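/- Let $\mathbf F_r$ be the free group with basis $B=\{x_1,\dots,x_r\}$ and let $w_1,\dots,w_\ell\in\mathbf F_r$ be words in reduced form. For a natural number $n$ put $$\mathrm{Tr}_{w_1,\dots,w_\ell}(n)=\int_{A_1,\dots,A_r\in U(n)}\mathrm{tr}\big(w_1(A_1,\dots,A_r)\big)\cdots \mathrm{tr}\big(w_\ell(A_1,\dots,A_r)\big)\,d\mu ,$$ where $\mu$ is the product of the Haar probability measures on the unitary group $U(n)$. For $x\in B$ let $L_x$ be the number of instances of $x^{+1}$ in $w_1,\dots,w_\ell$. The words are called balanced if, for every $x\in B$, the number of instances of $x^{-1}$ is also $L_x$. **Notation.** The Weingarten function $\mathrm{Wg}_L:S_L\to\mathbb Q(n)$ is the inverse, in the group ring $\mathbb Q(n)[S_L]$, of the function $\pi\mapsto n^{\#\mathrm{cycles}(\pi)}$ (fixed points are counted as cycles). For a permutation $\pi$ let $\mathrm{M\ddot ob}(\pi)=\mathrm{sgn}(\pi)\prod_C c_{|C|-1}$, the product over the cycles $C$ of $\pi$, with $c_m=\frac{(2m)!}{m!(m+1)!}$. Suppose that the words are balanced and that no $w_i$ is trivial. Let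 $\mathrm{Match}^{\kappa\equiv1}$ be the set of all $\sigma=(\sigma_{x,0},\sigma_{x,1})_{x\in B}$ where $\sigma_{x,0},\sigma_{x,1}$ are bijections from the instances of $x^{+1}$ to the instances of $x^{-1}$; let $\sigma_j$ ($j=0,1$) be the bijection from all positive letters to all negative letters with components $\sigma_{x,j}$. The surface $\Sigma_\sigma$ is the following CW-complex. For each $i$ take an oriented circle $S^1(w_i)$, cut by $|w_i|$ points, called $o$-points, into intervals corresponding to the letters of $w_i$ in cyclic order; on the interval of a letter $x^{\pm1}$ mark two further points, the $(x,0)$-point and the $(x,1)$-point, in this order along the circle if the exponent is $+1$ and in the reverse order if it is $-1$. For every $x$, every $j\in\{0,1\}$ and every instance $\lambda$ of $x^{+1}$ add an edge joining the $(x,j)$-points of $\lambda$ and of $\sigma_{x,j}(\lambda)$. Finally glue a disc along every cycle obtained by alternately following a circle in its orientation to its next $(x,j)$-point (for any $x$, $j$) and crossing the added edge at that point. A disc $D$ is an $o$-disc if every component of $\partial D\cap\partial\Sigma_\sigma$ contains an $o$-point. Let $\chi(\sigma)$ be the Euler characteristic of $\Sigma_\sigma$. **Theorem.** 1. If $w_1,\dots,w_\ell$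 are balanced and non-trivial and $n\ge L_x$ for every $x\in B$, then no value of the functions $\mathrm{Wg}_{L_x}$ has a pole at $n$, and $$\mathrm{Tr}_{w_1,\dots,w_\ell}(n)=\sum_{\sigma\in\mathrm{Match}^{\kappa\equiv1}}\Big(\prod_{x\in B}\mathrm{Wg}_{L_x}\big(\sigma_{x,0}^{-1}\sigma_{x,1}\big)\Big)\cdot n^{\#\{o\text{-discs in }\Sigma_\sigma\}} .$$ 2. For arbitrary words $w_1,\dots,w_\ell\in\mathbf F_r$ there is a rational function in $\mathbb Q(n)$ that has no pole at any $n\ge\max_{x\in B}L_x$ and equals $\mathrm{Tr}_{w_1,\dots,w_\ell}(n)$ for all these $n$. It is computable: for every $r$ there is an algorithm that, given $w_1,\dots,w_\ell$, returns the coefficients of two polynomials with integer coefficients, the second one non-zero, whose quotient is this rational function. 3. If $w_1,\dots,w_\ell$ are balanced and non-trivial and $\sigma\in\mathrm{Match}^{\kappa\equiv1}$, then the summand of $\sigma$ in the sum of part 1 is, as $n\to\infty$, $$\mathrm{M\ddot ob}\big(\sigma_0^{-1}\sigma_1\big)\cdot n^{\chi(\sigma)}+O\big(n^{\chi(\sigma)-2}\big).$$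 -/

import Mathlib

open scoped BigOperators

namespace UnitaryWords

/-! ### Haar measure on the unitary group and the expected product of traces -/

/-- The group `U(n)` of complex unitary matrices of size `n`. -/
abbrev U (n : ℕ) : Type := Matrix.unitaryGroup (Fin n) ℂ

/-- `U(n)` with its usual topology (convergence of the matrix entries) is compact. -/
instance instCompactSpaceU (n : ℕ) : CompactSpace (U n) := by
  refine isCompact_iff_compactSpace.mp ?_
  have hb : IsCompact (Set.pi Set.univ fun _ : Fin n =>
      Set.pi Set.univ fun _ : Fin n => Metric.closedBall (0 : ℂ) 1) :=
    isCompact_univ_pi fun _ => isCompact_univ_pi fun _ => isCompact_closedBall 0 1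
  refine IsCompact.of_isClosed_subset (s := (show Set (Matrix (Fin n) (Fin n) ℂ) from _)) hb ?_ ?_
  · have : ((Matrix.unitaryGroup (Fin n) ℂ : Submonoid (Matrix (Fin n) (Fin n) ℂ)) :
        Set (Matrix (Fin n) (Fin n) ℂ)) = {A | A * star A = 1} := by
      ext A
      exact Matrix.mem_unitaryGroup_iff
    rw [this]
    exact isClosed_eq (continuous_id.matrix_mul continuous_id.matrix_conjTranspose)
      continuous_const
  · intro A hA i _ j _
    simpa using entry_norm_bound_of_unitary hA i j

/-- The Borel σ-algebra of `U(n)`. -/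
noncomputable instance instMeasurableSpaceU (n : ℕ) : MeasurableSpace (U n) := borel _

instance instBorelSpaceU (n : ℕ) : BorelSpace (U n) := ⟨rfl⟩

/-- The Haar measure of total mass one on `U(n)`. -/
noncomputable def haarU (n : ℕ) : MeasureTheory.Measure (U n) :=
  MeasureTheory.Measure.haarMeasure ⊤

/-- The tuples of words `w₁, …, w_ℓ` in the free group with basis `x₀, …, x_{r-1}`. -/
abbrev Words (r ℓ : ℕ) : Type := Fin ℓ → FreeGroup (Fin r)

/-- `Tr_{w₁,…,w_ℓ}(n)`: the expectation of `∏ᵢ tr(wᵢ(A₁, …, A_r))` over independent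
Haar-distributed `A₁, …, A_r ∈ U(n)`. -/
noncomputable def Tr {r ℓ : ℕ} (w : Words r ℓ) (n : ℕ) : ℂ :=
  ∫ A : Fin r → U n,
    ∏ i, Matrix.trace (FreeGroup.lift A (w i) : Matrix (Fin n) (Fin n) ℂ)
    ∂(MeasureTheory.Measure.pi fun _ => haarU n)

/-! ### The Weingarten function and the Möbius function of a permutation -/

/-- The number of cycles of a permutation, fixed points included. -/
def numCycles {α : Type*} [Fintype α] [DecidableEq α] (π : Equiv.Perm α) : ℕ :=
  π.partition.parts.card

/-- The function `π ↦ n ^ #cycles(π)`, as an element of the group ring `ℚ(n)[Sym(α)]`. -/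
noncomputable def cyclesElement (α : Type*) [Fintype α] [DecidableEq α] :
    MonoidAlgebra (RatFunc ℚ) (Equiv.Perm α) :=
  ∑ π : Equiv.Perm α, MonoidAlgebra.single π ((RatFunc.X : RatFunc ℚ) ^ numCycles π)

/-- The Weingarten function `Wg_L` of the symmetric group of a finite set `α` with `L` elements:
the inverse, in the group ring `ℚ(n)[Sym(α)]`, of the function `π ↦ n ^ #cycles(π)`. -/
noncomputable def Wg {α : Type*} [Fintype α] [DecidableEq α] (π : Equiv.Perm α) : RatFunc ℚ :=
  (Ring.inverse (cyclesElement α)).coeff π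

/-- `Möb(π) = sgn(π) ∏ c_{|C|-1}`, the product running over the cycles `C` of `π`
(fixed points included), where `c_m` is the `m`-th Catalan number. -/
def moeb {α : Type*} [Fintype α] [DecidableEq α] (π : Equiv.Perm α) : ℤ :=
  (Equiv.Perm.sign π : ℤ) * ((π.partition.parts.map fun k => catalan (k - 1)).prod : ℕ)

/-- The value at the natural number `n` of a rational function in `ℚ(n)`
(meaningful when `HasNoPoleAt f n`). -/
noncomputable def evalAt (f : RatFunc ℚ) (n : ℕ) : ℚ := f.eval (RingHom.id ℚ) (n : ℚ)

/-- The rational function `f` has no pole at the natural number `n`. -/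
def HasNoPoleAt (f : RatFunc ℚ) (n : ℕ) : Prop := f.denom.eval (n : ℚ) ≠ 0

/-! ### Letters of the words and their matchings -/

/-- The places of the letters in the reduced words `w₁, …, w_ℓ`. -/
abbrev Pos {r ℓ : ℕ} (w : Words r ℓ) : Type := (i : Fin ℓ) × Fin (w i).toWord.length

section

variable {r ℓ : ℕ} (w : Words r ℓ)

/-- The letter at a place: `(x, true)` stands for `x` and `(x, false)` for `x⁻¹`. -/
def letter (p : Pos w) : Fin r × Bool := (w p.1).toWord.get p.2

/-- The instances of `x⁺¹` in `w₁, …, w_ℓ`. -/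
abbrev PosLetter (x : Fin r) : Type := {p : Pos w // letter w p = (x, true)}

/-- The instances of `x⁻¹` in `w₁, …, w_ℓ`. -/
abbrev NegLetter (x : Fin r) : Type := {p : Pos w // letter w p = (x, false)}

/-- `L_x`, the number of instances of `x⁺¹` in `w₁, …, w_ℓ`. -/
def L (x : Fin r) : ℕ := Fintype.card (PosLetter w x)

/-- Every letter `x` occurs in `w₁, …, w_ℓ` as often with exponent `+1` as with exponent `-1`. -/
def Balanced : Prop :=
  ∀ x, Fintype.card (PosLetter w x) = Fintype.card (NegLetter w x)

/-- The pairs of matchings: for every `x`, two bijections `σ_{x,0}`, `σ_{x,1}` from the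
instances of `x⁺¹` to the instances of `x⁻¹`. -/
abbrev MatchPairs : Type := (x : Fin r) → Fin 2 → (PosLetter w x ≃ NegLetter w x)

/-- The matching `σ_j = (σ_{x,j})_x` of all positive letters with the negative ones. -/
def fullMatch {w : Words r ℓ} (σ : MatchPairs w) (j : Fin 2) :
    ((x : Fin r) × PosLetter w x) ≃ ((x : Fin r) × NegLetter w x) :=
  Equiv.sigmaCongrRight fun x => σ x j

/-! ### The surface `Σ_σ`, as a CW-complex

The boundary consists of the oriented circles `S¹(w₁), …, S¹(w_ℓ)`.  The circle `S¹(wᵢ)` is cut by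
`|wᵢ|` `o`-points into intervals, which correspond to the letters of `wᵢ`, in cyclic order.  The
interval of a letter `x^{±1}` carries two further marked points `(x,0)` and `(x,1)`, in this
order if the exponent is `+1` and in reverse order if it is `-1`. -/

/-- The marked points of the circles with label `(x,j)`: `(p, j)` is the one on the interval of
the letter at the place `p`. -/
abbrev ZPoint : Type := Pos w × Fin 2

/-- The marked points of the circles (the vertices of `Σ_σ`): `Sum.inl p` is the `o`-point at the
beginning of the interval of the letter at `p`, and `Sum.inr` embeds the `z`-points. -/
abbrev MarkedPoint : Type := Pos w ⊕ ZPoint w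

/-- The place of the cyclically next letter of the same word. -/
def nextPos (p : Pos w) : Pos w := ⟨p.1, finRotate _ p.2⟩

/-- The label of the first `z`-point on the interval of the letter at `p`. -/
def firstZ (p : Pos w) : Fin 2 := if (letter w p).2 then 0 else 1

/-- The label of the last `z`-point on the interval of the letter at `p`. -/
def lastZ (p : Pos w) : Fin 2 := if (letter w p).2 then 1 else 0

/-- The next marked point along the oriented circle. -/
def nextPoint : MarkedPoint w → MarkedPoint w
  | Sum.inl p => Sum.inr (p, firstZ w p)
  | Sum.inr (p, j) => if j = lastZ w p then Sum.inl (nextPos w p) else Sum.inr (p, lastZ w p)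

/-- There is an `o`-point between the `z`-point `z` and the next `z`-point on its circle. -/
def HasOPointAfter (z : ZPoint w) : Prop := (nextPoint w (Sum.inr z)).isLeft = true

/-- The next `z`-point along the oriented circle. -/
def nextZPoint (z : ZPoint w) : ZPoint w :=
  match nextPoint w (Sum.inr z) with
  | Sum.inl p => (p, firstZ w p)
  | Sum.inr z' => z'

variable {w}

/-- The other end of the matching-edge at a `z`-point.  The matching-edges join, for all `x`, `j`
and every instance `p` of `x⁺¹`, the `(x,j)`-points on the intervals of `p` and `σ_{x,j}(p)`. -/
def mate (σ : MatchPairs w) (z : ZPoint w) : ZPoint w :=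
  match h : letter w z.1 with
  | (x, true) => ((σ x z.2 ⟨z.1, h⟩).1, z.2)
  | (x, false) => (((σ x z.2).symm ⟨z.1, h⟩).1, z.2)

/-- One step of the boundary walk of the 2-cells: from a `z`-point follow the oriented circle to the
next `z`-point and then cross the matching-edge there. This is a bijection of the `z`-points. -/
def walk (σ : MatchPairs w) (z : ZPoint w) : ZPoint w := mate σ (nextZPoint w z)

/-- The vertices of `Σ_σ`: the marked points. -/
abbrev Vertex (_σ : MatchPairs w) : Type := MarkedPoint w

/-- The edges of `Σ_σ`: the arcs of the circles between a marked point and the next one (labelled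
by the former), and the matching-edges. -/
abbrev Edge (_σ : MatchPairs w) : Type :=
  MarkedPoint w ⊕ ((x : Fin r) × Fin 2 × PosLetter w x)

/-- The 2-cells (discs) of `Σ_σ`, one for every cycle of the boundary walk. The boundary of the disc
of a cycle meets `∂Σ_σ` in the arcs from `z` to `nextZPoint w z`, for `z` in the cycle. -/
def Disc (σ : MatchPairs w) : Type := Quot fun z z' : ZPoint w => walk σ z = z'

/-- An `o`-disc is a disc `D` for which every component of `∂D ∩ ∂Σ_σ` contains an `o`-point. -/
def IsODisc {σ : MatchPairs w} (D : Disc σ) : Prop :=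
  ∀ z : ZPoint w, Quot.mk _ z = D → HasOPointAfter w z

/-- The number of `o`-discs in `Σ_σ`. -/
noncomputable def numODiscs (σ : MatchPairs w) : ℕ := Nat.card {D : Disc σ // IsODisc D}

/-- The Euler characteristic `χ(σ)` of the surface `Σ_σ`. -/
noncomputable def eulerChar (σ : MatchPairs w) : ℤ :=
  (Nat.card (Vertex σ) : ℤ) - Nat.card (Edge σ) + Nat.card (Disc σ)

/-- The summand of `σ`, evaluated at `n`: `∏_x Wg_{L_x}(σ_{x,0}⁻¹ σ_{x,1}) · n ^ #{o-discs}`. -/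
noncomputable def summand (σ : MatchPairs w) (n : ℕ) : ℚ :=
  (∏ x, evalAt (Wg ((σ x 1).trans (σ x 0).symm)) n) * (n : ℚ) ^ numODiscs σ

end

/-- The letters of the reduced words `w₁, …, w_ℓ`, as an input for an algorithm. -/
def wordsInput {r ℓ : ℕ} (w : Words r ℓ) : List (List (Fin r × Bool)) :=
  List.ofFn fun i => (w i).toWord

/-- The polynomial with the integer coefficients listed in `l`, constant coefficient first. -/
noncomputable def polyOfList (l : List ℤ) : Polynomial ℚ :=
  ∑ i : Fin l.length, Polynomial.C (l.get i : ℚ) * Polynomial.X ^ (i : ℕ)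

/-- The rational function `P / Q` given by the coefficient lists of two polynomials `P`, `Q`. -/
noncomputable def ratOfLists (c : List ℤ × List ℤ) : RatFunc ℚ :=
  algebraMap (Polynomial ℚ) (RatFunc ℚ) (polyOfList c.1) /
    algebraMap (Polynomial ℚ) (RatFunc ℚ) (polyOfList c.2)

end UnitaryWords

/-! Expanding every trace over matrix indices turns the integrand into a sum, over all assignments
`f` of an index in `Fin n` to each place, of products of matrix entries, conjugated for inverse
letters. A trivial word contributes only a factor `n`. By independence the integral of such a
product splits over the basis letters, and the Weingarten formula (`integral_kron_mul_star`)
evaluates each factor as a sum over pairs of bijections `σ_{x,0}`, `σ_{x,1}` with delta conditions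
on `f`. For fixed `σ` these conditions say that `f` is constant on the cycles of one permutation of
the places (`forall_cond_iff`). Its cycles are the `o`-discs (`numODiscs_eq`), so there are `n ^
#{o-discs}` such `f`. Unbalanced words have no matchings, and the same formula gives zero.

The Weingarten formula comes from Schur-Weyl duality in the stable range. By invariance of the Haar
measure, the matrix of mixed moments commutes with all tensor powers of unitary matrices. If `n` is
at least the number of tensor factors, it is then a combination of permutation operators
(`CommutesWithU.exists_coeff`). Unitarity gives a linear system for the coefficients, whose matrix
is the Gram matrix `n ^ #cycles(σ⁻¹ τ)`. Its quadratic form is a sum of squares, and an injective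
index map shows that it is definite (`gram_mulVec_injective`). Hence `Wg` is a row of the adjugate
of this matrix divided by its determinant, with no pole in the range.

For the asymptotics, the inverse relation yields a recursion for `Wg` under multiplication by
transpositions (`wgAt_recursion`). After normalisation by `n ^ (L + |π|)`, transpositions that split
a cycle have weight `1` and those that join two cycles have weight `n⁻²`. The limiting recursion is
the one that the Catalan recursion gives for the Möbius function (`moeb_recursion`), and the error
is `O(n⁻²)`. A count of cells (`eulerChar_eq`) identifies the resulting exponent with the Euler
characteristic.

For computability, places and matchings are encoded by numbers, and a search looks for a polynomial
matrix `V` and a polynomial `d ≠ 0` with `V * G = d * 1`, where `G` is the Gram matrix of all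
matchings. Checking a candidate is primitive recursive. The adjugate and the determinant provide one
candidate, and any candidate gives the same quotient `V / d`, whose entries are the products of
Weingarten functions. -/

namespace UnitaryWords

/-! ### Cycle statistics of permutations -/

section Cycles

variable {α β : Type*} [Fintype α] [DecidableEq α] [Fintype β] [DecidableEq β]

/-- The defect `∑ (|C| - 1)` over the cycles `C` of a permutation. -/
def defect (π : Equiv.Perm α) : ℕ := (π.cycleType.map fun k => k - 1).sum

/-- The product of Catalan numbers `∏ c_{|C|-1}` over the cycles `C` of a permutation. -/
def catProd (π : Equiv.Perm α) : ℕ := (π.cycleType.map fun k => catalan (k - 1)).prod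

/-- A cycle of length `k` accounts for `1 + (k - 1)` points. Statements on `numCycles` are reduced
in this way to `defect`, which ignores fixed points and hence depends on `cycleType` alone. -/
theorem numCycles_add_defect (π : Equiv.Perm α) : numCycles π + defect π = Fintype.card α := by
  have h1 : π.cycleType.card + defect π = π.cycleType.sum := by
    have h : ∀ s : Multiset ℕ, (∀ k ∈ s, 2 ≤ k) → s.card + (s.map fun k => k - 1).sum = s.sum := by
      intro s
      induction s using Multiset.induction with
      | empty => simp
      | cons a s ih =>
        intro hs
        have h1 := ih fun k hk => hs k (Multiset.mem_cons_of_mem hk)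
        have h2 := hs a (Multiset.mem_cons_self a s)
        simp only [Multiset.card_cons, Multiset.map_cons, Multiset.sum_cons]
        omega
    exact h _ fun k hk => Equiv.Perm.two_le_of_mem_cycleType hk
  have h2 := Equiv.Perm.sum_cycleType π
  have h3 : π.support.card ≤ Fintype.card α := Finset.card_le_univ _
  simp only [numCycles, Equiv.Perm.parts_partition, Multiset.card_add, Multiset.card_replicate]
  omega

theorem moeb_eq (π : Equiv.Perm α) : moeb π = (Equiv.Perm.sign π : ℤ) * (catProd π : ℤ) := by
  simp [moeb, catProd, Equiv.Perm.parts_partition, Multiset.map_replicate, Multiset.prod_replicate]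

theorem sign_eq_neg_one_pow_defect (π : Equiv.Perm α) :
    (Equiv.Perm.sign π : ℤ) = (-1) ^ defect π := by
  have h := numCycles_add_defect π
  have h2 := Equiv.Perm.sum_cycleType π
  have h3 : π.support.card ≤ Fintype.card α := Finset.card_le_univ _
  simp only [numCycles, Equiv.Perm.parts_partition, Multiset.card_add,
    Multiset.card_replicate] at h
  rw [Equiv.Perm.sign_of_cycleType]
  have : π.cycleType.sum + π.cycleType.card = defect π + 2 * π.cycleType.card := by omega
  rw [this, pow_add, pow_mul]
  simp

theorem defect_mul_of_disjoint {σ τ : Equiv.Perm α} (h : σ.Disjoint τ) :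
    defect (σ * τ) = defect σ + defect τ := by
  simp [defect, h.cycleType_mul]

theorem catProd_mul_of_disjoint {σ τ : Equiv.Perm α} (h : σ.Disjoint τ) :
    catProd (σ * τ) = catProd σ * catProd τ := by
  simp [catProd, h.cycleType_mul]

theorem defect_inv (π : Equiv.Perm α) : defect π⁻¹ = defect π := by
  simp [defect]

theorem defect_conj (σ π : Equiv.Perm α) : defect (σ * π * σ⁻¹) = defect π := by
  simp [defect]

theorem numCycles_inv (π : Equiv.Perm α) : numCycles π⁻¹ = numCycles π := by
  have h1 := numCycles_add_defect π
  have h2 := numCycles_add_defect π⁻¹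
  rw [defect_inv] at h2
  omega

theorem numCycles_conj (σ π : Equiv.Perm α) : numCycles (σ * π * σ⁻¹) = numCycles π := by
  have h1 := numCycles_add_defect π
  have h2 := numCycles_add_defect (σ * π * σ⁻¹)
  rw [defect_conj] at h2
  omega

theorem numCycles_mul_comm (σ π : Equiv.Perm α) : numCycles (σ * π) = numCycles (π * σ) := by
  rw [← numCycles_conj σ⁻¹ (σ * π)]
  congr 1
  group

/-- A permutation that is the identity off the image has no further nontrivial cycles. This serves
for the passage to `Option α`, for reindexing, and for a single summand of a sigma type. -/
theorem cycleType_eq_of_embedding (e : α ↪ β) (π : Equiv.Perm α) (π' : Equiv.Perm β)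
    (h : ∀ a, π' (e a) = e (π a)) (h' : ∀ b, b ∉ Set.range e → π' b = b) :
    π'.cycleType = π.cycleType := by
  classical
  have : π' = π.extendDomain (Equiv.ofInjective e e.injective) := by
    ext b
    by_cases hb : b ∈ Set.range e
    · obtain ⟨a, rfl⟩ := hb
      have := Equiv.Perm.extendDomain_apply_image π (Equiv.ofInjective e e.injective) a
      simp only [Equiv.ofInjective_apply] at this
      rw [h, this]
    · rw [h' b hb, Equiv.Perm.extendDomain_apply_not_subtype _ _ hb]
  rw [this, Equiv.Perm.cycleType_extendDomain]

theorem cycleType_optionCongr (π : Equiv.Perm α) :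
    Equiv.Perm.cycleType (Equiv.optionCongr π) = π.cycleType := by
  refine cycleType_eq_of_embedding Function.Embedding.some π _ (fun a => by simp) ?_
  rintro (_ | b) hb
  · simp
  · exact absurd ⟨b, rfl⟩ hb

theorem formPerm_cycleType {l : List α} (hl : l.Nodup) (h2 : 2 ≤ l.length) :
    l.formPerm.cycleType = {l.length} := by
  have hne : ∀ x, l ≠ [x] := by
    rintro x rfl
    simp at h2
  rw [(List.isCycle_formPerm hl h2).cycleType, List.support_formPerm_of_nodup _ hl hne,
    List.toFinset_card_of_nodup hl]

theorem defect_formPerm {x : α} {l : List α} (hl : (x :: l).Nodup) :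
    defect (x :: l).formPerm = l.length := by
  rcases l with _ | ⟨y, l⟩
  · simp [defect]
  · rw [defect, formPerm_cycleType hl (by simp)]
    simp

theorem catProd_formPerm {x : α} {l : List α} (hl : (x :: l).Nodup) :
    catProd (x :: l).formPerm = catalan l.length := by
  rcases l with _ | ⟨y, l⟩
  · simp [catProd]
  · rw [catProd, formPerm_cycleType hl (by simp)]
    simp

omit [Fintype α] in
theorem formPerm_disjoint {l : List α} {ρ : Equiv.Perm α} (h : ∀ y ∈ l, ρ y = y) :
    l.formPerm.Disjoint ρ := by
  intro y
  by_cases hy : y ∈ l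
  · exact Or.inr (h y hy)
  · exact Or.inl (List.formPerm_apply_of_notMem hy)

omit [Fintype α] in
-- The list form of the fact that a transposition joins two disjoint cycles. Multiplying by it once
-- more cuts the joined cycle apart.
theorem formPerm_append {x y : α} {l₁ l₂ : List α} (h : (x :: (l₁ ++ y :: l₂)).Nodup) :
    (x :: (l₁ ++ y :: l₂)).formPerm =
      Equiv.swap x y * ((x :: l₁).formPerm * (y :: l₂).formPerm) := by
  induction l₁ generalizing x with
  | nil => simp [List.formPerm_cons_cons]
  | cons z l₁ ih =>
    have hz : (z :: (l₁ ++ y :: l₂)).Nodup := by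
      simp only [List.cons_append, List.nodup_cons] at h ⊢
      exact h.2
    have hxz : x ≠ z := by
      rintro rfl
      simp at h
    have hxy : x ≠ y := by
      rintro rfl
      simp at h
    have hzy : z ≠ y := by
      rintro rfl
      simp at hz
    rw [List.cons_append, List.formPerm_cons_cons, ih hz, List.formPerm_cons_cons]
    have : Equiv.swap x z * Equiv.swap z y = Equiv.swap x y * Equiv.swap x z := by
      have := Equiv.mul_swap_eq_swap_mul (Equiv.swap x z) z y
      rw [Equiv.swap_apply_right, Equiv.swap_apply_of_ne_of_ne hxy.symm hzy.symm] at this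
      exact this
    simp only [← mul_assoc]
    rw [this]

omit [Fintype α] in
theorem swap_mul_formPerm_append {x y : α} {l₁ l₂ : List α} (h : (x :: (l₁ ++ y :: l₂)).Nodup) :
    Equiv.swap x y * (x :: (l₁ ++ y :: l₂)).formPerm =
      (x :: l₁).formPerm * (y :: l₂).formPerm := by
  rw [formPerm_append h, Equiv.swap_mul_self_mul]

/-- Splits off the cycle through `x`, written as a list that starts at `x`. A fixed point is the
case `l = []`, so later arguments need no case distinction. -/
theorem exists_formPerm_mul (π : Equiv.Perm α) (x : α) :
    ∃ (l : List α) (ρ : Equiv.Perm α), (x :: l).Nodup ∧ π = (x :: l).formPerm * ρ ∧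
      (∀ y ∈ x :: l, ρ y = y) ∧ ∀ y, y ∈ x :: l ↔ π.SameCycle x y := by
  by_cases hx : π x = x
  · refine ⟨[], π, by simp, by simp, by simpa using hx, fun y => ?_⟩
    rw [List.mem_singleton]
    constructor
    · rintro rfl
      exact Equiv.Perm.SameCycle.refl _ _
    · intro h
      exact ((h.eq_of_left hx).symm)
  · have hx' : x ∈ π.support := Equiv.Perm.mem_support.mpr hx
    obtain ⟨l, hl⟩ : ∃ l, π.toList x = x :: l := by
      have hne : π.toList x ≠ [] := by
        rw [Ne, Equiv.Perm.toList_eq_nil_iff]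
        simpa using hx
      have hh : (π.toList x)[0]'(List.length_pos_iff.mpr hne) = x :=
        Equiv.Perm.getElem_toList _ _ _ _
      rcases h : π.toList x with _ | ⟨z, l⟩
      · exact absurd h hne
      · simp only [h, List.getElem_cons_zero] at hh
        exact ⟨l, by rw [hh]⟩
    have hc : (x :: l).formPerm = π.cycleOf x := by
      rw [← hl, Equiv.Perm.formPerm_toList]
    have hm : ∀ y, y ∈ x :: l ↔ π.SameCycle x y := by
      intro y
      rw [← hl, Equiv.Perm.mem_toList_iff]
      exact ⟨fun h => h.1, fun h => ⟨h, hx'⟩⟩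
    refine ⟨l, (x :: l).formPerm⁻¹ * π, ?_, by group, ?_, hm⟩
    · rw [← hl]
      exact Equiv.Perm.nodup_toList π x
    · intro y hy
      rw [Equiv.Perm.mul_apply, Equiv.Perm.inv_eq_iff_eq, hc,
        ((hm y).mp hy).cycleOf_apply]

theorem defect_formPerm_mul {x : α} {l : List α} {ρ : Equiv.Perm α} (hl : (x :: l).Nodup)
    (h : ∀ y ∈ x :: l, ρ y = y) : defect ((x :: l).formPerm * ρ) = l.length + defect ρ := by
  rw [defect_mul_of_disjoint (formPerm_disjoint h), defect_formPerm hl]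

theorem catProd_formPerm_mul {x : α} {l : List α} {ρ : Equiv.Perm α} (hl : (x :: l).Nodup)
    (h : ∀ y ∈ x :: l, ρ y = y) :
    catProd ((x :: l).formPerm * ρ) = catalan l.length * catProd ρ := by
  rw [catProd_mul_of_disjoint (formPerm_disjoint h), catProd_formPerm hl]

/-- The transposition cuts the cycle just before `y`, leaving the cycles `x :: l₁` and `y :: l₂`,
which are disjoint from each other and from `ρ`. -/
theorem split_formPerm_mul {x y : α} {l₁ l₂ : List α} {ρ : Equiv.Perm α}
    (hl : (x :: (l₁ ++ y :: l₂)).Nodup) (h : ∀ z ∈ x :: (l₁ ++ y :: l₂), ρ z = z) :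
    defect (Equiv.swap x y * ((x :: (l₁ ++ y :: l₂)).formPerm * ρ)) =
        l₁.length + l₂.length + defect ρ ∧
      catProd (Equiv.swap x y * ((x :: (l₁ ++ y :: l₂)).formPerm * ρ)) =
        catalan l₁.length * catalan l₂.length * catProd ρ := by
  have h1 : (x :: l₁).Nodup := by
    refine hl.sublist ?_
    simp
  have h2 : (y :: l₂).Nodup := by
    refine hl.sublist ?_
    exact List.Sublist.cons _ (List.sublist_append_right _ _)
  have e : Equiv.swap x y * ((x :: (l₁ ++ y :: l₂)).formPerm * ρ) =
      (x :: l₁).formPerm * ((y :: l₂).formPerm * ρ) := by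
    rw [← mul_assoc, swap_mul_formPerm_append hl, mul_assoc]
  have f1 : ∀ z ∈ x :: l₁, ((y :: l₂).formPerm * ρ) z = z := by
    intro z hz
    rw [Equiv.Perm.mul_apply, h z (by simp at hz ⊢; tauto), List.formPerm_apply_of_notMem]
    intro hz'
    rw [← List.cons_append] at hl
    exact (List.disjoint_of_nodup_append hl) hz hz'
  have f2 : ∀ z ∈ y :: l₂, ρ z = z := fun z hz => h z (by simp at hz ⊢; tauto)
  rw [e, defect_formPerm_mul h1 f1, defect_formPerm_mul h2 f2, catProd_formPerm_mul h1 f1,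
    catProd_formPerm_mul h2 f2]
  exact ⟨by ring, by ring⟩

theorem defect_swap_mul_of_sameCycle {π : Equiv.Perm α} {x y : α} (hxy : x ≠ y)
    (h : π.SameCycle x y) : defect (Equiv.swap x y * π) + 1 = defect π := by
  obtain ⟨l, ρ, hl, rfl, hρ, hm⟩ := exists_formPerm_mul π x
  have hy : y ∈ l := by
    have := (hm y).mpr h
    simpa [hxy.symm] using this
  obtain ⟨l₁, l₂, rfl⟩ := List.append_of_mem hy
  rw [(split_formPerm_mul hl hρ).1, defect_formPerm_mul hl hρ]
  simp
  ring

/-- The cycles of `x` and of `y` are split off in turn. The list identity, read in the joining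
direction, merges them into one. -/
theorem defect_swap_mul_of_not_sameCycle {π : Equiv.Perm α} {x y : α}
    (h : ¬ π.SameCycle x y) : defect (Equiv.swap x y * π) = defect π + 1 := by
  have hxy : x ≠ y := by
    rintro rfl
    exact h (Equiv.Perm.SameCycle.refl _ _)
  obtain ⟨l₁, ρ, hl, rfl, hρ, hm⟩ := exists_formPerm_mul π x
  obtain ⟨l₂, ρ, hl₂, rfl, hρ₂, hm₂⟩ := exists_formPerm_mul ρ y
  have hdis : ∀ z ∈ x :: l₁, z ∉ y :: l₂ := by
    intro z hz hz2
    have h1 := ((hm₂ z).mp hz2).symm.eq_of_left (hρ z hz)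
    rw [h1] at hz
    exact h ((hm y).mp hz)
  have hnd : (x :: (l₁ ++ y :: l₂)).Nodup := by
    rw [← List.cons_append]
    exact List.Nodup.append hl hl₂ hdis
  have hρ' : ∀ z ∈ x :: (l₁ ++ y :: l₂), ρ z = z := by
    intro z hz
    rw [← List.cons_append, List.mem_append] at hz
    rcases hz with hz | hz
    · have := hρ z hz
      rw [Equiv.Perm.mul_apply] at this
      by_contra hne
      by_cases hz2 : ρ z ∈ y :: l₂
      · have h3 := hρ₂ _ hz2
        exact hne (ρ.injective h3)
      · rw [List.formPerm_apply_of_notMem hz2] at this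
        exact hne this
    · exact hρ₂ z hz
  have e : Equiv.swap x y * ((x :: l₁).formPerm * ((y :: l₂).formPerm * ρ)) =
      (x :: (l₁ ++ y :: l₂)).formPerm * ρ := by
    rw [formPerm_append hnd]
    simp only [mul_assoc]
  rw [e, defect_formPerm_mul hnd hρ', defect_formPerm_mul hl hρ, defect_formPerm_mul hl₂ hρ₂]
  simp
  ring

/-- This is the Catalan recursion: as `y` runs through the rest of the cycle of `x`, the two pieces
contribute `c_i * c_(m-i)`, where the cycle has `m + 2` points and contributes `c_(m+1)`. -/
theorem sum_catProd_swap_mul (π : Equiv.Perm α) (x : α) (hx : π x ≠ x) :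
    ∑ y ∈ Finset.univ.filter (fun y => y ≠ x ∧ π.SameCycle x y),
      catProd (Equiv.swap x y * π) = catProd π := by
  obtain ⟨l, ρ, hl, he, hρ, hm⟩ := exists_formPerm_mul π x
  have hxl : x ∉ l := (List.nodup_cons.mp hl).1
  have hnl : l.Nodup := (List.nodup_cons.mp hl).2
  have hs : Finset.univ.filter (fun y => y ≠ x ∧ π.SameCycle x y) = l.toFinset := by
    ext y
    rw [Finset.mem_filter, ← hm y, List.mem_toFinset, List.mem_cons]
    constructor
    · rintro ⟨-, h1, h2⟩
      exact h2.resolve_left h1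
    · intro h
      refine ⟨Finset.mem_univ _, ?_, Or.inr h⟩
      rintro rfl
      exact hxl h
  have hlen : l.length ≠ 0 := by
    intro h0
    rw [List.length_eq_zero_iff] at h0
    subst h0
    apply hx
    rw [he]
    simpa using hρ x
  obtain ⟨m, hlm⟩ := Nat.exists_eq_succ_of_ne_zero hlen
  rw [hs, List.sum_toFinset _ hnl, he, catProd_formPerm_mul hl hρ, ← he, hlm,
    Nat.succ_eq_add_one, catalan_succ, Finset.sum_mul]
  have : (List.map (fun y => catProd (Equiv.swap x y * π)) l) =
      List.ofFn fun i : Fin l.length => catProd (Equiv.swap x l[i] * π) := by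
    apply List.ext_getElem <;> simp
  rw [this, List.sum_ofFn]
  refine Fintype.sum_equiv (finCongr hlm) _ _ fun i => ?_
  -- The entry with index `i` plays the role of `y`, so the pieces have `i` and `m - i` points
  -- besides their heads.
  have hsplit : l = l.take i ++ l[i] :: l.drop (i + 1) := by simp
  have key := split_formPerm_mul (x := x) (y := l[i]) (l₁ := l.take i) (l₂ := l.drop (i + 1))
    (ρ := ρ) (by rwa [← hsplit]) (by rwa [← hsplit])
  rw [← hsplit, ← he] at key
  rw [key.2]
  simp only [finCongr_apply, Fin.val_cast, List.length_take, List.length_drop]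
  have hi := i.2
  rw [min_eq_left hi.le]
  congr 3
  omega

theorem sign_swap_mul {x y : α} (hxy : x ≠ y) (π : Equiv.Perm α) :
    (Equiv.Perm.sign (Equiv.swap x y * π) : ℤ) = -(Equiv.Perm.sign π : ℤ) := by
  rw [Equiv.Perm.sign_mul, Equiv.Perm.sign_swap hxy]
  simp

theorem moeb_optionCongr (π : Equiv.Perm α) :
    moeb (Equiv.optionCongr π : Equiv.Perm (Option α)) = moeb π := by
  rw [moeb_eq, moeb_eq, catProd, cycleType_optionCongr, sign_eq_neg_one_pow_defect, defect,
    cycleType_optionCongr, sign_eq_neg_one_pow_defect]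
  rfl

/-- The recursion for the Möbius function coming from the recursion of Catalan numbers. -/
theorem moeb_eq_neg_sum (π : Equiv.Perm α) (x : α) (hx : π x ≠ x) :
    moeb π = - ∑ y ∈ Finset.univ.filter (fun y => y ≠ x ∧ π.SameCycle x y),
      moeb (Equiv.swap x y * π) := by
  rw [moeb_eq, ← sum_catProd_swap_mul π x hx]
  push_cast
  rw [Finset.mul_sum, ← Finset.sum_neg_distrib]
  refine Finset.sum_congr rfl fun y hy => ?_
  rw [moeb_eq, sign_swap_mul (Finset.mem_filter.mp hy).2.1.symm]
  ring

/-! ### Counting functions which are constant on cycles -/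

theorem numCycles_optionCongr (π : Equiv.Perm α) :
    numCycles (Equiv.optionCongr π : Equiv.Perm (Option α)) = numCycles π + 1 := by
  have h1 := numCycles_add_defect π
  have h2 := numCycles_add_defect (Equiv.optionCongr π : Equiv.Perm (Option α))
  rw [defect, cycleType_optionCongr, ← defect, Fintype.card_option] at h2
  omega

theorem numCycles_swap_mul_optionCongr (π : Equiv.Perm α) (i : α) :
    numCycles (Equiv.swap none (some i) * (Equiv.optionCongr π : Equiv.Perm (Option α))) =
      numCycles π := by
  have h1 := numCycles_add_defect (Equiv.optionCongr π : Equiv.Perm (Option α))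
  have h2 := numCycles_add_defect
    (Equiv.swap none (some i) * (Equiv.optionCongr π : Equiv.Perm (Option α)))
  rw [defect_swap_mul_of_not_sameCycle] at h2
  · rw [numCycles_optionCongr] at h1
    omega
  · intro h
    have := h.eq_of_left (by simp [Function.IsFixedPt])
    simp at this

theorem numCycles_of_isEmpty [IsEmpty α] (π : Equiv.Perm α) : numCycles π = 0 := by
  have := numCycles_add_defect π
  rw [Fintype.card_eq_zero] at this
  omega

theorem numCycles_permCongr (e : α ≃ β) (π : Equiv.Perm α) :
    numCycles (e.permCongr π) = numCycles π := by
  have h1 := numCycles_add_defect π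
  have h2 := numCycles_add_defect (e.permCongr π)
  have : (e.permCongr π).cycleType = π.cycleType := by
    refine cycleType_eq_of_embedding e.toEmbedding _ _ (fun a => by simp) fun b hb => ?_
    exact absurd ⟨e.symm b, by simp⟩ hb
  rw [defect, this, ← defect, ← Fintype.card_congr e] at h2
  omega

end Cycles

/-- The new point `none` is a cycle of its own, and its value is free. -/
theorem card_invariant_optionCongr {α : Type*} [Fintype α] (π : Equiv.Perm α) (n : ℕ) :
    Nat.card {f : Option α → Fin n // ∀ a, f (Equiv.optionCongr π a) = f a} =
      n * Nat.card {f : α → Fin n // ∀ a, f (π a) = f a} := by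
  let e : {f : Option α → Fin n // ∀ a, f (Equiv.optionCongr π a) = f a} ≃
      Fin n × {f : α → Fin n // ∀ a, f (π a) = f a} :=
    { toFun := fun f => (f.1 none, ⟨fun a => f.1 (some a), fun a => by simpa using f.2 (some a)⟩)
      invFun := fun g => ⟨fun o => o.elim g.1 g.2.1, fun o => by
        rcases o with _ | a
        · simp
        · simpa using g.2.2 a⟩
      left_inv := fun f => by
        ext o
        rcases o with _ | a <;> simp
      right_inv := fun g => by simp }
  rw [Nat.card_congr e, Nat.card_prod, Nat.card_fin]

/-- Here `none` is inserted into the cycle of `i`, so its value is forced to be that at `some i`. -/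
theorem card_invariant_swap_mul_optionCongr {α : Type*} [Fintype α] [DecidableEq α]
    (π : Equiv.Perm α) (i : α) (n : ℕ) :
    Nat.card {f : Option α → Fin n // ∀ a, f ((Equiv.swap none (some i) *
        (Equiv.optionCongr π : Equiv.Perm (Option α))) a) = f a} =
      Nat.card {f : α → Fin n // ∀ a, f (π a) = f a} := by
  let e : {f : Option α → Fin n // ∀ a, f ((Equiv.swap none (some i) *
        (Equiv.optionCongr π : Equiv.Perm (Option α))) a) = f a} ≃
      {f : α → Fin n // ∀ a, f (π a) = f a} :=
    { toFun := fun f => ⟨fun a => f.1 (some a), fun a => by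
        have h0 := f.2 none
        have h1 := f.2 (some a)
        simp only [Equiv.Perm.mul_apply, Equiv.optionCongr_apply, Option.map_none, Option.map_some,
          Equiv.swap_apply_left] at h0 h1
        by_cases h : π a = i
        · rw [h, Equiv.swap_apply_right] at h1
          simp only [h, h0, h1]
        · rwa [Equiv.swap_apply_of_ne_of_ne (by simp) (by simpa using h)] at h1⟩
      invFun := fun g => ⟨fun o => o.elim (g.1 i) g.1, fun o => by
        rcases o with _ | a
        · simp
        · have h1 := g.2 a
          simp only [Equiv.Perm.mul_apply, Equiv.optionCongr_apply, Option.map_some]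
          by_cases h : π a = i
          · rw [h, Equiv.swap_apply_right]
            simp only [Option.elim]
            rw [← h1, h]
          · rw [Equiv.swap_apply_of_ne_of_ne (by simp) (by simpa using h)]
            exact h1⟩
      left_inv := fun f => by
        have h0 := f.2 none
        simp only [Equiv.Perm.mul_apply, Equiv.optionCongr_apply, Option.map_none,
          Equiv.swap_apply_left] at h0
        ext o
        rcases o with _ | a
        · simp [h0]
        · simp
      right_inv := fun g => by simp }
  exact Nat.card_congr e

theorem perm_option_cases {α : Type*} [DecidableEq α] (π : Equiv.Perm (Option α)) :
    (∃ σ : Equiv.Perm α, π = Equiv.optionCongr σ) ∨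
      ∃ (i : α) (σ : Equiv.Perm α), π = Equiv.swap none (some i) *
        (Equiv.optionCongr σ : Equiv.Perm (Option α)) := by
  have h := Equiv.Perm.decomposeOption.symm_apply_apply π
  generalize Equiv.Perm.decomposeOption π = p at h
  obtain ⟨_ | i, σ⟩ := p
  · left
    refine ⟨σ, h.symm.trans ?_⟩
    ext1 a
    simp
  · right
    exact ⟨i, σ, h.symm⟩

/-- There are `n ^ #cycles(π)` functions to `Fin n` which are invariant under `π`. -/
theorem card_invariant {α : Type*} [Fintype α] [DecidableEq α] (π : Equiv.Perm α) (n : ℕ) :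
    Nat.card {f : α → Fin n // ∀ a, f (π a) = f a} = n ^ numCycles π := by
  revert π
  -- The motive of the induction over finite types carries no decidable equality, so the classical
  -- instance is fixed inside and exchanged at the end.
  have key : ∀ (π : Equiv.Perm α), Nat.card {f : α → Fin n // ∀ a, f (π a) = f a} =
      n ^ @numCycles α _ (Classical.decEq α) π := by
    classical
    refine Fintype.induction_empty_option (P := fun α _ => ∀ (π : Equiv.Perm α),
      Nat.card {f : α → Fin n // ∀ a, f (π a) = f a} = n ^ @numCycles α _ (Classical.decEq α) π) ?_ ?_ ?_ α
    · intro α β _ e h π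
      let _ := Fintype.ofEquiv β e.symm
      rw [← Equiv.apply_symm_apply e.permCongr π, numCycles_permCongr]
      generalize e.permCongr.symm π = σ
      have h := h σ
      have hc : Nat.card {f : β → Fin n // ∀ a, f (e.permCongr σ a) = f a} =
          Nat.card {f : α → Fin n // ∀ a, f (σ a) = f a} := by
        refine Nat.card_congr ((Equiv.arrowCongr e.symm (Equiv.refl _)).subtypeEquiv fun f => ?_)
        simp only [Equiv.permCongr_apply, Equiv.arrowCongr_apply, Equiv.coe_refl, 
          Function.comp_apply, Equiv.symm_symm, id]
        rw [← e.forall_congr_right]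
        simp
      rw [hc]
      convert h
    · intro π
      rw [@numCycles_of_isEmpty _ _ (Classical.decEq _) _ π, pow_zero, Nat.card_eq_one_iff_unique]
      exact ⟨⟨fun f g => Subtype.ext (Subsingleton.elim _ _)⟩,
        ⟨⟨fun a => a.elim, fun a => a.elim⟩⟩⟩
    · intro α _ ih π
      rcases perm_option_cases π with ⟨σ, rfl⟩ | ⟨i, σ, rfl⟩
      · have := numCycles_optionCongr σ
        rw [card_invariant_optionCongr, ih]
        convert (pow_succ' n (numCycles σ)).symm using 2
        convert this
      · have := numCycles_swap_mul_optionCongr σ i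
        rw [card_invariant_swap_mul_optionCongr, ih]
        congr 1
        rw [← this]
        congr
  intro π
  convert key π

/-- Maps from the quotient to a two-element set are the invariant maps, so both numbers are
exponents of the same power of `2`. -/
theorem card_quot_eq_numCycles {α : Type*} [Fintype α] [DecidableEq α] (π : Equiv.Perm α) :
    Nat.card (Quot fun a b => π a = b) = numCycles π := by
  have h := card_invariant π 2
  let e : (Quot (fun a b => π a = b) → Fin 2) ≃ {f : α → Fin 2 // ∀ a, f (π a) = f a} :=
    { toFun := fun g => ⟨fun a => g (Quot.mk _ a), fun a => by
        exact congrArg g (Quot.sound (r := fun a b => π a = b) (show π a = π a from rfl)).symm⟩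
      invFun := fun f => Quot.lift f.1 fun a b hab => by rw [← hab, f.2]
      left_inv := fun g => by
        ext q
        induction q using Quot.ind
        rfl
      right_inv := fun f => rfl }
  rw [← Nat.card_congr e, Nat.card_fun, Nat.card_fin] at h
  exact Nat.pow_right_injective le_rfl h

/-! ### Permutations of a disjoint union that preserve the summands -/

section Sigma

variable {ι : Type*} [Fintype ι] [DecidableEq ι] {β : ι → Type*} [∀ i, Fintype (β i)]
  [∀ i, DecidableEq (β i)]

theorem cycleType_sigmaCongrRight (F : ∀ i, Equiv.Perm (β i)) :
    Equiv.Perm.cycleType (Equiv.Perm.sigmaCongrRight F) = ∑ i, (F i).cycleType := by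
  -- The components are switched on one at a time. Each new one is disjoint from the product of the
  -- earlier ones.
  have key : ∀ s : Finset ι,
      Equiv.Perm.cycleType (Equiv.Perm.sigmaCongrRight fun i => if i ∈ s then F i else 1) =
        ∑ i ∈ s, (F i).cycleType := by
    intro s
    induction s using Finset.induction with
    | empty =>
      have : (Equiv.Perm.sigmaCongrRight fun i => if i ∈ (∅ : Finset ι) then F i else 1) = 1 := by
        simp only [Finset.notMem_empty, if_false]
        exact Equiv.Perm.sigmaCongrRight_one
      rw [this]
      simp
    | insert i s his ih =>
      rw [Finset.sum_insert his, ← ih]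
      have h1 : (Equiv.Perm.sigmaCongrRight fun j => if j ∈ insert i s then F j else 1) =
          (Equiv.Perm.sigmaCongrRight (Pi.mulSingle i (F i))) *
            Equiv.Perm.sigmaCongrRight fun j => if j ∈ s then F j else 1 := by
        rw [Equiv.Perm.sigmaCongrRight_mul]
        congr 1
        ext1 j
        by_cases hj : j = i
        · subst hj
          simp [his]
        · simp [hj]
      have h2 : Equiv.Perm.cycleType (Equiv.Perm.sigmaCongrRight (Pi.mulSingle i (F i))) =
          (F i).cycleType := by
        refine cycleType_eq_of_embedding (Function.Embedding.sigmaMk i) _ _ (fun a => ?_) ?_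
        · simp
        · rintro ⟨j, a⟩ hj
          by_cases hji : j = i
          · subst hji
            exact absurd ⟨a, rfl⟩ hj
          · simp [hji]
      rw [h1, Equiv.Perm.Disjoint.cycleType_mul, h2]
      rintro ⟨j, a⟩
      by_cases hj : j = i
      · subst hj
        right
        simp [his]
      · left
        simp [hj]
  rw [← key]
  simp

theorem defect_sigmaCongrRight (F : ∀ i, Equiv.Perm (β i)) :
    defect (Equiv.Perm.sigmaCongrRight F) = ∑ i, defect (F i) := by
  have h : ∀ s : Finset ι, (Multiset.map (fun k => k - 1) (∑ i ∈ s, (F i).cycleType)).sum =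
      ∑ i ∈ s, (Multiset.map (fun k => k - 1) ((F i).cycleType)).sum := by
    intro s
    induction s using Finset.induction with
    | empty => simp
    | insert i s his ih => simp [Finset.sum_insert his, ih]
  rw [defect, cycleType_sigmaCongrRight, h]
  rfl

theorem moeb_sigmaCongrRight (F : ∀ i, Equiv.Perm (β i)) :
    moeb (Equiv.Perm.sigmaCongrRight F) = ∏ i, moeb (F i) := by
  simp only [moeb_eq, sign_eq_neg_one_pow_defect, defect_sigmaCongrRight, catProd,
    cycleType_sigmaCongrRight, Finset.prod_mul_distrib]
  rw [Finset.prod_pow_eq_pow_sum]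
  have h2 : ∀ s : Finset ι,
      (Multiset.map (fun k => catalan (k - 1)) (∑ i ∈ s, (F i).cycleType)).prod =
      ∏ i ∈ s, (Multiset.map (fun k => catalan (k - 1)) ((F i).cycleType)).prod := by
    intro s
    induction s using Finset.induction with
    | empty => simp
    | insert i s his ih => simp [Finset.sum_insert his, Finset.prod_insert his, ih]
  rw [h2]
  push_cast
  rfl

end Sigma

end UnitaryWords

namespace UnitaryWords

/-! ### Gram matrices of permutations -/

section Gram

variable {I α β : Type*} [Fintype I] [DecidableEq I] [Fintype α] [DecidableEq α] [Fintype β]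
  [DecidableEq β] {R : Type*} [CommRing R]

/-- The matrix with entries `x ^ #cycles(eᵢ⁻¹ eⱼ)`, for a family of bijections `eᵢ`. -/
def gram (e : I → α ≃ β) (x : R) : Matrix I I R :=
  Matrix.of fun i j => x ^ numCycles ((e j).trans (e i).symm)

omit [Fintype I] [DecidableEq I] [Fintype β] [DecidableEq β] in
-- Exhibits the entry as an inner product: for each `f`, the bijections `e i` and `e j` send `f` to
-- basis vectors, which are equal or orthogonal.
theorem gram_apply_eq_sum (e : I → α ≃ β) (n : ℕ) [DecidableEq (β → Fin n)] (i j : I) :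
    gram e (n : ℚ) i j =
      ∑ f : α → Fin n, if f ∘ (e i).symm = f ∘ (e j).symm then 1 else 0 := by
  have h := card_invariant ((e j).trans (e i).symm) n
  rw [gram, Matrix.of_apply, ← Nat.cast_pow, ← h, Finset.sum_boole, Nat.card_eq_fintype_card,
    Fintype.card_subtype]
  congr 3
  ext f
  constructor
  · intro h
    funext b
    have := h ((e j).symm b)
    simpa using this
  · intro h a
    have := congrFun h (e j a)
    simpa using this

omit [DecidableEq I] in
-- The quadratic form of the Gram matrix at `v` is the sum of squares in `h0`. For an injective `f`,
-- which exists as `card α ≤ n`, the maps `f ∘ (e i).symm` are distinct, so one of the squares is `v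
-- i ^ 2`.
theorem gram_mulVec_injective (e : I → α ≃ β) (he : Function.Injective e) {n : ℕ}
    (hn : Fintype.card α ≤ n) (v : I → ℚ) (hv : Matrix.mulVec (gram e (n : ℚ)) v = 0) : v = 0 := by
  have h0 : ∑ f : α → Fin n, ∑ g : β → Fin n,
      (∑ i, v i * if f ∘ (e i).symm = g then 1 else 0) ^ 2 = 0 := by
    have h1 : ∑ i, v i * Matrix.mulVec (gram e (n : ℚ)) v i = 0 := by simp [hv]
    have h2 : ∀ f : α → Fin n, ∑ g : β → Fin n,
        (∑ i, v i * if f ∘ (e i).symm = g then 1 else 0) ^ 2 =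
        ∑ i, ∑ j, v i * ((if f ∘ (e i).symm = f ∘ (e j).symm then 1 else 0) * v j) := by
      intro f
      simp only [sq, Finset.sum_mul_sum]
      rw [Finset.sum_comm]
      refine Finset.sum_congr rfl fun i _ => ?_
      rw [Finset.sum_comm]
      refine Finset.sum_congr rfl fun j _ => ?_
      rw [Finset.sum_eq_single (f ∘ (e i).symm)]
      · simp only [if_true, mul_one, mul_ite, mul_zero, ite_mul, one_mul, zero_mul]
        simp only [eq_comm]
      · intro g _ hg
        rw [if_neg hg.symm]
        simp
      · simp
    refine Eq.trans ?_ h1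
    rw [Finset.sum_congr rfl fun f _ => h2 f, Finset.sum_comm]
    refine Finset.sum_congr rfl fun i _ => ?_
    rw [Finset.sum_comm, Matrix.mulVec, dotProduct, Finset.mul_sum]
    refine Finset.sum_congr rfl fun j _ => ?_
    rw [gram_apply_eq_sum, Finset.sum_mul, Finset.mul_sum]
  obtain ⟨f⟩ : Nonempty (α ↪ Fin n) := by
    apply Function.Embedding.nonempty_of_card_le
    simpa using hn
  funext i
  have h1 := (Finset.sum_eq_zero_iff_of_nonneg (fun f _ =>
    Finset.sum_nonneg fun g _ => sq_nonneg _)).mp h0 f (Finset.mem_univ _)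
  have h2 := (Finset.sum_eq_zero_iff_of_nonneg (fun g _ => sq_nonneg _)).mp h1
    (f ∘ (e i).symm) (Finset.mem_univ _)
  have h3 := pow_eq_zero_iff (two_ne_zero) |>.mp h2
  rw [Finset.sum_eq_single i] at h3
  · simpa using h3
  · intro j _ hj
    rw [if_neg, mul_zero]
    intro h
    apply hj
    apply he
    have : (e j).symm = (e i).symm := by
      ext b
      exact f.injective (congrFun h b)
    simpa using congrArg Equiv.symm this
  · simp

theorem det_gram_ne_zero (e : I → α ≃ β) (he : Function.Injective e) {n : ℕ}
    (hn : Fintype.card α ≤ n) : (gram e (n : ℚ)).det ≠ 0 := by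
  intro h
  obtain ⟨v, hv, hv'⟩ := Matrix.exists_mulVec_eq_zero_iff.mpr h
  exact hv (gram_mulVec_injective e he hn v hv')

omit [Fintype I] [DecidableEq I] [Fintype β] [DecidableEq β] in
theorem gram_map {S : Type*} [CommRing S] (φ : R →+* S) (e : I → α ≃ β) (x : R) :
    (gram e x).map φ = gram e (φ x) := by
  ext i j
  simp [gram]

omit [Fintype β] [DecidableEq β] in
theorem eval_det_gram (e : I → α ≃ β) (n : ℕ) :
    (gram e (Polynomial.X : Polynomial ℚ)).det.eval (n : ℚ) = (gram e (n : ℚ)).det := by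
  have := RingHom.map_det (Polynomial.evalRingHom (n : ℚ)) (gram e (Polynomial.X : Polynomial ℚ))
  rw [Polynomial.coe_evalRingHom] at this
  rw [this, RingHom.mapMatrix_apply, gram_map]
  simp

/-- A polynomial is nonzero if one value is, and `n = card α` already lies in the range of
definiteness. -/
theorem det_gram_X_ne_zero (e : I → α ≃ β) (he : Function.Injective e) :
    (gram e (Polynomial.X : Polynomial ℚ)).det ≠ 0 := by
  intro h
  have h1 := eval_det_gram e (Fintype.card α)
  rw [h, Polynomial.eval_zero] at h1
  exact det_gram_ne_zero e he le_rfl h1.symm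

end Gram

/-! ### Values of rational functions -/

/-- The rational function `f` has no pole at `n`, and its value there is `c`. -/
def HasValueAt (f : RatFunc ℚ) (n : ℕ) (c : ℚ) : Prop := HasNoPoleAt f n ∧ evalAt f n = c

theorem HasValueAt.mul {f g : RatFunc ℚ} {n : ℕ} {c d : ℚ} (hf : HasValueAt f n c)
    (hg : HasValueAt g n d) : HasValueAt (f * g) n (c * d) := by
  refine ⟨fun h => ?_, ?_⟩
  · have := Polynomial.eval_eq_zero_of_dvd_of_eval_eq_zero (RatFunc.denom_mul_dvd f g) h
    rw [Polynomial.eval_mul] at this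
    exact mul_ne_zero hf.1 hg.1 this
  · rw [← hf.2, ← hg.2]
    exact RatFunc.eval_mul _ _ hf.1 hg.1

theorem HasValueAt.add {f g : RatFunc ℚ} {n : ℕ} {c d : ℚ} (hf : HasValueAt f n c)
    (hg : HasValueAt g n d) : HasValueAt (f + g) n (c + d) := by
  refine ⟨fun h => ?_, ?_⟩
  · have := Polynomial.eval_eq_zero_of_dvd_of_eval_eq_zero (RatFunc.denom_add_dvd f g) h
    rw [Polynomial.eval_mul] at this
    exact mul_ne_zero hf.1 hg.1 this
  · rw [← hf.2, ← hg.2]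
    exact RatFunc.eval_add _ _ hf.1 hg.1

theorem hasValueAt_algebraMap (p : Polynomial ℚ) (n : ℕ) :
    HasValueAt (algebraMap (Polynomial ℚ) (RatFunc ℚ) p) n (p.eval (n : ℚ)) := by
  refine ⟨?_, ?_⟩
  · simp [HasNoPoleAt]
  · simp [evalAt, Polynomial.eval₂_eq_eval_map]

theorem hasValueAt_one (n : ℕ) : HasValueAt 1 n 1 := by
  simpa using hasValueAt_algebraMap 1 n

theorem hasValueAt_zero (n : ℕ) : HasValueAt 0 n 0 := by
  simpa using hasValueAt_algebraMap 0 n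

theorem hasValueAt_X (n : ℕ) : HasValueAt RatFunc.X n n := by
  simpa using hasValueAt_algebraMap Polynomial.X n

theorem HasValueAt.pow {f : RatFunc ℚ} {n : ℕ} {c : ℚ} (hf : HasValueAt f n c) (k : ℕ) :
    HasValueAt (f ^ k) n (c ^ k) := by
  induction k with
  | zero => simpa using hasValueAt_one n
  | succ k ih =>
    rw [pow_succ, pow_succ]
    exact ih.mul hf

theorem HasValueAt.prod {ι : Type*} (s : Finset ι) {f : ι → RatFunc ℚ} {n : ℕ} {c : ι → ℚ}
    (hf : ∀ i ∈ s, HasValueAt (f i) n (c i)) : HasValueAt (∏ i ∈ s, f i) n (∏ i ∈ s, c i) := by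
  classical
  induction s using Finset.induction with
  | empty => simpa using hasValueAt_one n
  | insert i s his ih =>
    rw [Finset.prod_insert his, Finset.prod_insert his]
    exact (hf i (Finset.mem_insert_self i s)).mul
      (ih fun j hj => hf j (Finset.mem_insert_of_mem hj))

theorem HasValueAt.sum {ι : Type*} (s : Finset ι) {f : ι → RatFunc ℚ} {n : ℕ} {c : ι → ℚ}
    (hf : ∀ i ∈ s, HasValueAt (f i) n (c i)) : HasValueAt (∑ i ∈ s, f i) n (∑ i ∈ s, c i) := by
  classical
  induction s using Finset.induction with
  | empty => simpa using hasValueAt_zero n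
  | insert i s his ih =>
    rw [Finset.sum_insert his, Finset.sum_insert his]
    exact (hf i (Finset.mem_insert_self i s)).add
      (ih fun j hj => hf j (Finset.mem_insert_of_mem hj))

theorem hasValueAt_div (p q : Polynomial ℚ) (n : ℕ) (hq : q.eval (n : ℚ) ≠ 0) :
    HasValueAt (algebraMap (Polynomial ℚ) (RatFunc ℚ) p / algebraMap (Polynomial ℚ) (RatFunc ℚ) q)
      n (p.eval (n : ℚ) / q.eval (n : ℚ)) := by
  have hq0 : algebraMap (Polynomial ℚ) (RatFunc ℚ) q ≠ 0 := by
    rw [Ne, FaithfulSMul.algebraMap_eq_zero_iff]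
    rintro rfl
    simp at hq
  have h1 : HasNoPoleAt
      (algebraMap (Polynomial ℚ) (RatFunc ℚ) p / algebraMap (Polynomial ℚ) (RatFunc ℚ) q) n :=
    fun h => hq (Polynomial.eval_eq_zero_of_dvd_of_eval_eq_zero (RatFunc.denom_div_dvd p q) h)
  refine ⟨h1, ?_⟩
  have h2 := HasValueAt.mul ⟨h1, rfl⟩ (hasValueAt_algebraMap q n)
  rw [div_mul_cancel₀ _ hq0] at h2
  rw [eq_div_iff hq, ← h2.2, (hasValueAt_algebraMap p n).2]

/-! ### The Weingarten function at a natural number -/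

section Weingarten

variable {α : Type*} [Fintype α] [DecidableEq α]

/-- The Gram matrix of all permutations. -/
noncomputable def permGram (α : Type*) [Fintype α] [DecidableEq α] :
    Matrix (Equiv.Perm α) (Equiv.Perm α) (Polynomial ℚ) :=
  gram (fun σ : Equiv.Perm α => σ) Polynomial.X

/-- The value of the Weingarten function at `n`. -/
noncomputable def wgAt (n : ℕ) (π : Equiv.Perm α) : ℚ :=
  ((permGram α).adjugate 1 π).eval (n : ℚ) / (permGram α).det.eval (n : ℚ)

theorem permGram_apply (σ τ : Equiv.Perm α) :
    permGram α σ τ = Polynomial.X ^ numCycles (σ⁻¹ * τ) := rfl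

/-- The entries of the Gram matrix depend only on `σ⁻¹ τ`, so the matrix is a convolution operator
and the row at `1` of its adjugate determines the convolution inverse up to the determinant. -/
theorem sum_adjugate_mul (τ : Equiv.Perm α) :
    ∑ σ, (permGram α).adjugate 1 σ * Polynomial.X ^ numCycles (σ⁻¹ * τ) =
      if τ = 1 then (permGram α).det else 0 := by
  have h := congrFun (congrFun (Matrix.adjugate_mul (permGram α)) 1) τ
  rw [Matrix.mul_apply] at h
  simp only [permGram_apply] at h
  rw [h]
  simp [Matrix.one_apply, eq_comm]

theorem eval_det_permGram_ne_zero {n : ℕ} (hn : Fintype.card α ≤ n) :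
    (permGram α).det.eval (n : ℚ) ≠ 0 := by
  rw [permGram, eval_det_gram]
  exact det_gram_ne_zero _ (fun _ _ h => h) hn

theorem sum_wgAt_mul {n : ℕ} (hn : Fintype.card α ≤ n) (τ : Equiv.Perm α) :
    ∑ σ, wgAt n σ * (n : ℚ) ^ numCycles (σ⁻¹ * τ) = if τ = 1 then 1 else 0 := by
  have h := congrArg (Polynomial.eval (n : ℚ)) (sum_adjugate_mul τ)
  have hd := eval_det_permGram_ne_zero hn
  simp only [Polynomial.eval_finsetSum, Polynomial.eval_mul, Polynomial.eval_pow,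
    Polynomial.eval_X] at h
  simp only [wgAt, div_mul_eq_mul_div, ← Finset.sum_div, h]
  split_ifs
  · exact div_self hd
  · simp

/-- The tool for identities between values of `wgAt`: it suffices to compare the convolutions with
`n ^ #cycles`, where the defining relation applies. -/
theorem eq_of_sum_mul_pow_eq {n : ℕ} (hn : Fintype.card α ≤ n) {f g : Equiv.Perm α → ℚ}
    (h : ∀ τ : Equiv.Perm α, ∑ σ, f σ * (n : ℚ) ^ numCycles (σ⁻¹ * τ) =
      ∑ σ, g σ * (n : ℚ) ^ numCycles (σ⁻¹ * τ)) : f = g := by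
  have := gram_mulVec_injective (fun σ : Equiv.Perm α => σ) (fun _ _ h => h) hn (f - g) (by
    funext τ
    have h := h τ
    rw [← sub_eq_zero, ← Finset.sum_sub_distrib] at h
    rw [Pi.zero_apply, ← h]
    refine Finset.sum_congr rfl fun σ _ => ?_
    rw [Pi.sub_apply, ← sub_mul, mul_comm]
    congr 1
    change (n : ℚ) ^ numCycles (τ⁻¹ * σ) = _
    rw [← numCycles_inv, mul_inv_rev, inv_inv])
  exact sub_eq_zero.mp this

/-- Inversion preserves the number of cycles, so `π ↦ wgAt n π⁻¹` solves the same convolution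
equation. -/
theorem wgAt_inv {n : ℕ} (hn : Fintype.card α ≤ n) (π : Equiv.Perm α) :
    wgAt n π⁻¹ = wgAt n π := by
  refine congrFun (eq_of_sum_mul_pow_eq hn (f := fun π => wgAt n π⁻¹) fun τ => ?_) π
  rw [sum_wgAt_mul hn, ← Equiv.sum_comp (Equiv.inv (Equiv.Perm α))]
  have h := sum_wgAt_mul hn (τ⁻¹)
  simp only [inv_eq_one] at h
  rw [← h]
  refine Finset.sum_congr rfl fun σ _ => ?_
  simp only [Equiv.inv_apply, inv_inv]
  rw [← numCycles_inv (σ * τ), mul_inv_rev, numCycles_mul_comm]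

theorem wg_eq_div (π : Equiv.Perm α) :
    Wg π = algebraMap (Polynomial ℚ) (RatFunc ℚ) ((permGram α).adjugate 1 π) /
      algebraMap (Polynomial ℚ) (RatFunc ℚ) (permGram α).det := by
  have hd : algebraMap (Polynomial ℚ) (RatFunc ℚ) (permGram α).det ≠ 0 := by
    rw [Ne, FaithfulSMul.algebraMap_eq_zero_iff]
    exact det_gram_X_ne_zero _ (fun _ _ h => h)
  set d := algebraMap (Polynomial ℚ) (RatFunc ℚ) (permGram α).det with hdd
  let v : Equiv.Perm α → RatFunc ℚ := fun σ =>
    algebraMap (Polynomial ℚ) (RatFunc ℚ) ((permGram α).adjugate 1 σ) / d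
  let W : MonoidAlgebra (RatFunc ℚ) (Equiv.Perm α) := ∑ σ, MonoidAlgebra.single σ (v σ)
  have hv : ∀ τ : Equiv.Perm α, ∑ σ, v σ * (RatFunc.X : RatFunc ℚ) ^ numCycles (σ⁻¹ * τ) =
      if τ = 1 then 1 else 0 := by
    intro τ
    have h := congrArg (algebraMap (Polynomial ℚ) (RatFunc ℚ)) (sum_adjugate_mul τ)
    simp only [map_sum, map_mul, map_pow, RatFunc.algebraMap_X] at h
    simp only [v, div_mul_eq_mul_div, ← Finset.sum_div, h]
    split_ifs
    · exact div_self hd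
    · simp
  have h1 : W * cyclesElement α = 1 := by
    simp only [W, cyclesElement, Finset.sum_mul, Finset.mul_sum, MonoidAlgebra.single_mul_single]
    have h2 : ∀ σ : Equiv.Perm α, ∑ π : Equiv.Perm α,
        MonoidAlgebra.single (σ * π) (v σ * (RatFunc.X : RatFunc ℚ) ^ numCycles π) =
        ∑ τ : Equiv.Perm α,
          MonoidAlgebra.single τ (v σ * (RatFunc.X : RatFunc ℚ) ^ numCycles (σ⁻¹ * τ)) := by
      intro σ
      rw [← Equiv.sum_comp (Equiv.mulLeft σ) fun τ =>
        MonoidAlgebra.single τ (v σ * (RatFunc.X : RatFunc ℚ) ^ numCycles (σ⁻¹ * τ))]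
      simp
    rw [Finset.sum_comm, Finset.sum_congr rfl fun σ _ => h2 σ, Finset.sum_comm]
    have h3 : ∀ τ : Equiv.Perm α, ∑ σ : Equiv.Perm α,
        MonoidAlgebra.single τ (v σ * (RatFunc.X : RatFunc ℚ) ^ numCycles (σ⁻¹ * τ)) =
        if τ = 1 then (1 : MonoidAlgebra (RatFunc ℚ) (Equiv.Perm α)) else 0 := by
      intro τ
      have : ∑ σ : Equiv.Perm α,
        MonoidAlgebra.single τ (v σ * (RatFunc.X : RatFunc ℚ) ^ numCycles (σ⁻¹ * τ)) =
          MonoidAlgebra.single τ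
            (∑ σ : Equiv.Perm α, v σ * (RatFunc.X : RatFunc ℚ) ^ numCycles (σ⁻¹ * τ)) :=
        (map_sum (MonoidAlgebra.singleAddHom τ) _ _).symm
      rw [this, hv]
      split_ifs with h
      · rw [h]
        rfl
      · simp
    rw [Finset.sum_congr rfl fun τ _ => h3 τ]
    simp
  -- The number of cycles is a class function, so `cyclesElement α` is central and a left inverse is
  -- also a right inverse.
  have h2 : cyclesElement α * W = 1 := by
    rw [← h1]
    simp only [W, Finset.sum_mul, Finset.mul_sum]
    refine Finset.sum_congr rfl fun σ _ => ?_
    simp only [cyclesElement, Finset.sum_mul, Finset.mul_sum, MonoidAlgebra.single_mul_single]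
    rw [← Equiv.sum_comp (MulAut.conj σ).toEquiv]
    refine Finset.sum_congr rfl fun π _ => ?_
    simp only [MulEquiv.toEquiv_eq_coe, MulEquiv.coe_toEquiv, MulAut.conj_apply, numCycles_conj]
    rw [mul_comm (v σ)]
    congr 1
    group
  have h3 : Ring.inverse (cyclesElement α) = W :=
    Ring.inverse_unit (⟨cyclesElement α, W, h2, h1⟩ : (MonoidAlgebra (RatFunc ℚ) (Equiv.Perm α))ˣ)
  rw [Wg, h3]
  simp only [W, MonoidAlgebra.coeff_sum, MonoidAlgebra.coeff_single, Finsupp.coe_finsetSum,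
    Finset.sum_apply, Finsupp.single_apply]
  simp [v]

theorem hasValueAt_wg {n : ℕ} (hn : Fintype.card α ≤ n) (π : Equiv.Perm α) :
    HasValueAt (Wg π) n (wgAt n π) := by
  rw [wg_eq_div]
  exact hasValueAt_div _ _ n (eval_det_permGram_ne_zero hn)

end Weingarten

end UnitaryWords

namespace UnitaryWords

/-! ### Asymptotics of the Weingarten function -/

section Asymptotics

open Filter Asymptotics

variable {α β : Type*} [Fintype α] [DecidableEq α] [Fintype β] [DecidableEq β]

theorem sum_wgAt_mul_left {n : ℕ} (hn : Fintype.card α ≤ n) (s τ : Equiv.Perm α) :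
    ∑ σ, wgAt n (s * σ) * (n : ℚ) ^ numCycles (σ⁻¹ * τ) = if s * τ = 1 then 1 else 0 := by
  rw [← sum_wgAt_mul hn, ← Equiv.sum_comp (Equiv.mulLeft s)
    fun σ => wgAt n σ * (n : ℚ) ^ numCycles (σ⁻¹ * (s * τ))]
  refine Finset.sum_congr rfl fun σ _ => ?_
  simp only [Equiv.coe_mulLeft, mul_inv_rev, mul_assoc]
  rw [inv_mul_cancel_left]

theorem sum_perm_option {M : Type*} [AddCommMonoid M] (g : Equiv.Perm (Option α) → M)
    (hg : ∀ σ, σ none ≠ none → g σ = 0) :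
    ∑ σ, g σ = ∑ σ : Equiv.Perm α, g (Equiv.optionCongr σ) := by
  rw [← Equiv.sum_comp Equiv.Perm.decomposeOption.symm, Fintype.sum_prod_type,
    Fintype.sum_option, Finset.sum_eq_zero (s := (Finset.univ : Finset α)), add_zero]
  · refine Finset.sum_congr rfl fun σ _ => ?_
    congr 1
    ext1 a
    simp
  · intro i _
    refine Finset.sum_eq_zero fun σ _ => hg _ ?_
    simp

omit [Fintype α] [DecidableEq α] in
theorem optionCongr_mul (σ τ : Equiv.Perm α) :
    (Equiv.optionCongr (σ * τ) : Equiv.Perm (Option α)) =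
      (Equiv.optionCongr σ : Equiv.Perm (Option α)) * (Equiv.optionCongr τ) := by
  ext1 a
  rcases a with _ | a <;> simp

omit [Fintype α] [DecidableEq α] in
theorem optionCongr_inv (σ : Equiv.Perm α) :
    (Equiv.optionCongr σ⁻¹ : Equiv.Perm (Option α)) =
      (Equiv.optionCongr σ : Equiv.Perm (Option α))⁻¹ := by
  rw [eq_inv_iff_mul_eq_one, ← optionCongr_mul, inv_mul_cancel]
  ext1 a
  simp

omit [Fintype α] [DecidableEq α] in
theorem optionCongr_eq_one_iff (σ : Equiv.Perm α) :
    (Equiv.optionCongr σ : Equiv.Perm (Option α)) = 1 ↔ σ = 1 := by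
  rw [← Equiv.optionCongr_injective.eq_iff (a := σ)]
  constructor
  · intro h
    rw [h]
    ext1 a
    simp
  · intro h
    rw [h]
    ext1 a
    simp

/-- The recursion for the Weingarten function on the fixed points of `none`. -/
theorem wgAt_recursion {n : ℕ} (hn : Fintype.card (Option α) ≤ n) (π : Equiv.Perm (Option α)) :
    (n : ℚ) * wgAt n π + ∑ i : α, wgAt n (Equiv.swap none (some i) * π) =
      if π none = none then wgAt n (Equiv.removeNone π : Equiv.Perm α) else 0 := by
  have hn' : Fintype.card α ≤ n := by
    rw [Fintype.card_option] at hn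
    omega
  refine congrFun (eq_of_sum_mul_pow_eq hn (f := fun π => (n : ℚ) * wgAt n π +
    ∑ i : α, wgAt n (Equiv.swap none (some i) * π)) (g := fun π =>
    if π none = none then wgAt n (Equiv.removeNone π : Equiv.Perm α) else 0) fun τ => ?_) π
  -- Convolving the left side with the Gram function leaves only delta functions: at `1` with factor
  -- `n`, and at every transposition that moves `none`.
  have hL : ∑ σ : Equiv.Perm (Option α), ((n : ℚ) * wgAt n σ +
      ∑ i : α, wgAt n (Equiv.swap none (some i) * σ)) * (n : ℚ) ^ numCycles (σ⁻¹ * τ) =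
      (n : ℚ) * (if τ = 1 then 1 else 0) +
        ∑ i : α, if Equiv.swap none (some i) * τ = 1 then 1 else 0 := by
    simp only [add_mul, Finset.sum_mul, Finset.sum_add_distrib]
    rw [← sum_wgAt_mul hn, Finset.mul_sum, Finset.sum_comm]
    congr 1
    · refine Finset.sum_congr rfl fun σ _ => by ring
    · refine Finset.sum_congr rfl fun i _ => ?_
      exact sum_wgAt_mul_left hn _ _
  rw [hL, sum_perm_option _ (fun σ hσ => by rw [if_neg hσ, zero_mul])]
  simp only [Equiv.optionCongr_apply, Option.map_none, if_true, Equiv.removeNone_optionCongr]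
  -- The right side is supported on permutations that fix `none`. If `τ` fixes `none`, this point is
  -- an extra cycle and yields the factor `n`. Otherwise `none` is inserted into another cycle, no
  -- factor appears, and only the transposition with `i = j` survives on the left.
  rcases perm_option_cases τ with ⟨τ, rfl⟩ | ⟨j, τ, rfl⟩
  · simp only [← optionCongr_inv, ← optionCongr_mul, numCycles_optionCongr, pow_succ,
      ← mul_assoc, ← Finset.sum_mul, sum_wgAt_mul hn', optionCongr_eq_one_iff]
    rw [Finset.sum_eq_zero, add_zero, mul_comm]
    intro i _
    rw [if_neg]
    intro h
    have := congrArg (fun f : Equiv.Perm (Option α) => f none) h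
    simp at this
  · have h1 : ∀ σ : Equiv.Perm α, numCycles ((Equiv.optionCongr σ : Equiv.Perm (Option α))⁻¹ *
        (Equiv.swap none (some j) * (Equiv.optionCongr τ : Equiv.Perm (Option α)))) =
        numCycles (σ⁻¹ * τ) := by
      intro σ
      rw [numCycles_mul_comm, mul_assoc, ← optionCongr_inv, ← optionCongr_mul,
        numCycles_swap_mul_optionCongr, numCycles_mul_comm]
    simp only [h1, sum_wgAt_mul hn']
    rw [if_neg, mul_zero, zero_add, Finset.sum_eq_single j]
    · rw [← mul_assoc, Equiv.swap_mul_self, one_mul]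
      simp only [optionCongr_eq_one_iff]
    · intro i _ hij
      rw [if_neg]
      intro h
      have := congrArg (fun f : Equiv.Perm (Option α) => f none) h
      simp only [Equiv.Perm.mul_apply, Equiv.optionCongr_apply, Option.map_none,
        Equiv.swap_apply_left, Equiv.Perm.one_apply] at this
      rw [Equiv.swap_apply_of_ne_of_ne (by simp) (by simpa using hij.symm)] at this
      simp at this
    · simp
    · intro h
      have := congrArg (fun f : Equiv.Perm (Option α) => f none) h
      simp at this

/-- The recursion of `wgNorm_recursion` with the weights `n⁻²` replaced by `0`. If `none` is fixed
it is simply dropped, and otherwise this is the Catalan recursion. -/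
theorem moeb_recursion (π : Equiv.Perm (Option α)) :
    moeb π = (if π none = none then moeb (Equiv.removeNone π : Equiv.Perm α) else 0) -
      ∑ i : α, if π.SameCycle none (some i) then moeb (Equiv.swap none (some i) * π) else 0 := by
  by_cases h : π none = none
  · have h1 : ∀ i : α, ¬ π.SameCycle none (some i) := by
      intro i hi
      have := hi.eq_of_left h
      simp at this
    simp only [h, if_true, h1, if_false, Finset.sum_const_zero, sub_zero]
    rcases perm_option_cases π with ⟨σ, rfl⟩ | ⟨i, σ, rfl⟩
    · rw [Equiv.removeNone_optionCongr, moeb_optionCongr]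
    · simp at h
  · rw [if_neg h, moeb_eq_neg_sum π none h, Finset.sum_filter, Fintype.sum_option]
    simp

theorem wgAt_permCongr (e : α ≃ β) {n : ℕ} (hn : Fintype.card α ≤ n) (π : Equiv.Perm α) :
    wgAt n (e.permCongr π) = wgAt n π := by
  refine congrFun (eq_of_sum_mul_pow_eq hn (f := fun π => wgAt n (e.permCongr π)) fun τ => ?_) π
  rw [sum_wgAt_mul hn]
  have hn' : Fintype.card β ≤ n := by rwa [← Fintype.card_congr e]
  have h := sum_wgAt_mul hn' (e.permCongr τ)
  have h1 : e.permCongr τ = 1 ↔ τ = 1 := by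
    rw [← (e.permCongr).injective.eq_iff (a := τ)]
    have : e.permCongr (1 : Equiv.Perm α) = 1 := by
      ext1 a
      simp
    rw [this]
  simp only [h1] at h
  rw [← h, ← Equiv.sum_comp e.permCongr]
  refine Finset.sum_congr rfl fun σ _ => ?_
  rw [← numCycles_permCongr e]
  congr 3
  exact (map_mul e.permCongrHom _ _).trans (by rw [map_inv]; rfl)

theorem moeb_permCongr (e : α ≃ β) (π : Equiv.Perm α) : moeb (e.permCongr π) = moeb π := by
  have h : (e.permCongr π).cycleType = π.cycleType := by
    refine cycleType_eq_of_embedding e.toEmbedding _ _ (fun a => by simp) fun b hb => ?_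
    exact absurd ⟨e.symm b, by simp⟩ hb
  rw [moeb_eq, moeb_eq, sign_eq_neg_one_pow_defect, sign_eq_neg_one_pow_defect, defect, catProd, h]
  rfl

/-- The normalised Weingarten function `n ^ (L + |π|) Wg(π)`. -/
noncomputable def wgNorm (n : ℕ) (π : Equiv.Perm α) : ℝ :=
  (n : ℝ) ^ (Fintype.card α + defect π) * (wgAt n π : ℝ)

/-- `wgAt_recursion` multiplied by `n ^ (card α + |π|)`. A transposition within a cycle lowers the
defect by one, which the extra point of `Option α` compensates. A transposition that joins two
cycles raises the defect, which costs `n⁻²`. -/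
theorem wgNorm_recursion {n : ℕ} (hn : Fintype.card (Option α) ≤ n)
    (π : Equiv.Perm (Option α)) :
    wgNorm n π = (if π none = none then wgNorm n (Equiv.removeNone π : Equiv.Perm α) else 0) -
      ∑ i : α, (if π.SameCycle none (some i) then 1 else ((n : ℝ) ^ 2)⁻¹) *
        wgNorm n (Equiv.swap none (some i) * π) := by
  have hn0 : (n : ℝ) ≠ 0 := by
    rw [Fintype.card_option] at hn
    exact_mod_cast (by omega : n ≠ 0)
  have h := congrArg (fun q : ℚ => (n : ℝ) ^ (Fintype.card α + defect π) * (q : ℝ))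
    (wgAt_recursion hn π)
  simp only [Rat.cast_add, Rat.cast_mul, Rat.cast_natCast, Rat.cast_sum, mul_add,
    Finset.mul_sum] at h
  have h1 : (n : ℝ) ^ (Fintype.card α + defect π) * ((n : ℝ) * (wgAt n π : ℝ)) = wgNorm n π := by
    rw [wgNorm, Fintype.card_option]
    ring
  have h2 : ∀ i : α, (n : ℝ) ^ (Fintype.card α + defect π) *
      (wgAt n (Equiv.swap none (some i) * π) : ℝ) =
      (if π.SameCycle none (some i) then 1 else ((n : ℝ) ^ 2)⁻¹) *
        wgNorm n (Equiv.swap none (some i) * π) := by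
    intro i
    rw [wgNorm, Fintype.card_option]
    split_ifs with hi
    · rw [← defect_swap_mul_of_sameCycle (by simp) hi]
      ring
    · rw [defect_swap_mul_of_not_sameCycle hi]
      field_simp
      ring
  have h3 : (n : ℝ) ^ (Fintype.card α + defect π) * (((if π none = none then
      wgAt n (Equiv.removeNone π : Equiv.Perm α) else 0 : ℚ)) : ℝ) =
      if π none = none then wgNorm n (Equiv.removeNone π : Equiv.Perm α) else 0 := by
    split_ifs with h0
    · have : defect (Equiv.removeNone π : Equiv.Perm α) = defect π := by
        rcases perm_option_cases π with ⟨σ, rfl⟩ | ⟨i, σ, rfl⟩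
        · rw [Equiv.removeNone_optionCongr, defect, defect, cycleType_optionCongr]
        · simp at h0
      rw [wgNorm, this]
    · simp
  rw [h1, h3, Finset.sum_congr rfl fun i _ => h2 i] at h
  linarith

/-- An a priori bound by induction on the defect. Splitting terms have smaller defect. Joining terms
have larger defect and escape the induction, so they are bounded by the sum of all values, with the
small factor `n⁻²` kept. -/
theorem wgNorm_isBigO_one_add (hα : ∀ σ : Equiv.Perm α,
      (fun n => wgNorm n σ) =O[atTop] (fun _ : ℕ => (1 : ℝ))) (d : ℕ) :
    ∀ π : Equiv.Perm (Option α), defect π = d → (fun n => wgNorm n π) =O[atTop]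
      fun n : ℕ => 1 + (∑ σ : Equiv.Perm (Option α), |wgNorm n σ|) * ((n : ℝ) ^ 2)⁻¹ := by
  have hS : ∀ n : ℕ, 0 ≤ (∑ σ : Equiv.Perm (Option α), |wgNorm n σ|) * ((n : ℝ) ^ 2)⁻¹ :=
    fun n => mul_nonneg (Finset.sum_nonneg fun _ _ => abs_nonneg _) (by positivity)
  induction d using Nat.strong_induction_on with
  | _ d ih =>
    intro π hπ
    have hrec : (fun n : ℕ => (if π none = none then
          wgNorm n (Equiv.removeNone π : Equiv.Perm α) else 0) -
        ∑ i : α, (if π.SameCycle none (some i) then 1 else ((n : ℝ) ^ 2)⁻¹) *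
          wgNorm n (Equiv.swap none (some i) * π)) =ᶠ[atTop] fun n => wgNorm n π := by
      filter_upwards [eventually_ge_atTop (Fintype.card (Option α))] with n hn
      exact (wgNorm_recursion hn π).symm
    refine IsBigO.congr' ?_ hrec EventuallyEq.rfl
    have hone : (fun _ : ℕ => (1 : ℝ)) =O[atTop] fun n : ℕ =>
        1 + (∑ σ : Equiv.Perm (Option α), |wgNorm n σ|) * ((n : ℝ) ^ 2)⁻¹ := by
      refine IsBigO.of_bound 1 (Eventually.of_forall fun n => ?_)
      rw [one_mul, norm_one, Real.norm_of_nonneg (by linarith [hS n])]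
      linarith [hS n]
    refine IsBigO.sub ?_ (IsBigO.fun_sum fun i _ => ?_)
    · split_ifs
      · exact (hα _).trans hone
      · exact isBigO_zero _ _
    · split_ifs with hi
      · simp only [one_mul]
        refine ih _ ?_ _ rfl
        rw [← hπ, ← defect_swap_mul_of_sameCycle (by simp) hi]
        exact Nat.lt_succ_self _
      · refine IsBigO.of_bound 1 (Eventually.of_forall fun n => ?_)
        rw [one_mul, Real.norm_of_nonneg (by linarith [hS n] :
          0 ≤ 1 + (∑ σ : Equiv.Perm (Option α), |wgNorm n σ|) * ((n : ℝ) ^ 2)⁻¹), norm_mul,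
          Real.norm_of_nonneg (by positivity : 0 ≤ ((n : ℝ) ^ 2)⁻¹), mul_comm, Real.norm_eq_abs]
        have h1 : |wgNorm n (Equiv.swap none (some i) * π)| ≤
            ∑ σ : Equiv.Perm (Option α), |wgNorm n σ| :=
          Finset.single_le_sum (f := fun σ : Equiv.Perm (Option α) => |wgNorm n σ|)
            (fun _ _ => abs_nonneg _) (Finset.mem_univ _)
        have h2 := mul_le_mul_of_nonneg_right h1 (by positivity : 0 ≤ ((n : ℝ) ^ 2)⁻¹)
        linarith

/-- With `S` the sum of all absolute values, the a priori bound gives `S ≤ C * (1 + S * n⁻²)`, and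
the last term can be absorbed for large `n`. -/
theorem wgNorm_isBigO_one_option (hα : ∀ σ : Equiv.Perm α,
      (fun n => wgNorm n σ) =O[atTop] (fun _ : ℕ => (1 : ℝ))) (π : Equiv.Perm (Option α)) :
    (fun n => wgNorm n π) =O[atTop] (fun _ : ℕ => (1 : ℝ)) := by
  have h1 : (fun n : ℕ => ∑ σ : Equiv.Perm (Option α), |wgNorm n σ|) =O[atTop]
      fun n : ℕ => 1 + (∑ σ : Equiv.Perm (Option α), |wgNorm n σ|) * ((n : ℝ) ^ 2)⁻¹ :=
    IsBigO.fun_sum fun σ _ => (wgNorm_isBigO_one_add hα _ σ rfl).abs_left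
  obtain ⟨C, hC0, hC⟩ := h1.exists_pos
  rw [IsBigOWith] at hC
  -- For `n > m > 2 * C` one has `C * n⁻² ≤ 1 / 2`, whence `S ≤ 2 * C`.
  obtain ⟨m, hm⟩ := exists_nat_gt (2 * C)
  refine IsBigO.of_bound (2 * C) ?_
  filter_upwards [hC, eventually_ge_atTop (m + 1)] with n hn hnm
  have hS0 : 0 ≤ ∑ σ : Equiv.Perm (Option α), |wgNorm n σ| :=
    Finset.sum_nonneg fun _ _ => abs_nonneg _
  have hle : |wgNorm n π| ≤ ∑ σ : Equiv.Perm (Option α), |wgNorm n σ| :=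
    Finset.single_le_sum (f := fun σ : Equiv.Perm (Option α) => |wgNorm n σ|)
      (fun _ _ => abs_nonneg _) (Finset.mem_univ _)
  set S := ∑ σ : Equiv.Perm (Option α), |wgNorm n σ|
  have hn1 : (m : ℝ) + 1 ≤ n := by exact_mod_cast hnm
  have hn2 : 2 * C ≤ (n : ℝ) ^ 2 := by nlinarith
  have hpos : 0 < (n : ℝ) ^ 2 := by linarith
  rw [Real.norm_of_nonneg hS0, Real.norm_of_nonneg (by positivity)] at hn
  rw [norm_one, mul_one, Real.norm_eq_abs]
  have h3 : C * (S * ((n : ℝ) ^ 2)⁻¹) ≤ S / 2 := by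
    rw [← div_eq_mul_inv, ← mul_div_assoc, div_le_div_iff₀ hpos two_pos]
    nlinarith
  nlinarith

/-- The difference of the two recursions, by induction on the defect. The joining terms are now
bounded functions times `n⁻²`, so they are part of the error. -/
theorem wgNorm_sub_moeb_isBigO_option (hα : ∀ σ : Equiv.Perm α,
      (fun n => wgNorm n σ - moeb σ) =O[atTop] (fun n : ℕ => ((n : ℝ) ^ 2)⁻¹)) (d : ℕ) :
    ∀ π : Equiv.Perm (Option α), defect π = d →
      (fun n => wgNorm n π - moeb π) =O[atTop] (fun n : ℕ => ((n : ℝ) ^ 2)⁻¹) := by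
  have hinv : (fun n : ℕ => ((n : ℝ) ^ 2)⁻¹) =O[atTop] (fun _ : ℕ => (1 : ℝ)) := by
    refine IsBigO.of_bound 1 ?_
    filter_upwards [eventually_ge_atTop 1] with n hn
    have : (1 : ℝ) ≤ n := by exact_mod_cast hn
    rw [Real.norm_of_nonneg (by positivity), norm_one, one_mul]
    exact inv_le_one_of_one_le₀ (by nlinarith)
  have hα1 : ∀ σ : Equiv.Perm α, (fun n => wgNorm n σ) =O[atTop] (fun _ : ℕ => (1 : ℝ)) := by
    intro σ
    have := ((hα σ).trans hinv).add (isBigO_const_const (moeb σ : ℝ) one_ne_zero atTop)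
    simpa using this
  induction d using Nat.strong_induction_on with
  | _ d ih =>
    intro π hπ
    have hrec : (fun n : ℕ => (if π none = none then
          (wgNorm n (Equiv.removeNone π : Equiv.Perm α) -
            moeb (Equiv.removeNone π : Equiv.Perm α)) else 0) -
        ∑ i : α, (if π.SameCycle none (some i) then
          (wgNorm n (Equiv.swap none (some i) * π) - moeb (Equiv.swap none (some i) * π)) else
          ((n : ℝ) ^ 2)⁻¹ * wgNorm n (Equiv.swap none (some i) * π))) =ᶠ[atTop]
          fun n => wgNorm n π - moeb π := by
      filter_upwards [eventually_ge_atTop (Fintype.card (Option α))] with n hn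
      rw [wgNorm_recursion hn π, moeb_recursion π]
      push_cast
      have h1 : ∀ i : α, (if π.SameCycle none (some i) then
          (wgNorm n (Equiv.swap none (some i) * π) - moeb (Equiv.swap none (some i) * π)) else
          ((n : ℝ) ^ 2)⁻¹ * wgNorm n (Equiv.swap none (some i) * π)) =
          (if π.SameCycle none (some i) then 1 else ((n : ℝ) ^ 2)⁻¹) *
            wgNorm n (Equiv.swap none (some i) * π) -
          ((if π.SameCycle none (some i) then (moeb (Equiv.swap none (some i) * π) : ℤ)
            else 0 : ℤ) : ℝ) := by
        intro i
        split_ifs <;> simp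
      rw [Finset.sum_congr rfl fun i _ => h1 i, Finset.sum_sub_distrib]
      push_cast
      split_ifs <;> ring
    refine IsBigO.congr' ?_ hrec EventuallyEq.rfl
    refine IsBigO.sub ?_ (IsBigO.fun_sum fun i _ => ?_)
    · split_ifs
      · exact hα _
      · exact isBigO_zero _ _
    · split_ifs with hi
      · refine ih _ ?_ _ rfl
        rw [← hπ, ← defect_swap_mul_of_sameCycle (by simp) hi]
        exact Nat.lt_succ_self _
      · have := (isBigO_refl (fun n : ℕ => ((n : ℝ) ^ 2)⁻¹) atTop).mul
          (wgNorm_isBigO_one_option hα1 (Equiv.swap none (some i) * π))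
        simpa using this

/-- The Weingarten function is `Möb(π) n ^ (-L-|π|) (1 + O(n⁻²))`. -/
theorem wgNorm_sub_moeb_isBigO (π : Equiv.Perm α) :
    (fun n => wgNorm n π - moeb π) =O[atTop] (fun n : ℕ => ((n : ℝ) ^ 2)⁻¹) := by
  have key : ∀ π : Equiv.Perm α,
      (fun n => @wgNorm α _ (Classical.decEq α) n π - @moeb α _ (Classical.decEq α) π) =O[atTop]
        (fun n : ℕ => ((n : ℝ) ^ 2)⁻¹) := by
    classical
    refine Fintype.induction_empty_option (P := fun α _ => ∀ π : Equiv.Perm α,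
      (fun n => @wgNorm α _ (Classical.decEq α) n π - @moeb α _ (Classical.decEq α) π) =O[atTop]
        (fun n : ℕ => ((n : ℝ) ^ 2)⁻¹)) ?_ ?_ ?_ α
    · intro α β _ e h π
      let _ := Fintype.ofEquiv β e.symm
      refine (h (e.permCongr.symm π)).congr' ?_ EventuallyEq.rfl
      filter_upwards [eventually_ge_atTop (Fintype.card α)] with n hn
      conv_rhs => rw [← Equiv.apply_symm_apply e.permCongr π]
      generalize e.permCongr.symm π = σ
      have h1 := wgAt_permCongr e hn σ
      have h2 := moeb_permCongr e σ
      have h3 := numCycles_permCongr e σ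
      have h4 := numCycles_add_defect σ
      have h5 := numCycles_add_defect (e.permCongr σ)
      have h6 := Fintype.card_congr e
      have h7 : defect (e.permCongr σ) = defect σ := by omega
      have h8 : wgNorm n (e.permCongr σ) = wgNorm n σ := by
        rw [wgNorm, wgNorm, h1, h6, h7]
      rw [← h8, ← h2]
    · intro π
      refine (isBigO_zero _ _).congr' ?_ EventuallyEq.rfl
      filter_upwards with n
      have h1 := sum_wgAt_mul (α := PEmpty) (n := n) (by simp) 1
      rw [Fintype.sum_subsingleton _ π, numCycles_of_isEmpty] at h1
      have h2 := numCycles_add_defect π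
      rw [Fintype.card_eq_zero] at h2
      have h3 : wgNorm n π = 1 := by
        have h4 : wgAt n π = 1 := by simpa using h1
        rw [wgNorm, h4, Fintype.card_eq_zero, (by omega : defect π = 0)]
        simp
      have h4 : moeb π = 1 := by
        rw [Subsingleton.elim π 1, moeb_eq]
        simp [catProd]
      have : (0 : ℝ) = wgNorm n π - moeb π := by
        rw [h3, h4]
        simp
      rw [this]
      congr
    · intro α _ ih π
      have := wgNorm_sub_moeb_isBigO_option ih _ π rfl
      convert this
  convert key π

end Asymptotics

end UnitaryWords

namespace UnitaryWords

/-! ### Tensor powers of matrices and their commutant -/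

section Commutant

variable {P : Type*} [Fintype P] [DecidableEq P] {n : ℕ}

/-- The tensor power `g^{⊗P}` of a matrix. -/
def kron (P : Type*) [Fintype P] {n : ℕ} (g : Matrix (Fin n) (Fin n) ℂ) :
    Matrix (P → Fin n) (P → Fin n) ℂ :=
  Matrix.of fun i k => ∏ p, g (i p) (k p)

omit [DecidableEq P] in
theorem kron_apply (g : Matrix (Fin n) (Fin n) ℂ) (i k : P → Fin n) :
    kron P g i k = ∏ p, g (i p) (k p) := rfl

theorem kron_mul (g h : Matrix (Fin n) (Fin n) ℂ) : kron P (g * h) = kron P g * kron P h := by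
  ext i k
  simp only [kron_apply, Matrix.mul_apply, Finset.prod_univ_sum, Fintype.piFinset_univ,
    Finset.prod_mul_distrib]

omit [DecidableEq P] in
theorem kron_diagonal (d : Fin n → ℂ) :
    kron P (Matrix.diagonal d) = Matrix.diagonal fun i => ∏ p, d (i p) := by
  ext i k
  rw [kron_apply]
  by_cases h : i = k
  · subst h
    simp
  · rw [Matrix.diagonal_apply_ne _ h]
    obtain ⟨p, hp⟩ := Function.ne_iff.mp h
    exact Finset.prod_eq_zero (Finset.mem_univ p) (Matrix.diagonal_apply_ne _ hp)

omit [DecidableEq P] in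
theorem kron_one : kron P (1 : Matrix (Fin n) (Fin n) ℂ) = 1 := by
  rw [← Matrix.diagonal_one, kron_diagonal]
  simp

omit [DecidableEq P] in
theorem kron_conjTranspose (g : Matrix (Fin n) (Fin n) ℂ) :
    kron P (star g) = star (kron P g) := by
  ext i k
  simp [kron_apply, Matrix.star_apply]

theorem star_kron_mul_kron (A : U n) : star (kron P (A : Matrix (Fin n) (Fin n) ℂ)) *
    kron P (A : Matrix (Fin n) (Fin n) ℂ) = 1 := by
  rw [← kron_conjTranspose, ← kron_mul, Unitary.coe_star_mul_self, kron_one]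

omit [DecidableEq P] in
theorem prod_comp_eq_prod_pow (i : P → Fin n) (d : Fin n → ℂ) :
    ∏ p, d (i p) = ∏ a, d a ^ (Finset.univ.filter fun p => i p = a).card := by
  rw [← Finset.prod_fiberwise' Finset.univ i d]
  simp

/-- `T` commutes with the tensor powers of all unitary matrices. -/
def CommutesWithU (T : Matrix (P → Fin n) (P → Fin n) ℂ) : Prop :=
  ∀ A : U n, Commute T (kron P (A : Matrix (Fin n) (Fin n) ℂ))

theorem commute_diagonal_iff (T : Matrix (P → Fin n) (P → Fin n) ℂ) (d : (P → Fin n) → ℂ) :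
    Commute T (Matrix.diagonal d) ↔ ∀ i k, T i k * d k = d i * T i k := by
  rw [commute_iff_eq, ← Matrix.ext_iff]
  simp [Matrix.mul_diagonal, Matrix.diagonal_mul]

/-- The order `m + 1` makes the powers with exponents `0, …, m` distinct, so these exponents can be
recovered from a unitary scalar. -/
theorem exists_primitiveRoot (m : ℕ) : ∃ ζ : ℂ, IsPrimitiveRoot ζ (m + 1) ∧ star ζ * ζ = 1 := by
  have h := Complex.isPrimitiveRoot_exp (m + 1) (by omega)
  refine ⟨_, h, ?_⟩
  have := h.norm'_eq_one (by omega)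
  rw [Complex.star_def, ← Complex.normSq_eq_conj_mul_self, Complex.normSq_eq_norm_sq, this]
  simp

theorem diagonal_mem_unitary {d : Fin n → ℂ} (hd : ∀ a, star (d a) * d a = 1) :
    Matrix.diagonal d ∈ Matrix.unitaryGroup (Fin n) ℂ := by
  rw [Matrix.mem_unitaryGroup_iff', Matrix.star_eq_conjTranspose, Matrix.diagonal_conjTranspose,
    Matrix.diagonal_mul_diagonal, ← Matrix.diagonal_one]
  congr 1
  funext a
  exact hd a

/-- `T` preserves weight spaces: the diagonal unitary matrix with `ζ` at `a` multiplies the basis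
vector of `i` by `ζ` to the number of occurrences of `a`. -/
theorem CommutesWithU.card_eq {T : Matrix (P → Fin n) (P → Fin n) ℂ} (hT : CommutesWithU T)
    {i k : P → Fin n} (h : T i k ≠ 0) (a : Fin n) :
    (Finset.univ.filter fun p => i p = a).card = (Finset.univ.filter fun p => k p = a).card := by
  obtain ⟨ζ, hζ, hζ1⟩ := exists_primitiveRoot (Fintype.card P)
  have hU : Matrix.diagonal (fun b => if b = a then ζ else 1) ∈
      Matrix.unitaryGroup (Fin n) ℂ := by
    refine diagonal_mem_unitary fun b => ?_
    split_ifs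
    · exact hζ1
    · simp
  have h1 := hT ⟨_, hU⟩
  rw [kron_diagonal, commute_diagonal_iff] at h1
  have h2 := h1 i k
  rw [mul_comm] at h2
  have h3 := mul_right_cancel₀ h h2
  simp only [Finset.prod_ite, Finset.prod_const, one_pow, mul_one] at h3
  have hlt : ∀ i : P → Fin n, (Finset.univ.filter fun p => i p = a).card < Fintype.card P + 1 :=
    fun i => Nat.lt_succ_of_le (Finset.card_le_univ _)
  exact (hζ.pow_inj (hlt k) (hlt i) h3).symm

/-- The eigenvalue of a diagonal tensor power depends only on the multiplicities of the indices,
which `T` preserves. Unitarity of `d` is no longer needed, and this opens the way to non-invertible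
matrices. -/
theorem CommutesWithU.commute_diagonal {T : Matrix (P → Fin n) (P → Fin n) ℂ}
    (hT : CommutesWithU T) (d : Fin n → ℂ) : Commute T (kron P (Matrix.diagonal d)) := by
  rw [kron_diagonal, commute_diagonal_iff]
  intro i k
  by_cases h : T i k = 0
  · simp [h]
  · rw [mul_comm, prod_comp_eq_prod_pow, prod_comp_eq_prod_pow]
    simp only [hT.card_eq h]

theorem CommutesWithU.commute_hermitian {T : Matrix (P → Fin n) (P → Fin n) ℂ}
    (hT : CommutesWithU T) {S : Matrix (Fin n) (Fin n) ℂ} (hS : S.IsHermitian) :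
    Commute T (kron P S) := by
  rw [hS.spectral_theorem, Unitary.conjStarAlgAut_apply, kron_mul, kron_mul]
  refine ((hT _).mul_right (hT.commute_diagonal _)).mul_right ?_
  rw [← Unitary.coe_star]
  exact hT _

/-- The matrix of a self-map of the standard basis. -/
def mapMatrix (φ : Fin n → Fin n) : Matrix (Fin n) (Fin n) ℂ :=
  Matrix.of fun x y => if x = φ y then 1 else 0

omit [DecidableEq P] in
theorem kron_mapMatrix (φ : Fin n → Fin n) (i k : P → Fin n) :
    kron P (mapMatrix φ) i k = if i = φ ∘ k then 1 else 0 := by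
  simp only [kron_apply, mapMatrix, Matrix.of_apply, Finset.prod_boole, Finset.mem_univ,
    true_implies, funext_iff, Function.comp_apply]

theorem mapMatrix_perm_mem (π : Equiv.Perm (Fin n)) :
    mapMatrix π ∈ Matrix.unitaryGroup (Fin n) ℂ := by
  rw [Matrix.mem_unitaryGroup_iff']
  ext x y
  rw [Matrix.mul_apply]
  simp [mapMatrix, Matrix.star_apply, Matrix.one_apply, eq_comm]

/-- The map that sends the basis vectors of `a` and `b` to that of `b` is the Hermitian matrix `S`,
with block `[[0, 1], [1, 1]]` on `a, b`, followed by the diagonal projection that kills `a`. -/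
theorem CommutesWithU.commute_merge {T : Matrix (P → Fin n) (P → Fin n) ℂ}
    (hT : CommutesWithU T) {a b : Fin n} (hab : a ≠ b) :
    Commute T (kron P (mapMatrix (Function.update id a b))) := by
  let S : Matrix (Fin n) (Fin n) ℂ :=
    Matrix.of fun x y => if x = Function.update id a b y ∨ (x = a ∧ y = b) then 1 else 0
  have hS : S.IsHermitian := by
    ext x y
    simp only [S, Matrix.conjTranspose_apply, Matrix.of_apply, apply_ite star, star_one, star_zero]
    refine if_congr ?_ rfl rfl
    simp only [Function.update_apply, id]
    split_ifs <;> grind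
  have h : mapMatrix (Function.update id a b) =
      Matrix.diagonal (fun x => if x = a then 0 else 1) * S := by
    ext x y
    rw [Matrix.diagonal_mul]
    simp only [S, mapMatrix, Matrix.of_apply, Function.update_apply, id]
    split_ifs <;> grind
  rw [h, kron_mul]
  exact (hT.commute_diagonal _).mul_right (hT.commute_hermitian hS)

/-- Applying the tensor power of `ψ` to the expansion of column `k` of `T` gives column `ψ ∘ k`,
because composition with `ψ` on the left commutes with composition with `σ` on the right. -/
theorem perm_coeff_comp {T : Matrix (P → Fin n) (P → Fin n) ℂ} {c : Equiv.Perm P → ℂ}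
    {k : P → Fin n} (hk : ∀ i, T i k = ∑ σ : Equiv.Perm P, if i = k ∘ σ then c σ else 0)
    {ψ : Fin n → Fin n} (hψ : Commute T (kron P (mapMatrix ψ))) (i : P → Fin n) :
    T i (ψ ∘ k) = ∑ σ : Equiv.Perm P, if i = (ψ ∘ k) ∘ σ then c σ else 0 := by
  have h := congrFun (congrFun hψ.eq i) k
  rw [Matrix.mul_apply, Matrix.mul_apply] at h
  simp only [kron_mapMatrix, mul_ite, mul_one, mul_zero, ite_mul, one_mul, zero_mul,
    Finset.sum_ite_eq', Finset.mem_univ, if_true] at h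
  rw [h]
  simp only [hk, ← Finset.sum_filter]
  rw [Finset.sum_filter, Finset.sum_congr rfl fun m _ => by rw [Finset.sum_filter],
    Finset.sum_congr rfl (g := fun m => ∑ σ : Equiv.Perm P,
      if m = k ∘ σ then (if i = ψ ∘ m then c σ else 0) else 0), Finset.sum_comm]
  · rw [Finset.sum_filter]
    simp only [Finset.sum_ite_eq', Finset.mem_univ, if_true]
    rfl
  · intro m _
    split_ifs
    · rfl
    · simp

/-- In the stable range the commutant of the tensor power is spanned by permutations. -/
theorem CommutesWithU.exists_coeff {T : Matrix (P → Fin n) (P → Fin n) ℂ}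
    (hT : CommutesWithU T) (hn : Fintype.card P ≤ n) :
    ∃ c : Equiv.Perm P → ℂ, ∀ k i, T i k =
      ∑ σ : Equiv.Perm P, if i = k ∘ σ then c σ else 0 := by
  obtain ⟨e⟩ : Nonempty (P ↪ Fin n) := by
    apply Function.Embedding.nonempty_of_card_le
    simpa using hn
  -- All coefficients are read off from the single column of an injective index map `e`.
  refine ⟨fun σ => T (e ∘ σ) e, ?_⟩
  set c : Equiv.Perm P → ℂ := fun σ => T (e ∘ σ) e with hc
  have he : ∀ i, T i e = ∑ σ : Equiv.Perm P, if i = e ∘ σ then c σ else 0 := by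
    intro i
    by_cases hi : ∃ σ : Equiv.Perm P, i = e ∘ σ
    · obtain ⟨σ, rfl⟩ := hi
      rw [Finset.sum_eq_single σ]
      · simp [hc]
      · intro τ _ hτ
        rw [if_neg]
        intro h
        apply hτ
        ext p
        exact (e.injective (congrFun h p)).symm
      · simp
    -- A nonzero entry forces `i` to take each value as often as `e` does, so `i` would be a
    -- rearrangement of `e` after all.
    · rw [Finset.sum_eq_zero fun σ _ => if_neg fun h => hi ⟨σ, h⟩]
      by_contra hne
      apply hi
      have hcard := hT.card_eq hne
      have hex : ∀ p, ∃ q, e q = i p := by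
        intro p
        have h1 : 0 < (Finset.univ.filter fun q => i q = i p).card :=
          Finset.card_pos.mpr ⟨p, by simp⟩
        rw [hcard] at h1
        obtain ⟨q, hq⟩ := Finset.card_pos.mp h1
        exact ⟨q, (Finset.mem_filter.mp hq).2⟩
      choose σ hσ using hex
      have hinj : Function.Injective σ := by
        intro p p' hpp
        have h1 : (Finset.univ.filter fun q => i q = i p).card ≤ 1 := by
          rw [hcard, Finset.card_le_one]
          intro x hx y hy
          exact e.injective (((Finset.mem_filter.mp hx).2).trans (Finset.mem_filter.mp hy).2.symm)
        refine Finset.card_le_one.mp h1 p (by simp) p' ?_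
        simp [← hσ, hpp]
      refine ⟨Equiv.ofBijective σ (Finite.injective_iff_bijective.mp hinj), ?_⟩
      funext p
      exact (hσ p).symm
  have hinj : ∀ k : P → Fin n, Function.Injective k →
      ∀ i, T i k = ∑ σ : Equiv.Perm P, if i = k ∘ σ then c σ else 0 := by
    intro k hk
    -- Any injective `k` is `e` followed by a permutation of `Fin n`, and permutation matrices are
    -- unitary.
    let π : Equiv.Perm (Fin n) := Equiv.extendSubtype
      ((Equiv.ofInjective e e.injective).symm.trans (Equiv.ofInjective k hk))
    have hπ : k = π ∘ e := by
      funext p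
      have := Equiv.extendSubtype_apply_of_mem
        ((Equiv.ofInjective e e.injective).symm.trans (Equiv.ofInjective k hk)) (e p) ⟨p, rfl⟩
      simp only [Function.comp_apply, π]
      rw [this]
      have h2 : (Equiv.ofInjective e e.injective).symm ⟨e p, ⟨p, rfl⟩⟩ = p :=
        (Equiv.symm_apply_eq _).mpr rfl
      simp only [Equiv.trans_apply, h2, Equiv.ofInjective_apply]
    rw [hπ]
    exact perm_coeff_comp he (hT ⟨_, mapMatrix_perm_mem π⟩)
  -- Induction on the number of values that `k` misses. If `k p = k q` with `p ≠ q`, then moving `p`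
  -- to a missed value `a` enlarges the image, and merging `a` into `k p` recovers `k`.
  have key : ∀ (m : ℕ) (k : P → Fin n), n - (Finset.univ.image k).card = m →
      ∀ i, T i k = ∑ σ : Equiv.Perm P, if i = k ∘ σ then c σ else 0 := by
    intro m
    induction m using Nat.strong_induction_on with
    | _ m ih =>
      intro k hm
      by_cases hk : Function.Injective k
      · exact hinj k hk
      · obtain ⟨p, q, hpq, hne⟩ : ∃ p q, k p = k q ∧ p ≠ q := by
          simpa [Function.Injective] using hk
        have hlt : (Finset.univ.image k).card < Fintype.card P := by
          refine lt_of_le_of_ne Finset.card_image_le fun h => hk ?_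
          rw [← Finset.card_univ, Finset.card_image_iff] at h
          exact fun x y hxy => h (by simp) (by simp) hxy
        obtain ⟨a, ha⟩ : ∃ a, a ∉ Finset.univ.image k := by
          by_contra! hall
          have : (Finset.univ.image k) = Finset.univ := Finset.eq_univ_iff_forall.mpr hall
          rw [this, Finset.card_univ, Fintype.card_fin] at hlt
          omega
        have ha' : ∀ x, k x ≠ a := fun x hx => ha (Finset.mem_image.mpr ⟨x, by simp, hx⟩)
        have hk' : k = Function.update id a (k p) ∘ Function.update k p a := by
          funext x
          by_cases hx : x = p
          · subst hx
            simp
          · simp [hx, ha' x]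
        have himg : Finset.univ.image (Function.update k p a) =
            insert a (Finset.univ.image k) := by
          ext y
          simp only [Finset.mem_image, Finset.mem_univ, true_and, Finset.mem_insert]
          constructor
          · rintro ⟨x, rfl⟩
            by_cases hx : x = p
            · subst hx
              simp
            · right
              exact ⟨x, by simp [hx]⟩
          · rintro (rfl | ⟨x, rfl⟩)
            · exact ⟨p, by simp⟩
            · by_cases hx : x = p
              · exact ⟨q, by rw [Function.update_of_ne hne.symm, hx, hpq]⟩
              · exact ⟨x, by simp [hx]⟩
        have hcard : (Finset.univ.image (Function.update k p a)).card =
            (Finset.univ.image k).card + 1 := by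
          rw [himg, Finset.card_insert_of_notMem ha]
        rw [hk']
        refine perm_coeff_comp (ih _ ?_ _ rfl) (hT.commute_merge (ha' p).symm)
        rw [hcard]
        omega
  exact fun k => key _ k rfl

end Commutant

end UnitaryWords

namespace UnitaryWords

/-! ### Integration over the unitary group -/

section Integration

open MeasureTheory

instance instIsProbabilityMeasureHaarU (n : ℕ) : IsProbabilityMeasure (haarU n) :=
  ⟨by
    have := Measure.haarMeasure_self (K₀ := (⊤ : TopologicalSpace.PositiveCompacts (U n)))
    simpa [haarU] using this⟩

instance instIsMulLeftInvariantHaarU (n : ℕ) : (haarU n).IsMulLeftInvariant := by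
  unfold haarU
  infer_instance

theorem integrable_haarU {n : ℕ} {f : U n → ℂ} (hf : Continuous f) : Integrable f (haarU n) :=
  hf.integrable_of_hasCompactSupport (HasCompactSupport.of_compactSpace f)

theorem continuous_entry {n : ℕ} (i j : Fin n) :
    Continuous fun A : U n => (A : Matrix (Fin n) (Fin n) ℂ) i j :=
  (continuous_subtype_val.matrix_elem i j)

section

variable {P : Type*} [Fintype P] {n : ℕ}

theorem continuous_kron (i j : P → Fin n) :
    Continuous fun A : U n => kron P (A : Matrix (Fin n) (Fin n) ℂ) i j :=
  continuous_finsetProd _ fun p _ => continuous_entry (i p) (j p)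

theorem continuous_kron_mul_star (i j i' j' : P → Fin n) :
    Continuous fun A : U n => kron P (A : Matrix (Fin n) (Fin n) ℂ) i j *
      star (kron P (A : Matrix (Fin n) (Fin n) ℂ) i' j') :=
  (continuous_kron i j).mul (continuous_kron i' j').star

/-- The matrix of mixed moments of the entries of a Haar unitary matrix. -/
noncomputable def moment (j j' : P → Fin n) : Matrix (P → Fin n) (P → Fin n) ℂ :=
  Matrix.of fun i i' => ∫ A : U n, kron P (A : Matrix (Fin n) (Fin n) ℂ) i j *
    star (kron P (A : Matrix (Fin n) (Fin n) ℂ) i' j') ∂haarU n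

/-- The substitution `A ↦ B * A` leaves the Haar measure invariant and conjugates the moment matrix
by the tensor power of `B`. -/
theorem moment_commutesWithU [DecidableEq P] (j j' : P → Fin n) :
    CommutesWithU (moment j j') := by
  intro B
  have h1 : moment j j' = kron P (B : Matrix (Fin n) (Fin n) ℂ) * moment j j' *
      star (kron P (B : Matrix (Fin n) (Fin n) ℂ)) := by
    ext i i'
    have h2 : moment j j' i i' = ∫ A : U n,
        kron P ((B * A : U n) : Matrix (Fin n) (Fin n) ℂ) i j *
          star (kron P ((B * A : U n) : Matrix (Fin n) (Fin n) ℂ) i' j') ∂haarU n :=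
      (integral_mul_left_eq_self (μ := haarU n) (fun A : U n =>
        kron P (A : Matrix (Fin n) (Fin n) ℂ) i j *
          star (kron P (A : Matrix (Fin n) (Fin n) ℂ) i' j')) B).symm
    rw [h2]
    simp only [Submonoid.coe_mul, kron_mul, Matrix.mul_apply, star_sum, star_mul',
      Finset.sum_mul_sum, Matrix.star_apply, moment, Matrix.of_apply]
    have hint : ∀ k k', Integrable (fun A : U n =>
        kron P (B : Matrix (Fin n) (Fin n) ℂ) i k * kron P (A : Matrix (Fin n) (Fin n) ℂ) k j *
        (star (kron P (B : Matrix (Fin n) (Fin n) ℂ) i' k') *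
          star (kron P (A : Matrix (Fin n) (Fin n) ℂ) k' j'))) (haarU n) := fun k k' =>
      integrable_haarU ((continuous_const.mul (continuous_kron k j)).mul
        (continuous_const.mul (continuous_kron k' j').star))
    rw [integral_finsetSum _ fun k _ => integrable_finsetSum _ fun k' _ => hint k k']
    simp only [Finset.sum_mul]
    rw [Finset.sum_comm]
    refine Finset.sum_congr rfl fun k _ => ?_
    rw [integral_finsetSum _ fun k' _ => hint k k']
    refine Finset.sum_congr rfl fun k' _ => ?_
    rw [← integral_const_mul, ← integral_mul_const]
    congr 1
    funext A
    ring
  have h3 := star_kron_mul_kron (P := P) B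
  rw [commute_iff_eq]
  conv_lhs => rw [h1]
  rw [mul_assoc, h3, mul_one]

end

variable {P N : Type*} [Fintype P] [DecidableEq P] [Fintype N] [DecidableEq N] {n : ℕ}

omit [DecidableEq P] in
theorem kron_comp_perm (g : Matrix (Fin n) (Fin n) ℂ) (i k : P → Fin n) (τ : Equiv.Perm P) :
    kron P g (i ∘ τ) (k ∘ τ) = kron P g i k := by
  simp only [kron_apply, Function.comp_apply]
  exact Equiv.prod_comp τ fun p => g (i p) (k p)

/-- Before integration the sum is an entry of the tensor power of `star A * A = 1`. -/
theorem sum_moment (j j' : P → Fin n) (τ : Equiv.Perm P) :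
    ∑ i, moment j j' (i ∘ τ) i = if j = j' ∘ τ then 1 else 0 := by
  simp only [moment, Matrix.of_apply]
  rw [← integral_finsetSum _ fun i _ => integrable_haarU (continuous_kron_mul_star _ _ _ _)]
  have h : ∀ A : U n, ∑ i, kron P (A : Matrix (Fin n) (Fin n) ℂ) (i ∘ τ) j *
      star (kron P (A : Matrix (Fin n) (Fin n) ℂ) i j') = if j = j' ∘ τ then 1 else 0 := by
    intro A
    have h1 := congrFun (congrFun (star_kron_mul_kron (P := P) A) j') (j ∘ τ.symm)
    rw [Matrix.mul_apply, Matrix.one_apply] at h1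
    have h2 : (j' = j ∘ τ.symm) = (j = j' ∘ τ) := by
      rw [eq_iff_iff]
      constructor
      · rintro rfl
        funext p
        simp
      · rintro rfl
        funext p
        simp
    simp only [h2] at h1
    rw [← h1]
    refine Finset.sum_congr rfl fun i _ => ?_
    rw [Matrix.star_apply, mul_comm, ← kron_comp_perm _ i (j ∘ τ.symm) τ]
    congr 2
    funext p
    simp
  simp only [h]
  simp

/-- The Weingarten formula, for moments of the same order. -/
theorem moment_eq (hn : Fintype.card P ≤ n) (i j i' j' : P → Fin n) :
    moment j j' i i' = ∑ σ : Equiv.Perm P, ∑ τ : Equiv.Perm P,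
      if i = i' ∘ σ ∧ j = j' ∘ τ then (wgAt n (σ⁻¹ * τ) : ℂ) else 0 := by
  obtain ⟨c, hc⟩ := (moment_commutesWithU j j').exists_coeff hn
  -- Summing the expansion against the permutation `τ` turns the unknown `c` into its convolution
  -- with the Gram function, while `sum_moment` evaluates the same sum.
  have h1 : ∀ τ : Equiv.Perm P, ∑ σ : Equiv.Perm P, c σ * (n : ℂ) ^ numCycles (σ⁻¹ * τ) =
      if j = j' ∘ τ then 1 else 0 := by
    intro τ
    rw [← sum_moment j j' τ]
    simp only [hc]
    rw [Finset.sum_comm]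
    refine Finset.sum_congr rfl fun σ _ => ?_
    -- The family of inverses is used so that the maps compared are `f ∘ τ` and `f ∘ σ`.
    have h2 := gram_apply_eq_sum (fun σ : Equiv.Perm P => σ⁻¹) n τ σ
    have h3 : (gram (fun σ : Equiv.Perm P => σ⁻¹) (n : ℚ) τ σ) =
        (n : ℚ) ^ numCycles (σ⁻¹ * τ) := by
      rw [numCycles_mul_comm]
      rfl
    rw [h3] at h2
    have h4 : (n : ℂ) ^ numCycles (σ⁻¹ * τ) =
        ∑ f : P → Fin n, if f ∘ τ = f ∘ σ then (1 : ℂ) else 0 := by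
      have := congrArg (fun q : ℚ => (q : ℂ)) h2
      simp only [Rat.cast_pow, Rat.cast_natCast, Rat.cast_sum, apply_ite (fun q : ℚ => (q : ℂ)),
        Rat.cast_one, Rat.cast_zero] at this
      exact this
    rw [h4, Finset.mul_sum]
    refine Finset.sum_congr rfl fun f _ => ?_
    simp
  -- The Gram matrix is inverted by the values of the Weingarten function. `wgAt_inv` moves its
  -- inverse relation to the other side.
  have h2 : ∀ σ : Equiv.Perm P, c σ =
      ∑ τ : Equiv.Perm P, if j = j' ∘ τ then (wgAt n (σ⁻¹ * τ) : ℂ) else 0 := by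
    intro σ
    have h3 : ∀ σ' : Equiv.Perm P, ∑ τ : Equiv.Perm P,
        (wgAt n (σ⁻¹ * τ) : ℂ) * (n : ℂ) ^ numCycles (σ'⁻¹ * τ) = if σ' = σ then 1 else 0 := by
      intro σ'
      have h4 := sum_wgAt_mul hn (σ'⁻¹ * σ)
      simp only [inv_mul_eq_one] at h4
      have h5 := congrArg (fun q : ℚ => (q : ℂ)) h4
      simp only [Rat.cast_pow, Rat.cast_natCast, Rat.cast_sum, Rat.cast_mul,
        apply_ite (fun q : ℚ => (q : ℂ)), Rat.cast_one, Rat.cast_zero] at h5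
      rw [← h5, ← Equiv.sum_comp ((Equiv.inv (Equiv.Perm P)).trans (Equiv.mulLeft σ))]
      refine Finset.sum_congr rfl fun ρ _ => ?_
      simp only [Equiv.trans_apply, Equiv.inv_apply, Equiv.coe_mulLeft, inv_mul_cancel_left]
      rw [wgAt_inv hn, ← mul_assoc, numCycles_mul_comm]
    have h4 : ∑ τ : Equiv.Perm P, (wgAt n (σ⁻¹ * τ) : ℂ) *
        ∑ σ' : Equiv.Perm P, c σ' * (n : ℂ) ^ numCycles (σ'⁻¹ * τ) = c σ := by
      simp only [Finset.mul_sum]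
      rw [Finset.sum_comm, Finset.sum_congr rfl (g := fun σ' => c σ' *
        ∑ τ : Equiv.Perm P, (wgAt n (σ⁻¹ * τ) : ℂ) * (n : ℂ) ^ numCycles (σ'⁻¹ * τ))]
      · simp [h3]
      · intro σ' _
        rw [Finset.mul_sum]
        exact Finset.sum_congr rfl fun τ _ => by ring
    rw [← h4]
    simp [h1]
  rw [hc]
  refine Finset.sum_congr rfl fun σ _ => ?_
  rw [h2]
  split_ifs with h
  · simp [h]
  · simp [h]

omit [DecidableEq P] [DecidableEq N] in
-- Multiplication of `A` by a scalar `ζ` multiplies the integrand by `ζ ^ (|P| - |N|)`, and the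
-- order of `ζ` exceeds both `|P|` and `|N|`.
theorem integral_eq_zero_of_card_ne (h : Fintype.card P ≠ Fintype.card N) (a b : P → Fin n)
    (c d : N → Fin n) :
    ∫ A : U n, kron P (A : Matrix (Fin n) (Fin n) ℂ) a b *
      star (kron N (A : Matrix (Fin n) (Fin n) ℂ) c d) ∂haarU n = 0 := by
  obtain ⟨ζ, hζ, hζ1⟩ := exists_primitiveRoot (Fintype.card P + Fintype.card N)
  have hU : Matrix.diagonal (fun _ => ζ) ∈ Matrix.unitaryGroup (Fin n) ℂ :=
    diagonal_mem_unitary fun _ => hζ1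
  set f : U n → ℂ := fun A => kron P (A : Matrix (Fin n) (Fin n) ℂ) a b *
      star (kron N (A : Matrix (Fin n) (Fin n) ℂ) c d) with hf
  have h1 : ∀ A, f ((⟨_, hU⟩ : U n) * A) =
      (ζ ^ Fintype.card P * star ζ ^ Fintype.card N) * f A := by
    intro A
    simp only [hf, Submonoid.coe_mul, kron_apply, Matrix.diagonal_mul, Finset.prod_mul_distrib,
      Finset.prod_const, Finset.card_univ, star_mul', star_pow]
    ring
  have h2 := integral_mul_left_eq_self (μ := haarU n) f (⟨_, hU⟩ : U n)
  simp only [h1] at h2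
  rw [integral_const_mul] at h2
  by_contra hne
  have h3 := mul_right_cancel₀ hne (h2.trans (one_mul _).symm)
  have h4 : ζ ^ Fintype.card P = ζ ^ Fintype.card N := by
    have h5 := congrArg (fun x => x * ζ ^ Fintype.card N) h3
    simp only [one_mul, mul_assoc] at h5
    rw [← mul_pow, hζ1, one_pow, mul_one] at h5
    exact h5
  exact h (hζ.pow_inj (by omega) (by omega) h4)

/-- The Weingarten formula. -/
theorem integral_kron_mul_star (hn : Fintype.card P ≤ n) (a b : P → Fin n) (c d : N → Fin n) :
    ∫ A : U n, kron P (A : Matrix (Fin n) (Fin n) ℂ) a b *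
      star (kron N (A : Matrix (Fin n) (Fin n) ℂ) c d) ∂haarU n =
    ∑ σ : (P ≃ N) × (P ≃ N), if a = c ∘ σ.1 ∧ b = d ∘ σ.2 then
      (wgAt n (σ.2.trans σ.1.symm) : ℂ) else 0 := by
  by_cases h : Fintype.card P = Fintype.card N
  · let e := Fintype.equivOfCardEq h
    have h1 : ∀ A : U n, kron N (A : Matrix (Fin n) (Fin n) ℂ) c d =
        kron P (A : Matrix (Fin n) (Fin n) ℂ) (c ∘ e) (d ∘ e) := by
      intro A
      simp only [kron_apply, Function.comp_apply]
      exact (Equiv.prod_comp e fun q => (A : Matrix (Fin n) (Fin n) ℂ) (c q) (d q)).symm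
    simp only [h1]
    have h2 := moment_eq hn a b (c ∘ e) (d ∘ e)
    rw [moment, Matrix.of_apply] at h2
    let E : Equiv.Perm P ≃ (P ≃ N) := Equiv.equivCongr (Equiv.refl P) e
    rw [h2, Fintype.sum_prod_type, ← Equiv.sum_comp E]
    refine Finset.sum_congr rfl fun σ _ => ?_
    rw [← Equiv.sum_comp E]
    refine Finset.sum_congr rfl fun τ _ => ?_
    refine if_congr Iff.rfl ?_ rfl
    congr 2
    ext p
    simp [E]
  · rw [integral_eq_zero_of_card_ne h, Finset.sum_eq_zero]
    rintro ⟨σ, -⟩ -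
    exact absurd (Fintype.card_congr σ) h

end Integration

end UnitaryWords

namespace UnitaryWords

/-! ### The combinatorics of the surface -/

section Surface

variable {r ℓ : ℕ} {w : Words r ℓ}

/-- The permutation of the places which passes to the cyclically next letter. -/
def nextPerm (w : Words r ℓ) : Equiv.Perm (Pos w) := Equiv.sigmaCongrRight fun _ => finRotate _

theorem nextPerm_apply (p : Pos w) : nextPerm w p = nextPos w p := rfl

theorem mate_of_pos (σ : MatchPairs w) {p : Pos w} {x : Fin r} (h : letter w p = (x, true))
    (j : Fin 2) : mate σ (p, j) = ((σ x j ⟨p, h⟩).1, j) := by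
  unfold mate
  split
  · rename_i y h'
    obtain rfl : y = x := by
      have := h'.symm.trans h
      simpa using this
    rfl
  · rename_i y h'
    have := h'.symm.trans h
    simp at this

theorem mate_of_neg (σ : MatchPairs w) {p : Pos w} {x : Fin r} (h : letter w p = (x, false))
    (j : Fin 2) : mate σ (p, j) = (((σ x j).symm ⟨p, h⟩).1, j) := by
  unfold mate
  split
  · rename_i y h'
    have := h'.symm.trans h
    simp at this
  · rename_i y h'
    obtain rfl : y = x := by
      have := h'.symm.trans h
      simpa using this
    rfl

theorem letter_cases (p : Pos w) : (∃ x, letter w p = (x, true)) ∨ ∃ x, letter w p = (x, false) := by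
  rcases h : letter w p with ⟨x, _ | _⟩
  · exact Or.inr ⟨x, rfl⟩
  · exact Or.inl ⟨x, rfl⟩

theorem mate_mate (σ : MatchPairs w) (z : ZPoint w) : mate σ (mate σ z) = z := by
  obtain ⟨p, j⟩ := z
  rcases letter_cases p with ⟨x, h⟩ | ⟨x, h⟩
  · rw [mate_of_pos σ h, mate_of_neg σ (σ x j ⟨p, h⟩).2]
    simp
  · rw [mate_of_neg σ h, mate_of_pos σ ((σ x j).symm ⟨p, h⟩).2]
    simp

theorem mate_snd (σ : MatchPairs w) (z : ZPoint w) : (mate σ z).2 = z.2 := by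
  obtain ⟨p, j⟩ := z
  rcases letter_cases p with ⟨x, h⟩ | ⟨x, h⟩
  · rw [mate_of_pos σ h]
  · rw [mate_of_neg σ h]

theorem letter_mate_snd (σ : MatchPairs w) (z : ZPoint w) :
    (letter w (mate σ z).1).2 = !(letter w z.1).2 := by
  obtain ⟨p, j⟩ := z
  rcases letter_cases p with ⟨x, h⟩ | ⟨x, h⟩
  · rw [mate_of_pos σ h, (σ x j ⟨p, h⟩).2, h]
    rfl
  · rw [mate_of_neg σ h, ((σ x j).symm ⟨p, h⟩).2, h]
    rfl

/-- A matching-edge joins points of equal label on letters of opposite exponent, where the order of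
the two labels is reversed. Crossing an edge therefore exchanges first and last points. -/
theorem firstZ_mate (σ : MatchPairs w) (z : ZPoint w) :
    firstZ w (mate σ z).1 = lastZ w z.1 := by
  rw [firstZ, lastZ, letter_mate_snd]
  cases (letter w z.1).2 <;> rfl

theorem lastZ_mate (σ : MatchPairs w) (z : ZPoint w) :
    lastZ w (mate σ z).1 = firstZ w z.1 := by
  rw [firstZ, lastZ, letter_mate_snd]
  cases (letter w z.1).2 <;> rfl

theorem firstZ_ne_lastZ (p : Pos w) : firstZ w p ≠ lastZ w p := by
  rw [firstZ, lastZ]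
  cases (letter w p).2 <;> simp

theorem eq_firstZ_of_ne {p : Pos w} {j : Fin 2} (h : j ≠ lastZ w p) : j = firstZ w p := by
  have := firstZ_ne_lastZ p
  omega

theorem mate_eq_mk (σ : MatchPairs w) (p : Pos w) (j : Fin 2) :
    mate σ (p, j) = ((mate σ (p, j)).1, j) := by
  conv_lhs => rw [← Prod.mk.eta (p := mate σ (p, j)), mate_snd]

/-- The permutation of the places which crosses the matching-edge at the first `z`-point of a
place; its inverse crosses the matching-edge at the last `z`-point. -/
def crossPerm (σ : MatchPairs w) : Equiv.Perm (Pos w) where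
  toFun p := (mate σ (p, firstZ w p)).1
  invFun p := (mate σ (p, lastZ w p)).1
  left_inv p := by
    dsimp only
    rw [lastZ_mate, ← mate_eq_mk, mate_mate]
  right_inv p := by
    dsimp only
    rw [firstZ_mate, ← mate_eq_mk, mate_mate]

theorem crossPerm_apply (σ : MatchPairs w) (p : Pos w) :
    crossPerm σ p = (mate σ (p, firstZ w p)).1 := rfl

theorem crossPerm_of_pos (σ : MatchPairs w) {p : Pos w} {x : Fin r}
    (h : letter w p = (x, true)) : crossPerm σ p = (σ x 0 ⟨p, h⟩).1 := by
  have : firstZ w p = 0 := by simp [firstZ, h]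
  rw [crossPerm_apply, this, mate_of_pos σ h]

theorem crossPerm_of_neg (σ : MatchPairs w) {p : Pos w} {x : Fin r}
    (h : letter w p = (x, false)) : crossPerm σ p = ((σ x 1).symm ⟨p, h⟩).1 := by
  have : firstZ w p = 1 := by simp [firstZ, h]
  rw [crossPerm_apply, this, mate_of_neg σ h]

theorem nextZPoint_last (p : Pos w) :
    nextZPoint w (p, lastZ w p) = (nextPos w p, firstZ w (nextPos w p)) := by
  simp [nextZPoint, nextPoint]

theorem nextZPoint_first (p : Pos w) : nextZPoint w (p, firstZ w p) = (p, lastZ w p) := by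
  simp [nextZPoint, nextPoint, firstZ_ne_lastZ]

theorem hasOPointAfter_iff (z : ZPoint w) : HasOPointAfter w z ↔ z.2 = lastZ w z.1 := by
  obtain ⟨p, j⟩ := z
  by_cases h : j = lastZ w p <;> simp [HasOPointAfter, nextPoint, h]

/-- From a last point the walk passes an `o`-point, reaches the first point of the next letter and
crosses to a last point again. So arcs with an `o`-point are followed only by such arcs. -/
theorem walk_last (σ : MatchPairs w) (p : Pos w) : walk σ (p, lastZ w p) =
    ((crossPerm σ * nextPerm w) p, lastZ w ((crossPerm σ * nextPerm w) p)) := by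
  rw [walk, nextZPoint_last, Equiv.Perm.mul_apply, nextPerm_apply, crossPerm_apply, lastZ_mate,
    ← mate_eq_mk]

/-- The arcs inside a letter are likewise closed under the walk, and `nextPerm` does not enter. -/
theorem walk_first (σ : MatchPairs w) (p : Pos w) : walk σ (p, firstZ w p) =
    ((crossPerm σ)⁻¹ p, firstZ w ((crossPerm σ)⁻¹ p)) := by
  rw [walk, nextZPoint_first]
  change _ = ((mate σ (p, lastZ w p)).1, firstZ w (mate σ (p, lastZ w p)).1)
  rw [firstZ_mate, ← mate_eq_mk]

/-- The discs are the cycles through arcs with an `o`-point, and those through the other arcs. -/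
def discEquiv (σ : MatchPairs w) : Disc σ ≃
    (Quot fun a b => (crossPerm σ * nextPerm w) a = b) ⊕ (Quot fun a b => (crossPerm σ)⁻¹ a = b) where
  toFun := Quot.lift (fun z => if z.2 = lastZ w z.1 then Sum.inl (Quot.mk _ z.1)
    else Sum.inr (Quot.mk _ z.1)) (by
      rintro ⟨p, j⟩ z rfl
      by_cases h : j = lastZ w p
      · subst h
        simp only [if_true, walk_last]
        exact congrArg Sum.inl (Quot.sound rfl)
      · have h' := eq_firstZ_of_ne h
        subst h'
        simp only [walk_first, firstZ_ne_lastZ, if_false]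
        exact congrArg Sum.inr (Quot.sound rfl))
  invFun := Sum.elim
    (Quot.map (fun p => (p, lastZ w p)) (by
      rintro p q rfl
      exact walk_last σ p))
    (Quot.map (fun p => (p, firstZ w p)) (by
      rintro p q rfl
      exact walk_first σ p))
  left_inv D := by
    induction D using Quot.ind with
    | _ z =>
      obtain ⟨p, j⟩ := z
      by_cases h : j = lastZ w p
      · subst h
        change Sum.elim _ _ (if lastZ w p = lastZ w p then _ else _) = _
        rw [if_pos rfl]
        rfl
      · have h' := eq_firstZ_of_ne h
        subst h'
        change Sum.elim _ _ (if firstZ w p = lastZ w p then _ else _) = _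
        rw [if_neg h]
        rfl
  right_inv s := by
    rcases s with q | q
    · induction q using Quot.ind
      exact if_pos rfl
    · induction q using Quot.ind
      exact if_neg (firstZ_ne_lastZ _)

theorem discEquiv_mk (σ : MatchPairs w) (z : ZPoint w) :
    discEquiv σ (Quot.mk _ z) = if z.2 = lastZ w z.1 then Sum.inl (Quot.mk _ z.1)
    else Sum.inr (Quot.mk _ z.1) := rfl

/-- The boundary arcs of a disc contain an `o`-point either all or not at all, so one arc decides.
-/
theorem isODisc_iff (σ : MatchPairs w) (D : Disc σ) :
    IsODisc D ↔ (discEquiv σ D).isLeft = true := by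
  constructor
  · intro h
    induction D using Quot.ind with
    | _ z =>
      have := (hasOPointAfter_iff z).mp (h z rfl)
      rw [discEquiv_mk, if_pos this]
      rfl
  · rintro h z rfl
    rw [hasOPointAfter_iff]
    by_contra hne
    rw [discEquiv_mk, if_neg hne] at h
    simp at h

theorem numODiscs_eq (σ : MatchPairs w) :
    numODiscs σ = numCycles (nextPerm w * crossPerm σ) := by
  rw [numCycles_mul_comm, ← card_quot_eq_numCycles]
  refine (Nat.card_congr (Equiv.ofBijective (fun q => (⟨(discEquiv σ).symm (Sum.inl q), by
    rw [isODisc_iff, Equiv.apply_symm_apply]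
    rfl⟩ : {D : Disc σ // IsODisc D})) ⟨?_, ?_⟩)).symm
  · intro a b hab
    exact Sum.inl_injective ((discEquiv σ).symm.injective (congrArg Subtype.val hab))
  · rintro ⟨D, hD⟩
    rw [isODisc_iff, Sum.isLeft_iff] at hD
    obtain ⟨q, hq⟩ := hD
    exact ⟨q, Subtype.ext ((discEquiv σ).symm_apply_eq.mpr hq.symm)⟩

theorem card_disc_eq (σ : MatchPairs w) :
    Nat.card (Disc σ) = numODiscs σ + numCycles (crossPerm σ) := by
  have : Finite (Pos w) := inferInstance
  rw [Nat.card_congr (discEquiv σ), Nat.card_sum, card_quot_eq_numCycles, card_quot_eq_numCycles,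
    numODiscs_eq, numCycles_mul_comm, numCycles_inv]

/-- The invariant functions of `crossPerm`, restricted to positive letters. -/
theorem numCycles_crossPerm (σ : MatchPairs w) : numCycles (crossPerm σ) =
    numCycles ((fullMatch σ 1).trans (fullMatch σ 0).symm) := by
  have h1 := card_invariant (crossPerm σ) 2
  have h2 := card_invariant ((fullMatch σ 1).trans (fullMatch σ 0).symm) 2
  -- `crossPerm` alternates between positive and negative letters, and its square on positive
  -- letters is the inverse of `σ₀⁻¹ σ₁`. An invariant function is thus determined by its
  -- restriction to the positive letters.
  suffices h : Nat.card {f : Pos w → Fin 2 // ∀ a, f (crossPerm σ a) = f a} =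
      Nat.card {f : ((x : Fin r) × PosLetter w x) → Fin 2 //
        ∀ a, f (((fullMatch σ 1).trans (fullMatch σ 0).symm) a) = f a} by
    rw [h1, h2] at h
    exact Nat.pow_right_injective le_rfl h
  refine Nat.card_congr (Equiv.ofBijective (fun f => ⟨fun a => f.1 a.2.1, ?_⟩) ⟨?_, ?_⟩)
  · rintro ⟨x, p, hp⟩
    have e1 := f.2 ((σ x 0).symm (σ x 1 ⟨p, hp⟩)).1
    rw [crossPerm_of_pos σ ((σ x 0).symm (σ x 1 ⟨p, hp⟩)).2] at e1
    have e2 := f.2 (σ x 1 ⟨p, hp⟩).1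
    rw [crossPerm_of_neg σ (σ x 1 ⟨p, hp⟩).2] at e2
    simp only [Subtype.coe_eta, Equiv.apply_symm_apply, Equiv.symm_apply_apply] at e1 e2
    change f.1 ((σ x 0).symm (σ x 1 ⟨p, hp⟩)).1 = f.1 p
    rw [← e1, ← e2]
  · intro f g hfg
    have h3 : ∀ (x : Fin r) (p : PosLetter w x), f.1 p.1 = g.1 p.1 := fun x p =>
      congrFun (congrArg Subtype.val hfg) ⟨x, p⟩
    ext1
    funext p
    rcases letter_cases p with ⟨x, h⟩ | ⟨x, h⟩
    · exact h3 x ⟨p, h⟩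
    · rw [← f.2 p, ← g.2 p, crossPerm_of_neg σ h]
      exact h3 x _
  · intro g
    -- The extension gives a negative letter the value of its partner under `σ₀`. The partner under
    -- `σ₁` has the same value because `g` is invariant.
    let F : Pos w → Fin 2 := fun p => match h : letter w p with
      | (x, true) => g.1 ⟨x, ⟨p, h⟩⟩
      | (x, false) => g.1 ⟨x, (σ x 0).symm ⟨p, h⟩⟩
    have hpos : ∀ (x : Fin r) (p : PosLetter w x), F p.1 = g.1 ⟨x, p⟩ := by
      rintro x ⟨p, hp⟩
      simp only [F]
      split
      · rename_i y h
        obtain rfl : y = x := by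
          have := h.symm.trans hp
          simpa using this
        rfl
      · rename_i y h
        have := h.symm.trans hp
        simp at this
    have hneg : ∀ (x : Fin r) (p : NegLetter w x), F p.1 = g.1 ⟨x, (σ x 0).symm p⟩ := by
      rintro x ⟨p, hp⟩
      simp only [F]
      split
      · rename_i y h
        have := h.symm.trans hp
        simp at this
      · rename_i y h
        obtain rfl : y = x := by
          have := h.symm.trans hp
          simpa using this
        rfl
    refine ⟨⟨F, fun p => ?_⟩, ?_⟩
    · rcases letter_cases p with ⟨x, h⟩ | ⟨x, h⟩
      · rw [crossPerm_of_pos σ h, hneg, hpos x ⟨p, h⟩]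
        simp
      · rw [crossPerm_of_neg σ h, hpos, hneg x ⟨p, h⟩]
        have := g.2 ⟨x, (σ x 1).symm ⟨p, h⟩⟩
        rw [← this]
        simp only [fullMatch, Equiv.trans_apply, Equiv.sigmaCongrRight_apply,
          Equiv.apply_symm_apply]
        rfl
    · ext1
      funext a
      exact hpos a.1 a.2

end Surface

end UnitaryWords

namespace UnitaryWords

/-! ### Expansion of the expected product of traces -/

section Expansion

open MeasureTheory

theorem prod_ofFn_apply {n m : ℕ} (g : Fin (m + 1) → Matrix (Fin n) (Fin n) ℂ) (i j : Fin n) :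
    (List.ofFn g).prod i j = ∑ f : Fin (m + 1) → Fin n, if f 0 = i then
      (∏ k : Fin m, g k.castSucc (f k.castSucc) (f k.succ)) * g (Fin.last m) (f (Fin.last m)) j
      else 0 := by
  induction m generalizing i with
  | zero =>
    rw [List.ofFn_succ, List.ofFn_zero, List.prod_cons, List.prod_nil, mul_one,
      ← Equiv.sum_comp (Equiv.funUnique (Fin 1) (Fin n)).symm]
    simp
  | succ m ih =>
    rw [List.ofFn_succ, List.prod_cons, Matrix.mul_apply]
    simp only [ih]
    rw [← Equiv.sum_comp (Fin.consEquiv fun _ => Fin n), Fintype.sum_prod_type]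
    simp only [Fin.consEquiv_apply, Fin.cons_zero, Finset.mul_sum]
    rw [Finset.sum_comm, Finset.sum_comm (s := (Finset.univ : Finset (Fin n)))]
    refine Finset.sum_congr rfl fun f _ => ?_
    simp only [mul_ite, mul_zero, Finset.sum_ite_eq, Finset.sum_ite_eq', Finset.mem_univ, if_true]
    rw [Fin.prod_univ_succ]
    simp only [Fin.castSucc_zero, Fin.cons_zero, Fin.cons_succ, ← Fin.succ_castSucc,
      ← Fin.succ_last, mul_assoc]

theorem trace_prod_ofFn {n m : ℕ} (hm : m ≠ 0) (g : Fin m → Matrix (Fin n) (Fin n) ℂ) :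
    (List.ofFn g).prod.trace = ∑ f : Fin m → Fin n, ∏ k, g k (f k) (f (finRotate m k)) := by
  obtain ⟨m, rfl⟩ := Nat.exists_eq_succ_of_ne_zero hm
  rw [Matrix.trace]
  simp only [Matrix.diag_apply, Nat.succ_eq_add_one, prod_ofFn_apply]
  rw [Finset.sum_comm]
  refine Finset.sum_congr rfl fun f _ => ?_
  simp only [Finset.sum_ite_eq, Finset.mem_univ, if_true]
  rw [Fin.prod_univ_castSucc]
  simp [Fin.coeSucc_eq_succ]

variable {r ℓ : ℕ} (w : Words r ℓ)

/-- The matrix entry which belongs to the letter at `p`. -/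
noncomputable def entry {n : ℕ} (A : Fin r → U n) (f : Pos w → Fin n) (p : Pos w) : ℂ :=
  if (letter w p).2 then (A (letter w p).1 : Matrix (Fin n) (Fin n) ℂ) (f p) (f (nextPos w p))
  else star ((A (letter w p).1 : Matrix (Fin n) (Fin n) ℂ) (f (nextPos w p)) (f p))

/-- The number of trivial words. -/
def numTrivial : ℕ := (Finset.univ.filter fun i => w i = 1).card

theorem coe_lift_eq {n : ℕ} (A : Fin r → U n) (i : Fin ℓ) :
    (FreeGroup.lift A (w i) : Matrix (Fin n) (Fin n) ℂ) =
      (List.ofFn fun k : Fin (w i).toWord.length =>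
        if (letter w ⟨i, k⟩).2 then (A (letter w ⟨i, k⟩).1 : Matrix (Fin n) (Fin n) ℂ)
        else star (A (letter w ⟨i, k⟩).1 : Matrix (Fin n) (Fin n) ℂ)).prod := by
  conv_lhs => rw [← FreeGroup.mk_toWord (x := w i), FreeGroup.lift_mk]
  have : ∀ l : List (U n), ((l.prod : U n) : Matrix (Fin n) (Fin n) ℂ) =
      (l.map fun B : U n => (B : Matrix (Fin n) (Fin n) ℂ)).prod := fun l =>
    map_list_prod (Matrix.unitaryGroup (Fin n) ℂ).subtype l
  rw [this, List.map_map]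
  congr 1
  apply List.ext_getElem
  · simp
  · intro k h1 h2
    simp only [List.getElem_map, List.getElem_ofFn, letter, Function.comp_apply, List.get_eq_getElem]
    have h3 : ∀ y : Fin r × Bool, ((bif y.2 then A y.1 else (A y.1)⁻¹ : U n) :
        Matrix (Fin n) (Fin n) ℂ) = if y.2 = true then (A y.1 : Matrix (Fin n) (Fin n) ℂ)
          else star (A y.1 : Matrix (Fin n) (Fin n) ℂ) := by
      rintro ⟨x, _ | _⟩ <;> rfl
    exact h3 _

/-- For a trivial word the index sum has one empty summand and equals `1`, whereas the trace is `n`.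
The extra factor corrects this. -/
theorem trace_lift_eq {n : ℕ} (A : Fin r → U n) (i : Fin ℓ) :
    Matrix.trace (FreeGroup.lift A (w i) : Matrix (Fin n) (Fin n) ℂ) =
      (if w i = 1 then (n : ℂ) else 1) * ∑ f : Fin (w i).toWord.length → Fin n,
        ∏ k, if (letter w ⟨i, k⟩).2 then
          (A (letter w ⟨i, k⟩).1 : Matrix (Fin n) (Fin n) ℂ) (f k) (f (finRotate _ k))
          else star ((A (letter w ⟨i, k⟩).1 : Matrix (Fin n) (Fin n) ℂ) (f (finRotate _ k))
            (f k)) := by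
  by_cases h : w i = 1
  · have h0 : (w i).toWord.length = 0 := by rw [h]; simp
    have : IsEmpty (Fin (w i).toWord.length) := by rw [h0]; infer_instance
    rw [if_pos h]
    simp only [Finset.univ_eq_empty, Finset.prod_empty]
    have hc : Fintype.card (Fin (w i).toWord.length) = 0 := Fintype.card_eq_zero
    rw [Finset.sum_const, Finset.card_univ, Fintype.card_fun, hc, h]
    simp
  · have h0 : (w i).toWord.length ≠ 0 := by
      rw [Ne, List.length_eq_zero_iff, FreeGroup.toWord_eq_nil_iff]
      exact h
    rw [if_neg h, one_mul, coe_lift_eq, trace_prod_ofFn h0]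
    refine Finset.sum_congr rfl fun f _ => Finset.prod_congr rfl fun k _ => ?_
    split_ifs <;> rfl

theorem prod_trace_eq {n : ℕ} (A : Fin r → U n) :
    ∏ i, Matrix.trace (FreeGroup.lift A (w i) : Matrix (Fin n) (Fin n) ℂ) =
      (n : ℂ) ^ numTrivial w * ∑ f : Pos w → Fin n, ∏ p, entry w A f p := by
  simp only [trace_lift_eq, Finset.prod_mul_distrib]
  congr 1
  · rw [Finset.prod_ite]
    simp [numTrivial]
  · rw [Finset.prod_univ_sum, Fintype.piFinset_univ,
      ← Equiv.sum_comp (Equiv.piCurry fun (i : Fin ℓ) (_ : Fin (w i).toWord.length) => Fin n)]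
    refine Finset.sum_congr rfl fun f _ => ?_
    rw [Fintype.prod_sigma]
    rfl

theorem prod_entry_eq {n : ℕ} (A : Fin r → U n) (f : Pos w → Fin n) :
    ∏ p, entry w A f p = ∏ x, (kron (PosLetter w x) (A x : Matrix (Fin n) (Fin n) ℂ)
        (fun p => f p.1) (fun p => f (nextPos w p.1)) *
      star (kron (NegLetter w x) (A x : Matrix (Fin n) (Fin n) ℂ)
        (fun p => f (nextPos w p.1)) (fun p => f p.1))) := by
  -- Grouping the places by letter isolates the dependence on each `A x`.
  rw [← Fintype.prod_fiberwise (letter w), Fintype.prod_prod_type]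
  refine Finset.prod_congr rfl fun x _ => ?_
  rw [Fintype.prod_bool]
  simp only [kron_apply, star_prod]
  congr 1
  · refine Finset.prod_congr rfl fun p _ => ?_
    rw [entry, p.2]
    rfl
  · refine Finset.prod_congr rfl fun p _ => ?_
    rw [entry, p.2]
    rfl

/-- The condition under which an index assignment contributes to the summand of `σ`. -/
theorem forall_cond_iff {n : ℕ} (f : Pos w → Fin n) (σ : MatchPairs w) :
    (∀ x, ((fun p : PosLetter w x => f p.1) =
        (fun q : NegLetter w x => f (nextPos w q.1)) ∘ σ x 0 ∧
      (fun p : PosLetter w x => f (nextPos w p.1)) =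
        (fun q : NegLetter w x => f q.1) ∘ σ x 1)) ↔
      ∀ p, f ((nextPerm w * crossPerm σ) p) = f p := by
  constructor
  · intro h p
    rw [Equiv.Perm.mul_apply, nextPerm_apply]
    rcases letter_cases p with ⟨x, hx⟩ | ⟨x, hx⟩
    · rw [crossPerm_of_pos σ hx]
      exact (congrFun (h x).1 ⟨p, hx⟩).symm
    · rw [crossPerm_of_neg σ hx]
      have := congrFun (h x).2 ((σ x 1).symm ⟨p, hx⟩)
      simpa using this
  · intro h x
    constructor
    · funext p
      have := h p.1
      rw [Equiv.Perm.mul_apply, nextPerm_apply, crossPerm_of_pos σ p.2] at this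
      exact this.symm
    · funext p
      have := h (σ x 1 p).1
      rw [Equiv.Perm.mul_apply, nextPerm_apply, crossPerm_of_neg σ (σ x 1 p).2] at this
      simpa using this

theorem integral_prod_entry {n : ℕ} (hn : ∀ x, L w x ≤ n) (f : Pos w → Fin n) :
    ∫ A : Fin r → U n, ∏ p, entry w A f p ∂(Measure.pi fun _ => haarU n) =
      ∑ σ : MatchPairs w, if ∀ p, f ((nextPerm w * crossPerm σ) p) = f p then
        ∏ x, (wgAt n ((σ x 1).trans (σ x 0).symm) : ℂ) else 0 := by
  simp only [prod_entry_eq]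
  rw [integral_fintype_prod_eq_prod (μ := fun _ => haarU n) (f := fun x (B : U n) =>
    kron (PosLetter w x) (B : Matrix (Fin n) (Fin n) ℂ) (fun p => f p.1)
      (fun p => f (nextPos w p.1)) * star (kron (NegLetter w x) (B : Matrix (Fin n) (Fin n) ℂ)
        (fun p => f (nextPos w p.1)) (fun p => f p.1))),
    Finset.prod_congr rfl fun x _ => integral_kron_mul_star (hn x) _ _ _ _,
    Finset.prod_univ_sum, Fintype.piFinset_univ,
    ← Equiv.sum_comp (Equiv.piCongrRight fun x =>
      finTwoArrowEquiv (PosLetter w x ≃ NegLetter w x))]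
  refine Finset.sum_congr rfl fun σ _ => ?_
  rw [Finset.prod_ite_zero]
  have hiff := forall_cond_iff w f σ
  by_cases h : ∀ p, f ((nextPerm w * crossPerm σ) p) = f p
  · rw [if_pos h]
    exact if_pos fun x _ => hiff.mpr h x
  · rw [if_neg h]
    exact if_neg fun h' => h (hiff.mp fun x => h' x (Finset.mem_univ x))

theorem integrable_prod_entry {n : ℕ} (f : Pos w → Fin n) :
    Integrable (fun A : Fin r → U n => ∏ p, entry w A f p) (Measure.pi fun _ => haarU n) := by
  simp only [prod_entry_eq]
  exact Integrable.fintype_prod (f := fun x (B : U n) =>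
    kron (PosLetter w x) (B : Matrix (Fin n) (Fin n) ℂ) (fun p => f p.1)
      (fun p => f (nextPos w p.1)) * star (kron (NegLetter w x) (B : Matrix (Fin n) (Fin n) ℂ)
        (fun p => f (nextPos w p.1)) (fun p => f p.1)))
    fun x => integrable_haarU ((continuous_kron _ _).mul (continuous_kron _ _).star)

/-- The expected product of traces as a sum over pairs of matchings, for arbitrary words. -/
theorem tr_eq {n : ℕ} (hn : ∀ x, L w x ≤ n) :
    Tr w n = (((n : ℚ) ^ numTrivial w * ∑ σ : MatchPairs w,
      (∏ x, wgAt n ((σ x 1).trans (σ x 0).symm)) * (n : ℚ) ^ numODiscs σ : ℚ) : ℂ) := by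
  rw [Tr]
  simp only [prod_trace_eq]
  rw [integral_const_mul, integral_finsetSum _ fun f _ => integrable_prod_entry w f]
  simp only [integral_prod_entry w hn]
  rw [Finset.sum_comm]
  simp only [Rat.cast_mul, Rat.cast_pow, Rat.cast_natCast, Rat.cast_sum, Rat.cast_prod]
  congr 1
  refine Finset.sum_congr rfl fun σ _ => ?_
  -- After exchanging the sums, `σ` is weighted by the number of invariant index assignments.
  rw [← Finset.sum_filter, Finset.sum_const, nsmul_eq_mul, mul_comm]
  congr 1
  rw [numODiscs_eq, ← Nat.cast_pow, ← card_invariant, Nat.card_eq_fintype_card,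
    Fintype.card_subtype]

end Expansion

end UnitaryWords

namespace UnitaryWords

/-! ### The summands and their asymptotics -/

section Summands

open Filter Asymptotics

variable {r ℓ : ℕ} {w : Words r ℓ}

theorem summand_eq {n : ℕ} (hn : ∀ x, L w x ≤ n) (σ : MatchPairs w) :
    summand σ n = (∏ x, wgAt n ((σ x 1).trans (σ x 0).symm)) * (n : ℚ) ^ numODiscs σ := by
  rw [summand]
  congr 1
  exact Finset.prod_congr rfl fun x _ => (hasValueAt_wg (hn x) _).2

theorem tr_eq_sum_summand (hw : ∀ i, w i ≠ 1) {n : ℕ} (hn : ∀ x, L w x ≤ n) :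
    Tr w n = ((∑ σ : MatchPairs w, summand σ n : ℚ) : ℂ) := by
  have h0 : numTrivial w = 0 := by simp [numTrivial, hw]
  rw [tr_eq w hn, h0, pow_zero, one_mul]
  simp only [summand_eq hn]

/-- Vertices and circle arcs cancel, leaving `-2 * ∑ L_x` from the matching-edges. The discs without
`o`-points are the cycles of `σ₀⁻¹ σ₁`, whose number is `∑ L_x` minus the total defect. -/
theorem eulerChar_eq (σ : MatchPairs w) :
    eulerChar σ = numODiscs σ -
      ∑ x, (Fintype.card (PosLetter w x) + defect ((σ x 1).trans (σ x 0).symm) : ℤ) := by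
  have h1 : (Nat.card (Vertex σ) : ℤ) = 3 * Fintype.card (Pos w) := by
    rw [Nat.card_eq_fintype_card, Fintype.card_sum, Fintype.card_prod, Fintype.card_fin]
    push_cast
    ring
  have h2 : (Nat.card (Edge σ) : ℤ) = 3 * Fintype.card (Pos w) + 2 * ∑ x, (L w x : ℤ) := by
    rw [Nat.card_eq_fintype_card, Fintype.card_sum, Fintype.card_sum, Fintype.card_prod,
      Fintype.card_fin, Fintype.card_sigma (α := fun x => Fin 2 × PosLetter w x)]
    simp only [Fintype.card_prod, Fintype.card_fin, L]
    push_cast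
    rw [Finset.mul_sum]
    ring
  have h3 : numCycles ((fullMatch σ 1).trans (fullMatch σ 0).symm) +
      ∑ x, defect ((σ x 1).trans (σ x 0).symm) = ∑ x, L w x := by
    have h4 := numCycles_add_defect ((fullMatch σ 1).trans (fullMatch σ 0).symm)
    have h5 : defect ((fullMatch σ 1).trans (fullMatch σ 0).symm) =
        ∑ x, defect ((σ x 1).trans (σ x 0).symm) :=
      defect_sigmaCongrRight fun x => (σ x 1).trans (σ x 0).symm
    rw [h5, Fintype.card_sigma] at h4
    exact h4
  have h6 : ((∑ x, L w x : ℕ) : ℤ) = ∑ x, (Fintype.card (PosLetter w x) : ℤ) := by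
    push_cast
    rfl
  rw [eulerChar, h1, h2, card_disc_eq, numCycles_crossPerm, Finset.sum_add_distrib, ← h6]
  have h7 := congrArg (fun k : ℕ => (k : ℤ)) h3
  push_cast at h7 ⊢
  linarith

theorem isBigO_prod_sub_prod {ι : Type*} (s : Finset ι) {f : ι → ℕ → ℝ} {c : ι → ℝ} {g : ℕ → ℝ}
    (hg : g =O[atTop] fun _ => (1 : ℝ)) (h : ∀ i ∈ s, (fun n => f i n - c i) =O[atTop] g) :
    (fun n => ∏ i ∈ s, f i n - ∏ i ∈ s, c i) =O[atTop] g := by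
  classical
  induction s using Finset.induction with
  | empty => simpa using isBigO_zero _ _
  | insert i s hi ih =>
    have h1 := ih fun j hj => h j (Finset.mem_insert_of_mem hj)
    have h2 := h i (Finset.mem_insert_self i s)
    have h3 : (fun n => ∏ j ∈ s, f j n) =O[atTop] fun _ => (1 : ℝ) := by
      have := (h1.trans hg).add (isBigO_const_const (∏ j ∈ s, c j) (one_ne_zero (α := ℝ)) atTop)
      simpa using this
    -- The usual telescoping: `f * F - c * C = (f - c) * F + c * (F - C)`, where `F` is bounded.
    have h4 : (fun n => (f i n - c i) * ∏ j ∈ s, f j n +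
        c i * (∏ j ∈ s, f j n - ∏ j ∈ s, c j)) =O[atTop] g := by
      refine IsBigO.add ?_ (h1.const_mul_left _)
      simpa using h2.mul h3
    refine h4.congr_left fun n => ?_
    rw [Finset.prod_insert hi, Finset.prod_insert hi]
    ring

theorem summand_sub_isBigO (σ : MatchPairs w) :
    (fun n : ℕ => (summand σ n : ℝ) -
        (moeb ((fullMatch σ 1).trans (fullMatch σ 0).symm) : ℝ) * (n : ℝ) ^ eulerChar σ)
      =O[atTop] (fun n : ℕ => (n : ℝ) ^ (eulerChar σ - 2)) := by
  have hinv : (fun n : ℕ => ((n : ℝ) ^ 2)⁻¹) =O[atTop] (fun _ : ℕ => (1 : ℝ)) := by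
    refine IsBigO.of_bound 1 ?_
    filter_upwards [eventually_ge_atTop 1] with n hn
    have : (1 : ℝ) ≤ n := by exact_mod_cast hn
    rw [Real.norm_of_nonneg (by positivity), norm_one, one_mul]
    exact inv_le_one_of_one_le₀ (by nlinarith)
  have h1 := isBigO_prod_sub_prod (Finset.univ : Finset (Fin r)) hinv
    (f := fun x n => wgNorm n ((σ x 1).trans (σ x 0).symm))
    (c := fun x => (moeb ((σ x 1).trans (σ x 0).symm) : ℝ))
    fun x _ => wgNorm_sub_moeb_isBigO _
  have h2 : moeb ((fullMatch σ 1).trans (fullMatch σ 0).symm) =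
      ∏ x, moeb ((σ x 1).trans (σ x 0).symm) :=
    moeb_sigmaCongrRight fun x => (σ x 1).trans (σ x 0).symm
  have h3 := h1.mul (isBigO_refl (fun n : ℕ => (n : ℝ) ^ eulerChar σ) atTop)
  refine h3.congr' ?_ ?_
  · filter_upwards [eventually_ge_atTop 1,
      eventually_all.mpr fun x => eventually_ge_atTop (L w x)] with n hn1 hn
    have hn0 : (n : ℝ) ≠ 0 := by
      exact_mod_cast (by omega : n ≠ 0)
    rw [h2, summand_eq hn, sub_mul]
    push_cast
    congr 1
    simp only [wgNorm]
    rw [Finset.prod_mul_distrib, Finset.prod_pow_eq_pow_sum, mul_comm, ← mul_assoc, mul_comm]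
    congr 1
    -- The normalising powers `n ^ (L_x + |π_x|)` are exactly what separates `n ^ χ(σ)` from `n ^
    -- #{o-discs}`.
    rw [eulerChar_eq, zpow_sub₀ hn0, zpow_natCast]
    rw [← zpow_natCast (n : ℝ) (∑ x, _)]
    push_cast
    rw [div_mul_cancel₀]
    exact zpow_ne_zero _ hn0
  · filter_upwards [eventually_ge_atTop 1] with n hn1
    have hn0 : (n : ℝ) ≠ 0 := by
      exact_mod_cast (by omega : n ≠ 0)
    rw [zpow_sub₀ hn0, div_eq_mul_inv, mul_comm]
    norm_cast

end Summands

end UnitaryWords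

namespace UnitaryWords

/-! ### Primitive recursive functions -/

section Primrec

variable {γ : Type*} [Primcodable γ]

theorem primrec_sum_range {b : γ → ℕ} {f : γ → ℕ → ℕ} (hb : Primrec b)
    (hf : Primrec fun x : γ × ℕ => f x.1 x.2) :
    Primrec fun x => ∑ j ∈ Finset.range (b x), f x j := by
  have h : Primrec fun x => (Nat.rec 0 (fun n s => s + f x n) (b x) : ℕ) :=
    Primrec.nat_rec' hb (Primrec.const 0) (Primrec.nat_add.comp
      (Primrec.snd.comp Primrec.snd)
      (hf.comp (Primrec.pair Primrec.fst (Primrec.fst.comp Primrec.snd)))).to₂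
  refine h.of_eq fun x => ?_
  induction b x with
  | zero => rfl
  | succ n ih =>
    rw [Finset.sum_range_succ, ← ih]

theorem primrecPred_forall_lt {b : γ → ℕ} {p : γ → ℕ → Prop} (hb : Primrec b)
    (hp : PrimrecPred fun x : γ × ℕ => p x.1 x.2) :
    PrimrecPred fun x => ∀ j < b x, p x j := by
  have h : PrimrecRel fun (j : ℕ) (x : γ) => p x j :=
    (hp.comp (Primrec.pair Primrec.snd Primrec.fst)).primrecRel
  exact (h.forall_mem_list.comp (Primrec.list_range.comp hb) Primrec.id).of_eq (by simp)

theorem primrecPred_exists_lt {b : γ → ℕ} {p : γ → ℕ → Prop} (hb : Primrec b)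
    (hp : PrimrecPred fun x : γ × ℕ => p x.1 x.2) :
    PrimrecPred fun x => ∃ j < b x, p x j := by
  have h : PrimrecRel fun (j : ℕ) (x : γ) => p x j :=
    (hp.comp (Primrec.pair Primrec.snd Primrec.fst)).primrecRel
  exact (h.exists_mem_list.comp (Primrec.list_range.comp hb) Primrec.id).of_eq (by simp)

theorem primrec_pow {f g : γ → ℕ} (hf : Primrec f) (hg : Primrec g) :
    Primrec fun x => f x ^ g x :=
  (Primrec₂.unpaired'.mp Nat.Primrec.pow).comp hf hg

theorem primrecPred_imp {p q : γ → Prop} (hp : PrimrecPred p) (hq : PrimrecPred q) :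
    PrimrecPred fun x => p x → q x :=
  (hp.not.or hq).of_eq fun x => by tauto

/-- Integers are encoded by interleaving: `k` has the code `2 * k`, and `-(k + 1)` has the code `2 *
k + 1`. -/
theorem primrec_subNatNat {f g : γ → ℕ} (hf : Primrec f) (hg : Primrec g) :
    Primrec fun x => Int.subNatNat (f x) (g x) := by
  rw [← Primrec.encode_iff]
  have h : Primrec fun x => if g x ≤ f x then 2 * (f x - g x) else 2 * (g x - f x - 1) + 1 :=
    Primrec.ite (Primrec.nat_le.comp hg hf)
      (Primrec.nat_mul.comp (Primrec.const 2) (Primrec.nat_sub.comp hf hg))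
      (Primrec.succ.comp (Primrec.nat_mul.comp (Primrec.const 2)
        (Primrec.nat_sub.comp (Primrec.nat_sub.comp hg hf) (Primrec.const 1))))
  refine h.of_eq fun x => ?_
  split_ifs with hle
  · rw [Int.subNatNat_of_le hle]
    rfl
  · push Not at hle
    rw [Int.subNatNat_of_lt hle]
    rfl

end Primrec

/-! ### The algorithm -/

section Algorithm

open Classical in
/-- The number of `p < b` with property `P`. -/
noncomputable def countBelow (b : ℕ) (P : ℕ → Prop) : ℕ :=
  ∑ p ∈ Finset.range b, if P p then 1 else 0

variable {r : ℕ}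

/-- A number which exceeds the number of words and their lengths. -/
def side (W : List (List (Fin r × Bool))) : ℕ := W.length + W.flatten.length + 1

/-- A bound for the numbers which encode places; `i * side W + k` stands for the `k`-th letter of
the `i`-th word. -/
def placeBound (W : List (List (Fin r × Bool))) : ℕ := side W * side W

/-- The letter at a place. -/
def letterAt (W : List (List (Fin r × Bool))) (p : ℕ) : Option (Fin r × Bool) :=
  W[p / side W]?.bind fun u => u[p % side W]?

/-- The inverse letter. -/
def flipLetter (l : Fin r × Bool) : Fin r × Bool := (l.1, !l.2)

/-- The cyclically next place. -/
def nextAt (W : List (List (Fin r × Bool))) (p : ℕ) : ℕ :=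
  if (letterAt W (p + 1)).isSome = true then p + 1 else p / side W * side W

/-- The self-map of the places encoded by the digits of a number. -/
def digit (W : List (List (Fin r × Bool))) (c p : ℕ) : ℕ := c / placeBound W ^ p % placeBound W

/-- A bound for the numbers which encode self-maps of the places. -/
def codeBound (W : List (List (Fin r × Bool))) : ℕ := placeBound W ^ placeBound W

/-- The number `c` encodes a matching of the letters with inverse letters. -/
def IsMatching (W : List (List (Fin r × Bool))) (c : ℕ) : Prop :=
  ∀ p < placeBound W, letterAt W (digit W c p) = (letterAt W p).map flipLetter ∧
    digit W c (digit W c p) = p ∧ (letterAt W p = none → digit W c p = p)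

/-- The letter at a place is a letter with exponent `+1`. -/
def IsPositiveAt (W : List (List (Fin r × Bool))) (p : ℕ) : Prop :=
  (letterAt W p).map Prod.snd = some true

/-- The number of cycles of `σ₀⁻¹ σ₁` on the positive letters. -/
noncomputable def gramExponent (W : List (List (Fin r × Bool))) (c c' : ℕ) : ℕ :=
  countBelow (placeBound W) fun p => IsPositiveAt W p ∧
    ∀ k < placeBound W, p ≤ (fun q => digit W c (digit W c' q))^[k] p

open Classical in
/-- Crossing a matching-edge and passing to the next letter. -/
noncomputable def crossNext (W : List (List (Fin r × Bool))) (c c' p : ℕ) : ℕ :=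
  nextAt W (if IsPositiveAt W p then digit W c p else digit W c' p)

/-- The number of `o`-discs. -/
noncomputable def discExponent (W : List (List (Fin r × Bool))) (c c' : ℕ) : ℕ :=
  countBelow (placeBound W) fun p => (letterAt W p).isSome = true ∧
    ∀ k < placeBound W, p ≤ (crossNext W c c')^[k] p

/-- The number of empty words. -/
noncomputable def emptyCount (W : List (List (Fin r × Bool))) : ℕ :=
  countBelow W.length fun i => W[i]? = some []

/-- The words are reduced. -/
def IsReducedInput (W : List (List (Fin r × Bool))) : Prop :=
  ∀ p < placeBound W, (letterAt W p).isSome = true →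
    letterAt W (p + 1) ≠ (letterAt W p).map flipLetter

/-- The `j`-th coefficient of the polynomial with index `(c, e)` in a table. -/
def tableEntry (a : List ℕ) (c e j : ℕ) : ℕ := a.getD (Nat.pair (Nat.pair c e) j) 0

/-- A certificate `((a, b), (a', b'))` encodes a matrix of polynomials `a - b` and a polynomial
`a' - b'`. -/
abbrev Certificate : Type := (List ℕ × List ℕ) × (List ℕ × List ℕ)

open Classical in
/-- Coefficients of the product of a matrix of polynomials with the Gram matrix. -/
noncomputable def productEntry (W : List (List (Fin r × Bool))) (a : List ℕ) (B c c' j : ℕ) : ℕ :=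
  ∑ e ∈ Finset.range (codeBound W),
    if IsMatching W e ∧ gramExponent W e c' ≤ j ∧ j - gramExponent W e c' < B then
      tableEntry a c e (j - gramExponent W e c') else 0

open Classical in
/-- Coefficients of the product of a scalar polynomial with the identity matrix. -/
noncomputable def scalarEntry (d : List ℕ) (B c c' j : ℕ) : ℕ :=
  if c = c' ∧ j < B then d.getD j 0 else 0

/-- The matrix of polynomials in the certificate is a multiple of the inverse Gram matrix. -/
def IsCertificate (W : List (List (Fin r × Bool))) (t : Certificate) : Prop :=
  (∃ j < t.2.1.length, t.2.1.getD j 0 ≠ t.2.2.getD j 0) ∧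
    ∀ c < codeBound W, ∀ c' < codeBound W, IsMatching W c → IsMatching W c' →
      ∀ j < t.2.1.length + placeBound W + 1,
        productEntry W t.1.1 t.2.1.length c c' j + scalarEntry t.2.2 t.2.1.length c c' j =
          productEntry W t.1.2 t.2.1.length c c' j + scalarEntry t.2.1 t.2.1.length c c' j

open Classical in
/-- Coefficients of the numerator. -/
noncomputable def numeratorEntry (W : List (List (Fin r × Bool))) (a : List ℕ) (B j : ℕ) : ℕ :=
  ∑ c ∈ Finset.range (codeBound W), ∑ e ∈ Finset.range (codeBound W),
    if IsMatching W c ∧ IsMatching W e ∧ discExponent W c e + emptyCount W ≤ j ∧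
      j - (discExponent W c e + emptyCount W) < B then
      tableEntry a c e (j - (discExponent W c e + emptyCount W)) else 0

/-- The numerator and the denominator computed from a certificate. -/
noncomputable def outputOf (W : List (List (Fin r × Bool))) (t : Certificate) :
    List ℤ × List ℤ :=
  ((List.range (t.2.1.length + placeBound W + emptyCount W + 1)).map fun j =>
      Int.subNatNat (numeratorEntry W t.1.1 t.2.1.length j)
        (numeratorEntry W t.1.2 t.2.1.length j),
    (List.range t.2.1.length).map fun j =>
      Int.subNatNat (t.2.1.getD j 0) (t.2.2.getD j 0))

open Classical in
/-- One step of the search for a certificate. -/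
noncomputable def searchStep (W : List (List (Fin r × Bool))) (k : ℕ) :
    Option (List ℤ × List ℤ) :=
  if IsReducedInput W then
    (Encodable.decode (α := Certificate) k).bind fun t =>
      if IsCertificate W t then some (outputOf W t) else none
  else some ([], [])

/-! ### Primitive recursiveness of the search step -/

section Computability

variable {γ : Type*} [Primcodable γ] {W : γ → List (List (Fin r × Bool))} {b c d e j p : γ → ℕ}
  {l : γ → List ℕ}

theorem primrec_countBelow {P : γ → ℕ → Prop} (hb : Primrec b)
    (hP : PrimrecPred fun x : γ × ℕ => P x.1 x.2) :
    Primrec fun x => countBelow (b x) (P x) := by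
  classical
  exact primrec_sum_range hb (Primrec.ite hP (Primrec.const 1) (Primrec.const 0))

theorem primrec_side (hW : Primrec W) : Primrec fun x => side (W x) :=
  Primrec.succ.comp (Primrec.nat_add.comp (Primrec.list_length.comp hW)
    (Primrec.list_length.comp (Primrec.list_flatten.comp hW)))

theorem primrec_placeBound (hW : Primrec W) : Primrec fun x => placeBound (W x) :=
  Primrec.nat_mul.comp (primrec_side hW) (primrec_side hW)

theorem primrec_letterAt (hW : Primrec W) (hp : Primrec p) :
    Primrec fun x => letterAt (W x) (p x) :=
  Primrec.option_bind
    (Primrec.list_getElem?.comp hW (Primrec.nat_div.comp hp (primrec_side hW)))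
    (Primrec.list_getElem?.comp Primrec.snd
      ((Primrec.nat_mod.comp hp (primrec_side hW)).comp Primrec.fst))

theorem primrec_map_flipLetter {o : γ → Option (Fin r × Bool)} (ho : Primrec o) :
    Primrec fun x => (o x).map flipLetter :=
  (Primrec.option_map₁ (Primrec.dom_finite flipLetter)).comp ho

theorem primrec_nextAt (hW : Primrec W) (hp : Primrec p) :
    Primrec fun x => nextAt (W x) (p x) :=
  Primrec.ite (Primrec.eq.comp (Primrec.option_isSome.comp
      (primrec_letterAt hW (Primrec.succ.comp hp))) (Primrec.const true))
    (Primrec.succ.comp hp)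
    (Primrec.nat_mul.comp (Primrec.nat_div.comp hp (primrec_side hW)) (primrec_side hW))

theorem primrec_digit (hW : Primrec W) (hc : Primrec c) (hp : Primrec p) :
    Primrec fun x => digit (W x) (c x) (p x) :=
  Primrec.nat_mod.comp (Primrec.nat_div.comp hc (primrec_pow (primrec_placeBound hW) hp))
    (primrec_placeBound hW)

theorem primrec_codeBound (hW : Primrec W) : Primrec fun x => codeBound (W x) :=
  primrec_pow (primrec_placeBound hW) (primrec_placeBound hW)

theorem primrecPred_isMatching (hW : Primrec W) (hc : Primrec c) :
    PrimrecPred fun x => IsMatching (W x) (c x) := by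
  have hW' : Primrec fun x : γ × ℕ => W x.1 := hW.comp Primrec.fst
  have hc' : Primrec fun x : γ × ℕ => c x.1 := hc.comp Primrec.fst
  have hp : Primrec fun x : γ × ℕ => x.2 := Primrec.snd
  have hd := primrec_digit hW' hc' hp
  exact primrecPred_forall_lt (primrec_placeBound hW)
    ((Primrec.eq.comp (primrec_letterAt hW' hd)
      (primrec_map_flipLetter (primrec_letterAt hW' hp))).and
    ((Primrec.eq.comp (primrec_digit hW' hc' hd) hp).and
      (primrecPred_imp (Primrec.eq.comp (primrec_letterAt hW' hp) (Primrec.const none))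
        (Primrec.eq.comp hd hp))))

theorem primrecPred_isPositiveAt (hW : Primrec W) (hp : Primrec p) :
    PrimrecPred fun x => IsPositiveAt (W x) (p x) :=
  Primrec.eq.comp ((Primrec.option_map₁ Primrec.snd).comp (primrec_letterAt hW hp))
    (Primrec.const (some true))

theorem primrec_gramExponent (hW : Primrec W) (hc : Primrec c) (hd : Primrec d) :
    Primrec fun x => gramExponent (W x) (c x) (d x) := by
  have hW1 : Primrec fun x : γ × ℕ => W x.1 := hW.comp Primrec.fst
  refine primrec_countBelow (primrec_placeBound hW)
    ((primrecPred_isPositiveAt hW1 Primrec.snd).and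
      (primrecPred_forall_lt (primrec_placeBound hW1) (Primrec.nat_le.comp
        (Primrec.snd.comp Primrec.fst) (Primrec.nat_iterate Primrec.snd
          (Primrec.snd.comp Primrec.fst) ?_))))
  have hf : Primrec fun x : ((γ × ℕ) × ℕ) × ℕ => x.1.1.1 :=
    Primrec.fst.comp (Primrec.fst.comp Primrec.fst)
  exact primrec_digit (hW.comp hf) (hc.comp hf)
    (primrec_digit (hW.comp hf) (hd.comp hf) Primrec.snd)

theorem primrec_crossNext (hW : Primrec W) (hc : Primrec c) (hd : Primrec d) (hp : Primrec p) :
    Primrec fun x => crossNext (W x) (c x) (d x) (p x) := by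
  classical
  exact primrec_nextAt hW (Primrec.ite (primrecPred_isPositiveAt hW hp)
    (primrec_digit hW hc hp) (primrec_digit hW hd hp))

theorem primrec_discExponent (hW : Primrec W) (hc : Primrec c) (hd : Primrec d) :
    Primrec fun x => discExponent (W x) (c x) (d x) := by
  have hW1 : Primrec fun x : γ × ℕ => W x.1 := hW.comp Primrec.fst
  refine primrec_countBelow (primrec_placeBound hW)
    ((Primrec.eq.comp (Primrec.option_isSome.comp (primrec_letterAt hW1 Primrec.snd))
      (Primrec.const true)).and
      (primrecPred_forall_lt (primrec_placeBound hW1) (Primrec.nat_le.comp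
        (Primrec.snd.comp Primrec.fst) (Primrec.nat_iterate Primrec.snd
          (Primrec.snd.comp Primrec.fst) ?_))))
  have hf : Primrec fun x : ((γ × ℕ) × ℕ) × ℕ => x.1.1.1 :=
    Primrec.fst.comp (Primrec.fst.comp Primrec.fst)
  exact primrec_crossNext (hW.comp hf) (hc.comp hf) (hd.comp hf) Primrec.snd

theorem primrec_emptyCount (hW : Primrec W) : Primrec fun x => emptyCount (W x) :=
  primrec_countBelow (Primrec.list_length.comp hW)
    (Primrec.eq.comp (Primrec.list_getElem?.comp (hW.comp Primrec.fst) Primrec.snd)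
      (Primrec.const (some [])))

theorem primrecPred_isReducedInput (hW : Primrec W) :
    PrimrecPred fun x => IsReducedInput (W x) := by
  have hW1 : Primrec fun x : γ × ℕ => W x.1 := hW.comp Primrec.fst
  have hl := primrec_letterAt hW1 Primrec.snd
  exact primrecPred_forall_lt (primrec_placeBound hW)
    (primrecPred_imp (Primrec.eq.comp (Primrec.option_isSome.comp hl) (Primrec.const true))
      (Primrec.eq.comp (primrec_letterAt hW1 (Primrec.succ.comp Primrec.snd))
        (primrec_map_flipLetter hl)).not)

theorem primrec_tableEntry (hl : Primrec l) (hc : Primrec c) (he : Primrec e) (hj : Primrec j) :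
    Primrec fun x => tableEntry (l x) (c x) (e x) (j x) :=
  (Primrec.list_getD 0).comp hl
    (Primrec₂.natPair.comp (Primrec₂.natPair.comp hc he) hj)

theorem primrec_productEntry (hW : Primrec W) (hl : Primrec l) (hb : Primrec b) (hc : Primrec c)
    (hd : Primrec d) (hj : Primrec j) :
    Primrec fun x => productEntry (W x) (l x) (b x) (c x) (d x) (j x) := by
  classical
  have hf : Primrec fun x : γ × ℕ => x.1 := Primrec.fst
  have hs : Primrec fun x : γ × ℕ => x.2 := Primrec.snd
  have hg := primrec_gramExponent (hW.comp hf) hs (hd.comp hf)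
  have hsub := Primrec.nat_sub.comp (hj.comp hf) hg
  exact primrec_sum_range (primrec_codeBound hW) (Primrec.ite
    ((primrecPred_isMatching (hW.comp hf) hs).and
      ((Primrec.nat_le.comp hg (hj.comp hf)).and (Primrec.nat_lt.comp hsub (hb.comp hf))))
    (primrec_tableEntry (hl.comp hf) (hc.comp hf) hs hsub) (Primrec.const 0))

theorem primrec_scalarEntry (hl : Primrec l) (hb : Primrec b) (hc : Primrec c)
    (hd : Primrec d) (hj : Primrec j) :
    Primrec fun x => scalarEntry (l x) (b x) (c x) (d x) (j x) := by
  classical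
  exact Primrec.ite ((Primrec.eq.comp hc hd).and (Primrec.nat_lt.comp hj hb))
    ((Primrec.list_getD 0).comp hl hj) (Primrec.const 0)

theorem primrecPred_isCertificate {t : γ → Certificate} (hW : Primrec W) (ht : Primrec t) :
    PrimrecPred fun x => IsCertificate (W x) (t x) := by
  have h11 : Primrec fun x => (t x).1.1 := Primrec.fst.comp (Primrec.fst.comp ht)
  have h12 : Primrec fun x => (t x).1.2 := Primrec.snd.comp (Primrec.fst.comp ht)
  have h21 : Primrec fun x => (t x).2.1 := Primrec.fst.comp (Primrec.snd.comp ht)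
  have h22 : Primrec fun x => (t x).2.2 := Primrec.snd.comp (Primrec.snd.comp ht)
  have hB : Primrec fun x => (t x).2.1.length := Primrec.list_length.comp h21
  refine PrimrecPred.and (primrecPred_exists_lt hB ?_) ?_
  · exact (Primrec.eq.comp ((Primrec.list_getD 0).comp (h21.comp Primrec.fst) Primrec.snd)
      ((Primrec.list_getD 0).comp (h22.comp Primrec.fst) Primrec.snd)).not
  · have f1 : Primrec fun x : γ × ℕ => x.1 := Primrec.fst
    have f2 : Primrec fun x : (γ × ℕ) × ℕ => x.1.1 := Primrec.fst.comp Primrec.fst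
    have f3 : Primrec fun x : ((γ × ℕ) × ℕ) × ℕ => x.1.1.1 := f2.comp Primrec.fst
    have hc : Primrec fun x : ((γ × ℕ) × ℕ) × ℕ => x.1.1.2 :=
      Primrec.snd.comp (Primrec.fst.comp Primrec.fst)
    have hc' : Primrec fun x : ((γ × ℕ) × ℕ) × ℕ => x.1.2 := Primrec.snd.comp Primrec.fst
    have hj : Primrec fun x : ((γ × ℕ) × ℕ) × ℕ => x.2 := Primrec.snd
    refine primrecPred_forall_lt (primrec_codeBound hW) (primrecPred_forall_lt
      (primrec_codeBound (hW.comp f1)) (primrecPred_imp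
        (primrecPred_isMatching (hW.comp f2) (Primrec.snd.comp Primrec.fst))
        (primrecPred_imp (primrecPred_isMatching (hW.comp f2) Primrec.snd)
          (primrecPred_forall_lt (Primrec.succ.comp (Primrec.nat_add.comp (hB.comp f2)
            (primrec_placeBound (hW.comp f2)))) ?_))))
    exact Primrec.eq.comp
      (Primrec.nat_add.comp
        (primrec_productEntry (hW.comp f3) (h11.comp f3) (hB.comp f3) hc hc' hj)
        (primrec_scalarEntry (h22.comp f3) (hB.comp f3) hc hc' hj))
      (Primrec.nat_add.comp
        (primrec_productEntry (hW.comp f3) (h12.comp f3) (hB.comp f3) hc hc' hj)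
        (primrec_scalarEntry (h21.comp f3) (hB.comp f3) hc hc' hj))

theorem primrec_numeratorEntry (hW : Primrec W) (hl : Primrec l) (hb : Primrec b)
    (hj : Primrec j) : Primrec fun x => numeratorEntry (W x) (l x) (b x) (j x) := by
  classical
  have hf : Primrec fun x : (γ × ℕ) × ℕ => x.1.1 := Primrec.fst.comp Primrec.fst
  have hc : Primrec fun x : (γ × ℕ) × ℕ => x.1.2 := Primrec.snd.comp Primrec.fst
  have hs : Primrec fun x : (γ × ℕ) × ℕ => x.2 := Primrec.snd
  have hg := Primrec.nat_add.comp (primrec_discExponent (hW.comp hf) hc hs)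
    (primrec_emptyCount (hW.comp hf))
  have hsub := Primrec.nat_sub.comp (hj.comp hf) hg
  exact primrec_sum_range (primrec_codeBound hW) (primrec_sum_range
    (primrec_codeBound (hW.comp Primrec.fst)) (Primrec.ite
    ((primrecPred_isMatching (hW.comp hf) hc).and
      ((primrecPred_isMatching (hW.comp hf) hs).and
      ((Primrec.nat_le.comp hg (hj.comp hf)).and (Primrec.nat_lt.comp hsub (hb.comp hf)))))
    (primrec_tableEntry (hl.comp hf) hc hs hsub) (Primrec.const 0)))

theorem primrec_outputOf {t : γ → Certificate} (hW : Primrec W) (ht : Primrec t) :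
    Primrec fun x => outputOf (W x) (t x) := by
  have h11 : Primrec fun x => (t x).1.1 := Primrec.fst.comp (Primrec.fst.comp ht)
  have h12 : Primrec fun x => (t x).1.2 := Primrec.snd.comp (Primrec.fst.comp ht)
  have h21 : Primrec fun x => (t x).2.1 := Primrec.fst.comp (Primrec.snd.comp ht)
  have h22 : Primrec fun x => (t x).2.2 := Primrec.snd.comp (Primrec.snd.comp ht)
  have hB : Primrec fun x => (t x).2.1.length := Primrec.list_length.comp h21
  have f1 : Primrec fun x : γ × ℕ => x.1 := Primrec.fst
  refine Primrec.pair (Primrec.list_map (Primrec.list_range.comp (Primrec.succ.comp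
    (Primrec.nat_add.comp (Primrec.nat_add.comp hB (primrec_placeBound hW))
      (primrec_emptyCount hW)))) ?_) (Primrec.list_map (Primrec.list_range.comp hB) ?_)
  · exact primrec_subNatNat
      (primrec_numeratorEntry (hW.comp f1) (h11.comp f1) (hB.comp f1) Primrec.snd)
      (primrec_numeratorEntry (hW.comp f1) (h12.comp f1) (hB.comp f1) Primrec.snd)
  · exact primrec_subNatNat ((Primrec.list_getD 0).comp (h21.comp f1) Primrec.snd)
      ((Primrec.list_getD 0).comp (h22.comp f1) Primrec.snd)

theorem primrec_searchStep : Primrec₂ (searchStep (r := r)) := by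
  classical
  have h : Primrec fun x : List (List (Fin r × Bool)) × ℕ => searchStep x.1 x.2 := by
    refine Primrec.ite (primrecPred_isReducedInput Primrec.fst)
      (Primrec.option_bind (Primrec.decode.comp Primrec.snd) ?_) (Primrec.const _)
    exact Primrec.ite (primrecPred_isCertificate (Primrec.fst.comp Primrec.fst) Primrec.snd)
      (Primrec.option_some.comp (primrec_outputOf (Primrec.fst.comp Primrec.fst) Primrec.snd))
      (Primrec.const none)
  exact h

end Computability

/-- A search that always succeeds defines a computable function. -/
theorem exists_computable_search {α σ : Type*} [Primcodable α] [Primcodable σ]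
    {f : α → ℕ → Option σ} (hf : Primrec₂ f) (h : ∀ a, ∃ k s, f a k = some s) :
    ∃ g : α → σ, Computable g ∧ ∀ a, ∃ k, f a k = some (g a) := by
  have hdom : ∀ a, (Nat.rfindOpt (f a)).Dom := by
    intro a
    rw [Nat.rfindOpt_dom]
    exact h a
  refine ⟨fun a => (Nat.rfindOpt (f a)).get (hdom a),
    (Partrec.rfindOpt hf.to_comp).of_eq_tot fun a => Part.get_mem _, fun a => ?_⟩
  exact Nat.rfindOpt_spec (Part.get_mem (hdom a))

end Algorithm

end UnitaryWords

namespace UnitaryWords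

/-! ### Cycles as orbit minima -/

theorem quot_mk_pow {α : Type*} (π : Equiv.Perm α) (k : ℕ) (a : α) :
    (Quot.mk (fun a b => π a = b) ((π ^ k) a)) = Quot.mk _ a := by
  induction k with
  | zero => rfl
  | succ k ih =>
    rw [pow_succ', Equiv.Perm.mul_apply, ← ih]
    exact (Quot.sound (r := fun a b => π a = b) rfl).symm

theorem sameCycle_of_quot_eq {α : Type*} (π : Equiv.Perm α) {a b : α}
    (h : Quot.mk (fun a b => π a = b) a = Quot.mk _ b) : π.SameCycle a b := by
  have h' := Quot.eqvGen_exact h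
  induction h' with
  | rel a b hab => exact ⟨1, by simpa using hab⟩
  | refl a => exact Equiv.Perm.SameCycle.refl _ _
  | symm a b _ ih => exact (ih (Quot.eqvGen_sound ‹_›)).symm
  | trans a b c _ _ ih1 ih2 =>
    exact (ih1 (Quot.eqvGen_sound ‹_›)).trans (ih2 (Quot.eqvGen_sound ‹_›))

/-- Bounds the exponent, so that a bounded search recognises the minimum of an orbit. -/
theorem exists_pow_lt_of_sameCycle {α : Type*} [Fintype α] [DecidableEq α] (π : Equiv.Perm α)
    {a b : α} (h : π.SameCycle a b) : ∃ k < Fintype.card α, (π ^ k) a = b := by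
  by_cases ha : a ∈ π.support
  · obtain ⟨k, hk, hk'⟩ := h.exists_pow_eq_of_mem_support ha
    exact ⟨k, hk.trans_le (Finset.card_le_univ _), hk'⟩
  · rw [Equiv.Perm.notMem_support] at ha
    have : a = b := h.eq_of_left ha
    exact ⟨0, Fintype.card_pos_iff.mpr ⟨a⟩, by simpa using this⟩

theorem countBelow_eq_card {α : Type*} [Fintype α] {K : ℕ} {e : α → ℕ}
    (he : Function.Injective e) (heK : ∀ a, e a < K) (P : ℕ → Prop) (Q : α → Prop)
    (h : ∀ p < K, P p ↔ ∃ a, e a = p ∧ Q a) : countBelow K P = Nat.card {a // Q a} := by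
  classical
  rw [countBelow, Finset.sum_boole, Nat.cast_id, Nat.card_eq_fintype_card, Fintype.card_subtype]
  refine (Finset.card_nbij e ?_ ?_ ?_).symm
  · intro a ha
    have ha' : Q a := by simpa using ha
    simpa using ⟨heK a, (h _ (heK a)).mpr ⟨a, rfl, ha'⟩⟩
  · exact he.injOn
  · intro p hp
    have hp' : p < K ∧ P p := by simpa using hp
    obtain ⟨a, rfl, ha⟩ := (h p hp'.1).mp hp'.2
    exact ⟨a, by simpa using ha, rfl⟩

/-- The cycles of a permutation are counted by the minima of its orbits. -/
theorem countBelow_eq_numCycles {α : Type*} [Fintype α] [DecidableEq α] {K : ℕ} {e : α → ℕ}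
    (he : Function.Injective e) (heK : ∀ a, e a < K) (π : Equiv.Perm α) {f : ℕ → ℕ}
    (hf : ∀ a, f (e a) = e (π a)) {Q : ℕ → Prop} (hQ : ∀ p, Q p ↔ ∃ a, e a = p) :
    countBelow K (fun p => Q p ∧ ∀ k < K, p ≤ f^[k] p) = numCycles π := by
  have hit : ∀ k a, f^[k] (e a) = e ((π ^ k) a) := by
    intro k
    induction k with
    | zero => exact fun a => rfl
    | succ k ih =>
      intro a
      rw [Function.iterate_succ_apply, hf, ih, pow_succ, Equiv.Perm.mul_apply]
  have hcard : Fintype.card α ≤ K := by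
    have := Fintype.card_le_of_injective (fun a => (⟨e a, heK a⟩ : Fin K))
      fun a b hab => he (congrArg Fin.val hab)
    simpa using this
  rw [countBelow_eq_card he heK _ (fun a => ∀ k < K, e a ≤ e ((π ^ k) a)),
    ← card_quot_eq_numCycles]
  · refine Nat.card_congr (Equiv.ofBijective (fun a => Quot.mk _ a.1) ⟨?_, ?_⟩)
    · rintro ⟨a, ha⟩ ⟨b, hb⟩ hab
      have hs := sameCycle_of_quot_eq π hab
      obtain ⟨k, hk, hk'⟩ := exists_pow_lt_of_sameCycle π hs
      obtain ⟨j, hj, hj'⟩ := exists_pow_lt_of_sameCycle π hs.symm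
      have h1 := ha k (hk.trans_le hcard)
      have h2 := hb j (hj.trans_le hcard)
      rw [hk'] at h1
      rw [hj'] at h2
      exact Subtype.ext (he (le_antisymm h1 h2))
    · intro q
      have hne : ∃ n, ∃ a, Quot.mk _ a = q ∧ e a = n := by
        obtain ⟨a, rfl⟩ := Quot.exists_rep q
        exact ⟨_, a, rfl, rfl⟩
      classical
      -- Every cycle contains a point of least number, and it is the only one that passes the test.
      obtain ⟨a, rfl, ha⟩ := Nat.find_spec hne
      refine ⟨⟨a, fun k _ => ?_⟩, rfl⟩
      rw [ha]
      exact Nat.find_min' hne ⟨_, quot_mk_pow π k a, rfl⟩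
  · intro p _
    rw [hQ]
    constructor
    · rintro ⟨⟨a, rfl⟩, h⟩
      exact ⟨a, rfl, fun k hk => (h k hk).trans_eq (hit k a)⟩
    · rintro ⟨a, rfl, h⟩
      exact ⟨⟨a, rfl⟩, fun k hk => (h k hk).trans_eq (hit k a).symm⟩

/-! ### Places of letters as numbers -/

section Places

variable {r : ℕ} (W : List (List (Fin r × Bool)))

theorem length_lt_side : W.length < side W := by
  unfold side
  omega

variable {W}

theorem length_word_lt_side {u : List (Fin r × Bool)} (hu : u ∈ W) : u.length < side W := by
  have := (List.sublist_flatten_of_mem hu).length_le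
  unfold side
  omega

theorem letterAt_add {k : ℕ} (hk : k < side W) (i : ℕ) :
    letterAt W (i * side W + k) = W[i]?.bind fun u => u[k]? := by
  have hS : 0 < side W := by omega
  rw [letterAt, Nat.add_comm, Nat.add_mul_div_right _ _ hS, Nat.div_eq_of_lt hk, Nat.zero_add,
    Nat.add_mul_mod_self_right, Nat.mod_eq_of_lt hk]

theorem add_lt_placeBound {i k : ℕ} (hi : i < W.length) (hk : k < side W) :
    i * side W + k < placeBound W := by
  have := length_lt_side W
  have h : (i + 1) * side W ≤ side W * side W := Nat.mul_le_mul_right _ (by omega)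
  rw [Nat.succ_mul] at h
  unfold placeBound
  omega

theorem letterAt_eq_some {q : ℕ} {l : Fin r × Bool} (h : letterAt W q = some l) :
    ∃ (i : ℕ) (hi : i < W.length) (k : ℕ) (hk : k < W[i].length), q = i * side W + k ∧
      W[i][k] = l := by
  rw [letterAt, Option.bind_eq_some_iff] at h
  obtain ⟨u, hu, hl⟩ := h
  obtain ⟨hi, rfl⟩ := List.getElem?_eq_some_iff.mp hu
  obtain ⟨hk, hl⟩ := List.getElem?_eq_some_iff.mp hl
  exact ⟨_, hi, _, hk, by rw [Nat.mul_comm, Nat.div_add_mod], hl⟩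

/-- Since `side W` exceeds every word length, the number after the last place of a word carries no
letter. Consecutive numbers thus never compare letters of different words. -/
theorem isReducedInput_iff : IsReducedInput W ↔ ∀ u ∈ W, FreeGroup.IsReduced u := by
  constructor
  · intro h u hu
    obtain ⟨i, hi, rfl⟩ := List.getElem_of_mem hu
    have hS := length_word_lt_side hu
    rw [FreeGroup.IsReduced, List.isChain_iff_getElem]
    intro k hk h1
    have hlk : letterAt W (i * side W + k) = some W[i][k] := by
      rw [letterAt_add (by omega)]
      simp [hi]
    have hlk' : letterAt W (i * side W + k + 1) = some W[i][k + 1] := by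
      rw [Nat.add_assoc, letterAt_add (by omega)]
      simp [hi]
    have h2 := h _ (add_lt_placeBound hi (k := k) (by omega)) (by rw [hlk]; rfl)
    rw [hlk, hlk'] at h2
    by_contra h3
    refine h2 (congrArg some (Prod.ext h1.symm ?_))
    simp only [flipLetter]
    cases h4 : W[i][k].2 <;> cases h5 : W[i][k + 1].2 <;> simp_all
  · intro h p _ hp h2
    obtain ⟨l, hl⟩ := Option.isSome_iff_exists.mp hp
    obtain ⟨i, hi, k, hk, rfl, rfl⟩ := letterAt_eq_some hl
    have hu : W[i] ∈ W := List.getElem_mem hi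
    have hS := length_word_lt_side hu
    rw [hl, Nat.add_assoc, letterAt_add (by omega), List.getElem?_eq_getElem hi] at h2
    obtain ⟨hk', h2⟩ := List.getElem?_eq_some_iff.mp h2
    have h3 := List.isChain_iff_getElem.mp (h _ hu) k hk'
    rw [h2] at h3
    have h4 := h3 rfl
    simp [flipLetter] at h4

/-- Reduced inputs are exactly those that come from words in the free group, so existence of a
certificate need only be shown for such inputs. -/
theorem exists_wordsInput_eq (h : IsReducedInput W) :
    ∃ (ℓ : ℕ) (w : Words r ℓ), wordsInput w = W := by
  refine ⟨W.length, fun i => FreeGroup.mk W[i], ?_⟩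
  have hW := isReducedInput_iff.mp h
  refine List.ext_getElem (by simp [wordsInput]) fun i h1 h2 => ?_
  simp only [wordsInput, List.getElem_ofFn, FreeGroup.toWord_mk]
  exact (hW _ (List.getElem_mem h2)).reduce_eq

variable {ℓ : ℕ} (w : Words r ℓ)

theorem isReducedInput_wordsInput : IsReducedInput (wordsInput w) := by
  rw [isReducedInput_iff]
  intro u hu
  obtain ⟨i, rfl⟩ := (List.mem_ofFn' _ _).mp hu
  exact FreeGroup.isReduced_toWord

/-- The number of a place. -/
def placeNumber (p : Pos w) : ℕ := p.1 * side (wordsInput w) + p.2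

variable {w}

theorem length_toWord_lt (i : Fin ℓ) : (w i).toWord.length < side (wordsInput w) :=
  length_word_lt_side ((List.mem_ofFn' _ _).mpr ⟨i, rfl⟩)

theorem getElem?_wordsInput (i : Fin ℓ) : (wordsInput w)[(i : ℕ)]? = some (w i).toWord := by
  simp [wordsInput]

theorem letterAt_placeNumber (p : Pos w) :
    letterAt (wordsInput w) (placeNumber w p) = some (letter w p) := by
  have := length_toWord_lt (w := w) p.1
  rw [placeNumber, letterAt_add (p.2.2.trans this), getElem?_wordsInput]
  simp [letter]

theorem placeNumber_lt (p : Pos w) : placeNumber w p < placeBound (wordsInput w) :=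
  add_lt_placeBound (by simp [wordsInput]) (p.2.2.trans (length_toWord_lt p.1))

theorem placeNumber_injective : Function.Injective (placeNumber w) := by
  rintro ⟨i, k⟩ ⟨i', k'⟩ h
  have hk := k.2.trans (length_toWord_lt i)
  have hk' := k'.2.trans (length_toWord_lt i')
  have hS : 0 < side (wordsInput w) := by omega
  simp only [placeNumber] at h
  have h1 := congrArg (· / side (wordsInput w)) h
  have h2 := congrArg (· % side (wordsInput w)) h
  simp only [Nat.add_comm (_ * _), Nat.add_mul_div_right _ _ hS, Nat.div_eq_of_lt hk,
    Nat.div_eq_of_lt hk', Nat.zero_add] at h1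
  simp only [Nat.add_comm (_ * _), Nat.add_mul_mod_self_right, Nat.mod_eq_of_lt hk,
    Nat.mod_eq_of_lt hk'] at h2
  obtain rfl := Fin.ext h1
  obtain rfl := Fin.ext h2
  rfl

theorem exists_placeNumber_eq {q : ℕ} {l : Fin r × Bool} (h : letterAt (wordsInput w) q = some l) :
    ∃ p, placeNumber w p = q ∧ letter w p = l := by
  obtain ⟨i, hi, k, hk, rfl, rfl⟩ := letterAt_eq_some h
  have hi' : i < ℓ := by simpa [wordsInput] using hi
  refine ⟨⟨⟨i, hi'⟩, ⟨k, by simpa [wordsInput] using hk⟩⟩, rfl, ?_⟩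
  simp [letter, wordsInput]

theorem isSome_letterAt_iff (q : ℕ) :
    (letterAt (wordsInput w) q).isSome = true ↔ ∃ p, placeNumber w p = q := by
  constructor
  · intro h
    obtain ⟨l, hl⟩ := Option.isSome_iff_exists.mp h
    obtain ⟨p, hp, -⟩ := exists_placeNumber_eq hl
    exact ⟨p, hp⟩
  · rintro ⟨p, rfl⟩
    rw [letterAt_placeNumber]
    rfl

theorem isPositiveAt_iff (q : ℕ) :
    IsPositiveAt (wordsInput w) q ↔ ∃ p, placeNumber w p = q ∧ (letter w p).2 = true := by
  unfold IsPositiveAt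
  constructor
  · intro h
    obtain ⟨l, hl, hl'⟩ := Option.map_eq_some_iff.mp h
    obtain ⟨p, hp, rfl⟩ := exists_placeNumber_eq hl
    exact ⟨p, hp, hl'⟩
  · rintro ⟨p, rfl, h⟩
    rw [letterAt_placeNumber, Option.map_some, h]

theorem isPositiveAt_placeNumber (p : Pos w) :
    IsPositiveAt (wordsInput w) (placeNumber w p) ↔ (letter w p).2 = true := by
  rw [IsPositiveAt, letterAt_placeNumber, Option.map_some, Option.some_inj]

/-- The gap behind each word signals its end, where the walk returns to letter `0` of the same word.
-/
theorem nextAt_placeNumber (p : Pos w) :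
    nextAt (wordsInput w) (placeNumber w p) = placeNumber w (nextPerm w p) := by
  obtain ⟨i, k⟩ := p
  have hlen := length_toWord_lt (w := w) i
  have hk : (k : ℕ) < (w i).toWord.length := k.2
  have hdiv : placeNumber w ⟨i, k⟩ / side (wordsInput w) = i := by
    have hS : 0 < side (wordsInput w) := by omega
    rw [placeNumber, Nat.add_comm, Nat.add_mul_div_right _ _ hS, Nat.div_eq_of_lt (hk.trans hlen),
      Nat.zero_add]
  have hsome : (letterAt (wordsInput w) (placeNumber w ⟨i, k⟩ + 1)).isSome = true ↔
      (k : ℕ) + 1 < (w i).toWord.length := by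
    rw [placeNumber, Nat.add_assoc, letterAt_add ((Nat.succ_le_of_lt hk).trans_lt hlen), getElem?_wordsInput]
    simp
  have hrot : placeNumber w (nextPerm w ⟨i, k⟩) =
      i * side (wordsInput w) + (finRotate _ k : Fin _) := rfl
  rw [nextAt, hdiv, hrot]
  obtain ⟨m, hm⟩ : ∃ m, (w i).toWord.length = m + 1 := ⟨(w i).toWord.length - 1, by omega⟩
  have hval : ((finRotate _ k : Fin _) : ℕ) =
      if (k : ℕ) + 1 < (w i).toWord.length then (k : ℕ) + 1 else 0 := by
    clear hrot hsome hdiv hlen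
    generalize (w i).toWord.length = n at *
    subst hm
    rw [coe_finRotate]
    have : k = Fin.last m ↔ ¬ (k : ℕ) + 1 < m + 1 := by
      rw [Fin.ext_iff, Fin.val_last]
      omega
    split_ifs <;> simp_all
  rw [hval]
  by_cases h : (k : ℕ) + 1 < (w i).toWord.length
  · rw [if_pos (hsome.mpr h), if_pos h, placeNumber, Nat.add_assoc]
  · rw [if_neg (mt hsome.mp h), if_neg h, Nat.add_zero]

theorem emptyCount_wordsInput : emptyCount (wordsInput w) = numTrivial w := by
  classical
  have hl : (wordsInput w).length = ℓ := by simp [wordsInput]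
  rw [emptyCount, hl, countBelow_eq_card (e := fun i : Fin ℓ => (i : ℕ)) Fin.val_injective
    (fun i => i.2) _ (fun i => w i = 1), numTrivial, Nat.card_eq_fintype_card, Fintype.card_subtype]
  intro p hp
  constructor
  · intro h
    refine ⟨⟨p, hp⟩, rfl, ?_⟩
    rw [getElem?_wordsInput ⟨p, hp⟩, Option.some_inj] at h
    exact FreeGroup.toWord_eq_nil_iff.mp h
  · rintro ⟨i, rfl, hi⟩
    rw [getElem?_wordsInput, hi, FreeGroup.toWord_one]

end Places

end UnitaryWords

namespace UnitaryWords

/-! ### Matchings as numbers -/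

section Codes

variable {r ℓ : ℕ}

/-- The matchings of the instances of `x⁺¹` with the instances of `x⁻¹`, for every `x`. -/
abbrev Matching (w : Words r ℓ) : Type := (x : Fin r) → (PosLetter w x ≃ NegLetter w x)

variable {w : Words r ℓ}

/-- The place which a matching joins with a given place. -/
def partner (m : Matching w) (p : Pos w) : Pos w := (mate (fun x _ => m x) (p, 0)).1

theorem partner_of_pos (m : Matching w) {p : Pos w} {x : Fin r} (h : letter w p = (x, true)) :
    partner m p = (m x ⟨p, h⟩).1 := by
  rw [partner, mate_of_pos _ h]

theorem partner_of_neg (m : Matching w) {p : Pos w} {x : Fin r} (h : letter w p = (x, false)) :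
    partner m p = ((m x).symm ⟨p, h⟩).1 := by
  rw [partner, mate_of_neg _ h]

theorem partner_partner (m : Matching w) (p : Pos w) : partner m (partner m p) = p := by
  rw [partner, partner, ← mate_eq_mk, mate_mate]

theorem letter_partner (m : Matching w) (p : Pos w) :
    letter w (partner m p) = flipLetter (letter w p) := by
  rcases letter_cases p with ⟨x, h⟩ | ⟨x, h⟩
  · rw [partner_of_pos m h, (m x ⟨p, h⟩).2, h]
    rfl
  · rw [partner_of_neg m h, ((m x).symm ⟨p, h⟩).2, h]
    rfl

theorem partner_injective : Function.Injective (partner (w := w)) := by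
  intro m m' h
  funext x
  ext1 p
  have := congrFun h p.1
  rw [partner_of_pos m p.2, partner_of_pos m' p.2] at this
  exact Subtype.ext this

/-- Matchings are the same as involutions of the places that invert the letter. This is the form in
which `IsMatching` tests them. -/
theorem exists_partner_eq {f : Pos w → Pos w} (hf : ∀ p, f (f p) = p)
    (hl : ∀ p, letter w (f p) = flipLetter (letter w p)) : ∃ m : Matching w, partner m = f := by
  refine ⟨fun x =>
    { toFun := fun p => ⟨f p.1, by rw [hl, p.2]; rfl⟩
      invFun := fun p => ⟨f p.1, by rw [hl, p.2]; rfl⟩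
      left_inv := fun p => Subtype.ext (hf p.1)
      right_inv := fun p => Subtype.ext (hf p.1) }, ?_⟩
  funext p
  rcases letter_cases p with ⟨x, h⟩ | ⟨x, h⟩
  · rw [partner_of_pos _ h]
    rfl
  · rw [partner_of_neg _ h]
    rfl

theorem exists_digits_eq {K : ℕ} {f : ℕ → ℕ} (hf : ∀ q < K, f q < K) :
    ∃ c < K ^ K, ∀ q < K, c / K ^ q % K = f q := by
  let g : Fin K → Fin K := fun q => ⟨f q, hf q q.2⟩
  refine ⟨(finFunctionFinEquiv g).1, (finFunctionFinEquiv g).2, fun q hq => ?_⟩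
  have h := congrFun (finFunctionFinEquiv.symm_apply_apply g) ⟨q, hq⟩
  exact congrArg Fin.val h

theorem eq_of_digits_eq {K c c' : ℕ} (hc : c < K ^ K) (hc' : c' < K ^ K)
    (h : ∀ q < K, c / K ^ q % K = c' / K ^ q % K) : c = c' := by
  have : (⟨c, hc⟩ : Fin (K ^ K)) = ⟨c', hc'⟩ := by
    refine (finFunctionFinEquiv (m := K) (n := K)).symm.injective ?_
    funext q
    exact Fin.ext (h q q.2)
  exact congrArg Fin.val this

/-- The partner map is extended by the identity to numbers that are not places. With this
normalisation each matching has exactly one code below `codeBound`. -/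
theorem exists_code (m : Matching w) : ∃ c < codeBound (wordsInput w),
    (∀ p, digit (wordsInput w) c (placeNumber w p) = placeNumber w (partner m p)) ∧
      ∀ q < placeBound (wordsInput w), letterAt (wordsInput w) q = none →
        digit (wordsInput w) c q = q := by
  classical
  let f : ℕ → ℕ := fun q => if h : ∃ p, placeNumber w p = q
    then placeNumber w (partner m h.choose) else q
  have hf : ∀ q < placeBound (wordsInput w), f q < placeBound (wordsInput w) := by
    intro q hq
    by_cases h : ∃ p, placeNumber w p = q
    · simp only [f, dif_pos h]
      exact placeNumber_lt _
    · simpa only [f, dif_neg h] using hq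
  obtain ⟨c, hc, hd⟩ := exists_digits_eq hf
  refine ⟨c, hc, fun p => ?_, fun q hq hn => ?_⟩
  · have h : ∃ p', placeNumber w p' = placeNumber w p := ⟨p, rfl⟩
    rw [digit, hd _ (placeNumber_lt p)]
    simp only [f, dif_pos h]
    rw [placeNumber_injective h.choose_spec]
  · rw [digit, hd _ hq]
    have h : ¬ ∃ p, placeNumber w p = q := by
      rw [← isSome_letterAt_iff, hn]
      simp
    simp only [f, dif_neg h]

/-- The number which encodes a matching. -/
noncomputable def code (m : Matching w) : ℕ := (exists_code m).choose

theorem code_lt (m : Matching w) : code m < codeBound (wordsInput w) :=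
  (exists_code m).choose_spec.1

theorem digit_code (m : Matching w) (p : Pos w) :
    digit (wordsInput w) (code m) (placeNumber w p) = placeNumber w (partner m p) :=
  (exists_code m).choose_spec.2.1 p

theorem digit_code_of_none (m : Matching w) {q : ℕ} (hq : q < placeBound (wordsInput w))
    (h : letterAt (wordsInput w) q = none) : digit (wordsInput w) (code m) q = q :=
  (exists_code m).choose_spec.2.2 q hq h

theorem code_injective : Function.Injective (code (w := w)) := by
  intro m m' h
  refine partner_injective (funext fun p => placeNumber_injective ?_)
  rw [← digit_code, ← digit_code, h]

theorem isMatching_code (m : Matching w) : IsMatching (wordsInput w) (code m) := by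
  intro q hq
  cases hl : letterAt (wordsInput w) q with
  | none =>
    have hd := digit_code_of_none m hq hl
    rw [hd, hd, hl]
    exact ⟨rfl, rfl, fun _ => rfl⟩
  | some l =>
    obtain ⟨p, rfl, rfl⟩ := exists_placeNumber_eq hl
    rw [digit_code, digit_code, partner_partner, letterAt_placeNumber, letter_partner]
    exact ⟨rfl, rfl, fun h => by simp at h⟩

theorem exists_code_eq {c : ℕ} (hc : c < codeBound (wordsInput w))
    (h : IsMatching (wordsInput w) c) : ∃ m : Matching w, code m = c := by
  have h1 : ∀ p : Pos w, ∃ p', placeNumber w p' = digit (wordsInput w) c (placeNumber w p) ∧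
      letter w p' = flipLetter (letter w p) := fun p => by
    refine exists_placeNumber_eq ?_
    rw [(h _ (placeNumber_lt p)).1, letterAt_placeNumber]
    rfl
  choose f hf hl using h1
  obtain ⟨m, rfl⟩ := exists_partner_eq (f := f) (fun p => placeNumber_injective (by
    rw [hf, hf, (h _ (placeNumber_lt p)).2.1])) hl
  refine ⟨m, eq_of_digits_eq (code_lt m) hc fun q hq => ?_⟩
  change digit (wordsInput w) _ q = digit (wordsInput w) _ q
  cases hq' : letterAt (wordsInput w) q with
  | none => rw [digit_code_of_none m hq hq', (h q hq).2.2 hq']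
  | some l =>
    obtain ⟨p, rfl, -⟩ := exists_placeNumber_eq hq'
    rw [digit_code, hf]

open Classical in
theorem sum_range_codeBound {M : Type*} [AddCommMonoid M] (g : ℕ → M) :
    ∑ c ∈ Finset.range (codeBound (wordsInput w)),
      (if IsMatching (wordsInput w) c then g c else 0) = ∑ m : Matching w, g (code m) := by
  rw [← Finset.sum_filter]
  refine (Finset.sum_nbij code (fun m _ => ?_) code_injective.injOn (fun c hc => ?_)
    fun _ _ => rfl).symm
  · rw [Finset.mem_filter, Finset.mem_range]
    exact ⟨code_lt m, isMatching_code m⟩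
  · rw [Finset.mem_coe, Finset.mem_filter, Finset.mem_range] at hc
    obtain ⟨m, rfl⟩ := exists_code_eq hc.1 hc.2
    exact ⟨m, by simp, rfl⟩

/-- A matching as a bijection from all positive letters to all negative letters. -/
def Matching.full (m : Matching w) :
    ((x : Fin r) × PosLetter w x) ≃ ((x : Fin r) × NegLetter w x) :=
  Equiv.sigmaCongrRight m

theorem Matching.full_injective : Function.Injective (Matching.full (w := w)) := by
  intro m m' h
  funext x
  ext1 p
  have := DFunLike.congr_fun h ⟨x, p⟩
  simpa [Matching.full] using this

/-- On the numbers of positive letters, two applications of `digit` cross by `m'` to a negative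
letter and return by `m`, so orbit minima count the required cycles. -/
theorem gramExponent_code (m m' : Matching w) :
    gramExponent (wordsInput w) (code m) (code m') = numCycles (m'.full.trans m.full.symm) := by
  refine countBelow_eq_numCycles
    (e := fun a : (x : Fin r) × PosLetter w x => placeNumber w a.2.1) ?_
    (fun a => placeNumber_lt _) _ ?_ ?_
  · rintro ⟨x, p, hp⟩ ⟨y, q, hq⟩ h
    obtain rfl := placeNumber_injective h
    obtain rfl : x = y := congrArg Prod.fst (hp.symm.trans hq)
    rfl
  · rintro ⟨x, p⟩
    dsimp only
    rw [digit_code, digit_code, partner_of_pos m' p.2, partner_of_neg m (m' x p).2]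
    rfl
  · intro q
    rw [isPositiveAt_iff]
    constructor
    · rintro ⟨p, rfl, h⟩
      exact ⟨⟨(letter w p).1, p, Prod.ext rfl h⟩, rfl⟩
    · rintro ⟨⟨x, p⟩, rfl⟩
      exact ⟨p.1, rfl, by rw [p.2]⟩

/-- The pair of matchings with given components. -/
def matchPair (m m' : Matching w) : MatchPairs w := fun x => ![m x, m' x]

theorem discExponent_code (m m' : Matching w) :
    discExponent (wordsInput w) (code m) (code m') = numODiscs (matchPair m m') := by
  rw [numODiscs_eq]
  refine countBelow_eq_numCycles placeNumber_injective placeNumber_lt _ (fun p => ?_)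
    isSome_letterAt_iff
  rw [crossNext, Equiv.Perm.mul_apply, ← nextAt_placeNumber]
  simp only [isPositiveAt_placeNumber, digit_code]
  rcases letter_cases p with ⟨x, h⟩ | ⟨x, h⟩
  · rw [if_pos (by rw [h]), crossPerm_of_pos _ h, partner_of_pos _ h]
    rfl
  · rw [if_neg (by rw [h]; simp), crossPerm_of_neg _ h, partner_of_neg _ h]
    rfl

theorem countBelow_le (b : ℕ) (P : ℕ → Prop) : countBelow b P ≤ b := by
  classical
  refine (Finset.sum_le_sum (g := fun _ => 1) fun p _ => ?_).trans (by simp)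
  split_ifs <;> simp

theorem gramExponent_le (W : List (List (Fin r × Bool))) (c c' : ℕ) :
    gramExponent W c c' ≤ placeBound W :=
  countBelow_le _ _

theorem discExponent_le (W : List (List (Fin r × Bool))) (c c' : ℕ) :
    discExponent W c c' ≤ placeBound W :=
  countBelow_le _ _

/-- A pair of matchings is a matching for each index. -/
def matchPairEquiv : Matching w × Matching w ≃ MatchPairs w where
  toFun m := matchPair m.1 m.2
  invFun σ := (fun x => σ x 0, fun x => σ x 1)
  left_inv _ := rfl
  right_inv σ := by
    funext x j
    fin_cases j <;> rfl

end Codes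

end UnitaryWords

namespace UnitaryWords

/-! ### The polynomials of a certificate -/

section Polynomials

open Polynomial

/-- The polynomial of degree less than `B` with natural coefficients `f 0, f 1, …`. -/
noncomputable def natPoly (B : ℕ) (f : ℕ → ℕ) : ℚ[X] := ∑ j ∈ Finset.range B, C (f j : ℚ) * X ^ j

theorem coeff_natPoly (B : ℕ) (f : ℕ → ℕ) (j : ℕ) :
    (natPoly B f).coeff j = if j < B then (f j : ℚ) else 0 := by
  simp [natPoly, finsetSum_coeff, coeff_X_pow]

theorem coeff_natPoly_mul_X_pow (B : ℕ) (f : ℕ → ℕ) (g j : ℕ) :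
    (natPoly B f * X ^ g).coeff j = if g ≤ j ∧ j - g < B then (f (j - g) : ℚ) else 0 := by
  rw [coeff_mul_X_pow', coeff_natPoly, ite_and]

theorem coeff_polyOfList (l : List ℤ) (j : ℕ) : (polyOfList l).coeff j = (l.getD j 0 : ℤ) := by
  simp only [polyOfList, finsetSum_coeff, coeff_C_mul, coeff_X_pow]
  by_cases h : j < l.length
  · rw [Finset.sum_eq_single ⟨j, h⟩ (fun i _ hi => by
      rw [if_neg (fun h' => hi (Fin.ext h'.symm)), mul_zero]) (by simp)]
    simp [List.getD, h]
  · rw [Finset.sum_eq_zero fun i _ => by rw [if_neg (by have := i.2; omega), mul_zero]]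
    simp [List.getD, h]

theorem coeff_polyOfList_map_range (N : ℕ) (f : ℕ → ℤ) (j : ℕ) :
    (polyOfList ((List.range N).map f)).coeff j = if j < N then (f j : ℚ) else 0 := by
  rw [coeff_polyOfList]
  by_cases h : j < N <;> simp [List.getD, h]

/-- The entries of the matrix of polynomials of a certificate. -/
noncomputable def tablePoly (t : Certificate) (c e : ℕ) : ℚ[X] :=
  natPoly t.2.1.length (tableEntry t.1.1 c e) - natPoly t.2.1.length (tableEntry t.1.2 c e)

/-- The scalar polynomial of a certificate. -/
noncomputable def scalarPoly (t : Certificate) : ℚ[X] :=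
  natPoly t.2.1.length (fun j => t.2.1.getD j 0) - natPoly t.2.1.length fun j => t.2.2.getD j 0

variable {r ℓ : ℕ} {w : Words r ℓ}

/-- The entries are coefficients of a matrix product. The certificate keeps positive and negative
parts apart, so everything stays in the natural numbers. -/
theorem cast_productEntry (a : List ℕ) (B c : ℕ) (m : Matching w) (j : ℕ) :
    (productEntry (wordsInput w) a B c (code m) j : ℚ) =
      (∑ e : Matching w, natPoly B (tableEntry a c (code e)) *
        X ^ numCycles (m.full.trans e.full.symm)).coeff j := by
  rw [productEntry]
  simp only [ite_and]
  rw [sum_range_codeBound, Nat.cast_sum, finsetSum_coeff]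
  refine Finset.sum_congr rfl fun e _ => ?_
  rw [coeff_natPoly_mul_X_pow, gramExponent_code, ite_and]
  push_cast
  rfl

theorem cast_scalarEntry (d : List ℕ) (B : ℕ) (m m' : Matching w) (j : ℕ) :
    (scalarEntry d B (code m) (code m') j : ℚ) =
      (if m = m' then natPoly B (fun j => d.getD j 0) else 0).coeff j := by
  rw [scalarEntry, ite_and]
  simp only [code_injective.eq_iff]
  split_ifs with h <;> simp_all [coeff_natPoly]

theorem cast_numeratorEntry (a : List ℕ) (B j : ℕ) :
    (numeratorEntry (wordsInput w) a B j : ℚ) =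
      (∑ m : Matching w, ∑ e : Matching w, natPoly B (tableEntry a (code m) (code e)) *
        X ^ (numODiscs (matchPair m e) + numTrivial w)).coeff j := by
  have h : numeratorEntry (wordsInput w) a B j =
      ∑ m : Matching w, ∑ e : Matching w,
        if discExponent (wordsInput w) (code m) (code e) + emptyCount (wordsInput w) ≤ j ∧
          j - (discExponent (wordsInput w) (code m) (code e) + emptyCount (wordsInput w)) < B then
        tableEntry a (code m) (code e)
          (j - (discExponent (wordsInput w) (code m) (code e) + emptyCount (wordsInput w)))
        else 0 := by
    classical
    rw [numeratorEntry, ← sum_range_codeBound fun c => ∑ e : Matching w,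
        if discExponent (wordsInput w) c (code e) + emptyCount (wordsInput w) ≤ j ∧
          j - (discExponent (wordsInput w) c (code e) + emptyCount (wordsInput w)) < B then
        tableEntry a c (code e)
          (j - (discExponent (wordsInput w) c (code e) + emptyCount (wordsInput w)))
        else 0]
    refine Finset.sum_congr rfl fun c _ => ?_
    by_cases hc : IsMatching (wordsInput w) c
    · rw [if_pos hc, ← sum_range_codeBound fun e =>
        if discExponent (wordsInput w) c e + emptyCount (wordsInput w) ≤ j ∧
          j - (discExponent (wordsInput w) c e + emptyCount (wordsInput w)) < B then
        tableEntry a c e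
          (j - (discExponent (wordsInput w) c e + emptyCount (wordsInput w)))
        else 0]
      refine Finset.sum_congr rfl fun e _ => ?_
      by_cases he : IsMatching (wordsInput w) e <;> simp [hc, he]
    · simp [hc]
  rw [h]
  simp only [Nat.cast_sum, finsetSum_coeff, coeff_natPoly_mul_X_pow, discExponent_code,
    emptyCount_wordsInput]
  push_cast
  rfl

theorem isCertificate_iff (t : Certificate) : IsCertificate (wordsInput w) t ↔
    scalarPoly t ≠ 0 ∧ ∀ m m' : Matching w,
      ∑ e : Matching w, tablePoly t (code m) (code e) *
        X ^ numCycles (m'.full.trans e.full.symm) = if m = m' then scalarPoly t else 0 := by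
  refine and_congr ?_ ?_
  · rw [Ne, Polynomial.ext_iff, not_forall]
    refine exists_congr fun j => ?_
    rw [scalarPoly, coeff_sub, coeff_natPoly, coeff_natPoly, coeff_zero, sub_eq_zero]
    by_cases h : j < t.2.1.length <;> simp [h]
  · have key : ∀ (m m' : Matching w) (j : ℕ),
        (productEntry (wordsInput w) t.1.1 t.2.1.length (code m) (code m') j +
            scalarEntry t.2.2 t.2.1.length (code m) (code m') j =
          productEntry (wordsInput w) t.1.2 t.2.1.length (code m) (code m') j +
            scalarEntry t.2.1 t.2.1.length (code m) (code m') j) ↔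
        (∑ e : Matching w, tablePoly t (code m) (code e) *
          X ^ numCycles (m'.full.trans e.full.symm)).coeff j =
            (if m = m' then scalarPoly t else 0).coeff j := by
      intro m m' j
      rw [← Nat.cast_inj (R := ℚ), Nat.cast_add, Nat.cast_add, cast_productEntry,
        cast_productEntry, cast_scalarEntry, cast_scalarEntry]
      simp only [tablePoly, sub_mul, Finset.sum_sub_distrib, coeff_sub]
      by_cases h : m = m'
      · simp only [h, if_true, scalarPoly, coeff_sub]
        constructor <;> intro h <;> linarith
      · simp only [h, if_false, coeff_zero, add_zero]
        constructor <;> intro h <;> linarith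
    constructor
    · intro h m m'
      ext j
      -- Beyond this bound all coefficients vanish, since `gramExponent` is at most `placeBound`.
      -- The finitely many tests therefore imply the identity of polynomials.
      by_cases hj : j < t.2.1.length + placeBound (wordsInput w) + 1
      · exact (key m m' j).mp (h _ (code_lt m) _ (code_lt m') (isMatching_code m)
          (isMatching_code m') j hj)
      · have h0 : (if m = m' then scalarPoly t else 0).coeff j = 0 := by
          split_ifs
          · rw [scalarPoly, coeff_sub, coeff_natPoly, coeff_natPoly, if_neg (by omega),
              if_neg (by omega), sub_zero]
          · rfl
        rw [h0, finsetSum_coeff]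
        refine Finset.sum_eq_zero fun e _ => ?_
        have hle := gramExponent_le (wordsInput w) (code e) (code m')
        rw [gramExponent_code] at hle
        rw [tablePoly, sub_mul, coeff_sub, coeff_natPoly_mul_X_pow, coeff_natPoly_mul_X_pow,
          if_neg (by omega), if_neg (by omega), sub_zero]
    · intro h c hc c' hc' hm hm' j _
      obtain ⟨m, rfl⟩ := exists_code_eq hc hm
      obtain ⟨m', rfl⟩ := exists_code_eq hc' hm'
      exact (key m m' j).mpr (by rw [h])

theorem polyOfList_outputOf_snd (t : Certificate) :
    polyOfList (outputOf (wordsInput w) t).2 = scalarPoly t := by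
  ext j
  rw [outputOf, coeff_polyOfList_map_range, scalarPoly, coeff_sub, coeff_natPoly, coeff_natPoly]
  split_ifs
  · rw [Int.subNatNat_eq_coe]
    push_cast
    rfl
  · simp

theorem polyOfList_outputOf_fst (t : Certificate) :
    polyOfList (outputOf (wordsInput w) t).1 = X ^ numTrivial w *
      ∑ m : Matching w, ∑ e : Matching w, tablePoly t (code m) (code e) *
        X ^ numODiscs (matchPair m e) := by
  have hsplit : X ^ numTrivial w *
      ∑ m : Matching w, ∑ e : Matching w, tablePoly t (code m) (code e) *
        X ^ numODiscs (matchPair m e) =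
      (∑ m : Matching w, ∑ e : Matching w,
        natPoly t.2.1.length (tableEntry t.1.1 (code m) (code e)) *
          X ^ (numODiscs (matchPair m e) + numTrivial w)) -
      ∑ m : Matching w, ∑ e : Matching w,
        natPoly t.2.1.length (tableEntry t.1.2 (code m) (code e)) *
          X ^ (numODiscs (matchPair m e) + numTrivial w) := by
    simp only [← Finset.sum_sub_distrib, Finset.mul_sum, ← sub_mul, tablePoly, pow_add]
    refine Finset.sum_congr rfl fun m _ => Finset.sum_congr rfl fun e _ => ?_
    ring
  ext j
  rw [hsplit, coeff_sub, outputOf, coeff_polyOfList_map_range]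
  split_ifs with h
  · rw [Int.subNatNat_eq_coe, ← cast_numeratorEntry, ← cast_numeratorEntry]
    push_cast
    rfl
  · simp only [finsetSum_coeff, coeff_natPoly_mul_X_pow]
    have hno : ∀ m e : Matching w, ¬ (numODiscs (matchPair m e) + numTrivial w ≤ j ∧
        j - (numODiscs (matchPair m e) + numTrivial w) < t.2.1.length) := by
      intro m e
      have hle := discExponent_le (wordsInput w) (code m) (code e)
      rw [discExponent_code] at hle
      rw [emptyCount_wordsInput] at h
      omega
    simp [hno]

end Polynomials

end UnitaryWords

namespace UnitaryWords

/-! ### Correctness of the algorithm -/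

section Correctness

open Polynomial

variable {r ℓ : ℕ} {w : Words r ℓ}

theorem getD_map_range {N i : ℕ} (F : ℕ → ℕ) (h : i < N) :
    ((List.range N).map F).getD i 0 = F i := by
  simp [List.getD, h]

/-- The list of the natural numbers `f c e j` with `c, e < N` and `j < B`. -/
def tableOf (N B : ℕ) (f : ℕ → ℕ → ℕ → ℕ) : List ℕ :=
  (List.range (Nat.pair (Nat.pair N N) B)).map fun i =>
    f i.unpair.1.unpair.1 i.unpair.1.unpair.2 i.unpair.2

theorem tableEntry_tableOf {N B c e j : ℕ} (f : ℕ → ℕ → ℕ → ℕ) (hc : c < N) (he : e < N)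
    (hj : j < B) : tableEntry (tableOf N B f) c e j = f c e j := by
  have h1 : Nat.pair c e < Nat.pair N N :=
    (Nat.pair_lt_pair_left e hc).trans (Nat.pair_lt_pair_right N he)
  have h2 : Nat.pair (Nat.pair c e) j < Nat.pair (Nat.pair N N) B :=
    (Nat.pair_lt_pair_left j h1).trans (Nat.pair_lt_pair_right _ hj)
  rw [tableEntry, tableOf, getD_map_range _ h2]
  simp

/-- The positive and negative parts of the integer coefficients are recombined. -/
theorem natPoly_sub_natPoly {B : ℕ} {p : ℤ[X]} (hp : p.natDegree < B) {f g : ℕ → ℕ}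
    (hf : ∀ j < B, f j = (p.coeff j).toNat) (hg : ∀ j < B, g j = (-p.coeff j).toNat) :
    natPoly B f - natPoly B g = p.map (Int.castRingHom ℚ) := by
  ext j
  rw [coeff_sub, coeff_natPoly, coeff_natPoly, coeff_map]
  split_ifs with h
  · rw [hf j h, hg j h]
    have := Int.toNat_sub_toNat_neg (p.coeff j)
    rw [eq_intCast]
    nth_rewrite 3 [← this]
    push_cast
    rfl
  · rw [coeff_eq_zero_of_natDegree_lt (by omega)]
    simp

/-- Every matrix of polynomials with integer coefficients whose rows and columns are indexed by
matchings, and every scalar polynomial, come from a certificate. -/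
theorem exists_tablePoly_eq (V : Matching w → Matching w → ℤ[X]) (d : ℤ[X]) :
    ∃ t : Certificate, scalarPoly t = d.map (Int.castRingHom ℚ) ∧
      ∀ m e : Matching w, tablePoly t (code m) (code e) = (V m e).map (Int.castRingHom ℚ) := by
  obtain ⟨B, hd, hV⟩ : ∃ B, d.natDegree < B ∧ ∀ m e, (V m e).natDegree < B := by
    refine ⟨d.natDegree + ∑ m, ∑ e, (V m e).natDegree + 1, by omega, fun m e => ?_⟩
    have h1 := Finset.single_le_sum (f := fun e => (V m e).natDegree) (fun _ _ => Nat.zero_le _)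
      (Finset.mem_univ e)
    have h2 := Finset.single_le_sum (f := fun m => ∑ e, (V m e).natDegree)
      (fun _ _ => Nat.zero_le _) (Finset.mem_univ m)
    omega
  -- The matrix is indexed by codes, with zero at numbers that encode no matching.
  let T : ℕ → ℕ → ℤ[X] := fun c e => Function.extend
    (fun p : Matching w × Matching w => (code p.1, code p.2)) (fun p => V p.1 p.2) 0 (c, e)
  have hT : ∀ m e, T (code m) (code e) = V m e := fun m e =>
    Function.Injective.extend_apply (f := fun p : Matching w × Matching w => (code p.1, code p.2))
      (fun p q h => Prod.ext (code_injective (congrArg Prod.fst h))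
        (code_injective (congrArg Prod.snd h))) (fun p => V p.1 p.2) 0 (m, e)
  let N := codeBound (wordsInput w)
  refine ⟨((tableOf N B fun c e j => ((T c e).coeff j).toNat,
      tableOf N B fun c e j => (-(T c e).coeff j).toNat),
    ((List.range B).map fun j => (d.coeff j).toNat,
      (List.range B).map fun j => (-d.coeff j).toNat)), ?_, fun m e => ?_⟩
  · rw [scalarPoly]
    simp only [List.length_map, List.length_range]
    exact natPoly_sub_natPoly hd (fun j hj => getD_map_range _ hj) fun j hj => getD_map_range _ hj
  · rw [tablePoly]
    simp only [List.length_map, List.length_range]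
    refine natPoly_sub_natPoly (hV m e) (fun j hj => ?_) fun j hj => ?_
    · rw [tableEntry_tableOf _ (code_lt m) (code_lt e) hj, hT]
    · rw [tableEntry_tableOf _ (code_lt m) (code_lt e) hj, hT]

variable (w) in
-- The adjugate and the determinant of the Gram matrix over `ℤ[X]` serve. The determinant remains
-- nonzero after mapping to `ℚ[X]`, by definiteness at large `n`.
theorem exists_isCertificate : ∃ t, IsCertificate (wordsInput w) t := by
  let G : Matrix (Matching w) (Matching w) ℤ[X] := gram Matching.full X
  obtain ⟨t, ht, ht'⟩ := exists_tablePoly_eq G.adjugate G.det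
  have hmap : ∀ p : ℤ[X], p.map (Int.castRingHom ℚ) = mapRingHom (Int.castRingHom ℚ) p :=
    fun p => rfl
  refine ⟨t, (isCertificate_iff t).mpr ⟨?_, fun m m' => ?_⟩⟩
  · rw [ht, hmap, RingHom.map_det, RingHom.mapMatrix_apply, gram_map, coe_mapRingHom, map_X]
    exact det_gram_X_ne_zero _ Matching.full_injective
  · have h := congrArg (mapRingHom (Int.castRingHom ℚ))
      (congrFun (congrFun (Matrix.adjugate_mul G) m) m')
    rw [Matrix.mul_apply, map_sum] at h
    simp only [map_mul, G, gram, Matrix.of_apply, map_pow, coe_mapRingHom, map_X,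
      Matrix.smul_apply, Matrix.one_apply, smul_eq_mul, mul_ite, mul_one, mul_zero] at h
    simp only [ht, ht', G, gram]
    rw [h]
    split_ifs <;> simp

theorem exists_searchStep_eq_some (W : List (List (Fin r × Bool))) :
    ∃ k s, searchStep W k = some s := by
  classical
  by_cases hW : IsReducedInput W
  · obtain ⟨ℓ, w, rfl⟩ := exists_wordsInput_eq hW
    obtain ⟨t, ht⟩ := exists_isCertificate w
    exact ⟨Encodable.encode t, outputOf _ t, by
      rw [searchStep, if_pos hW, Encodable.encodek, Option.bind_some, if_pos ht]⟩
  -- Inputs that are not reduced receive a default output, so the search ends on every input.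
  · exact ⟨0, ([], []), by simp [searchStep, hW]⟩

theorem exists_certificate_of_searchStep {k : ℕ} {s : List ℤ × List ℤ}
    (h : searchStep (wordsInput w) k = some s) :
    ∃ t, IsCertificate (wordsInput w) t ∧ outputOf (wordsInput w) t = s := by
  classical
  rw [searchStep, if_pos (isReducedInput_wordsInput w), Option.bind_eq_some_iff] at h
  obtain ⟨t, -, h⟩ := h
  split_ifs at h with ht
  · exact ⟨t, ht, Option.some_inj.mp h⟩

theorem sum_wg_mul {α : Type*} [Fintype α] [DecidableEq α] (τ : Equiv.Perm α) :
    ∑ σ, Wg σ * (RatFunc.X : RatFunc ℚ) ^ numCycles (σ⁻¹ * τ) = if τ = 1 then 1 else 0 := by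
  have hd : algebraMap ℚ[X] (RatFunc ℚ) (permGram α).det ≠ 0 := by
    rw [Ne, FaithfulSMul.algebraMap_eq_zero_iff]
    exact det_gram_X_ne_zero _ (fun _ _ h => h)
  have h := congrArg (algebraMap ℚ[X] (RatFunc ℚ)) (sum_adjugate_mul τ)
  simp only [map_sum, map_mul, map_pow, RatFunc.algebraMap_X] at h
  simp only [wg_eq_div, div_mul_eq_mul_div, ← Finset.sum_div, h]
  split_ifs
  · exact div_self hd
  · rw [map_zero, zero_div]

theorem sum_wg_trans_mul {α β : Type*} [Fintype α] [DecidableEq α] [Fintype β] [DecidableEq β]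
    (m m' : α ≃ β) : ∑ e : α ≃ β, Wg (e.trans m.symm) *
      (RatFunc.X : RatFunc ℚ) ^ numCycles (m'.trans e.symm) = if m = m' then 1 else 0 := by
  have h := sum_wg_mul (m'.trans m.symm)
  have h1 : (m'.trans m.symm = 1) ↔ m = m' := by
    constructor
    · intro h
      ext a
      have h' : m.symm (m' a) = a := DFunLike.congr_fun h a
      rw [← h', Equiv.apply_symm_apply, h']
    · rintro rfl
      ext a
      simp
  simp only [h1] at h
  rw [← h, ← Equiv.sum_comp (Equiv.equivCongr (Equiv.refl α) m)]
  refine Finset.sum_congr rfl fun σ _ => ?_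
  congr 2
  · ext a
    simp

theorem numCycles_full (m e : Matching w) :
    numCycles (m.full.trans e.full.symm) = ∑ x, numCycles ((m x).trans (e x).symm) := by
  have h1 := numCycles_add_defect (m.full.trans e.full.symm)
  have h2 : defect (m.full.trans e.full.symm) = ∑ x, defect ((m x).trans (e x).symm) :=
    defect_sigmaCongrRight fun x => (m x).trans (e x).symm
  have h3 : ∑ x, numCycles ((m x).trans (e x).symm) + ∑ x, defect ((m x).trans (e x).symm) =
      ∑ x, Fintype.card (PosLetter w x) := by
    rw [← Finset.sum_add_distrib]
    exact Finset.sum_congr rfl fun x _ => numCycles_add_defect _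
  rw [h2, Fintype.card_sigma] at h1
  omega

/-- Cycle numbers add over the basis letters, so the Gram matrix of matchings is a tensor product,
and its inverse is the tensor product of the inverses. -/
theorem sum_prod_wg_mul (m m' : Matching w) :
    ∑ e : Matching w, (∏ x, Wg ((e x).trans (m x).symm)) *
      (RatFunc.X : RatFunc ℚ) ^ numCycles (m'.full.trans e.full.symm) =
        if m = m' then 1 else 0 := by
  have h : ∀ e : Matching w, (∏ x, Wg ((e x).trans (m x).symm)) *
      (RatFunc.X : RatFunc ℚ) ^ numCycles (m'.full.trans e.full.symm) =
        ∏ x, (Wg ((e x).trans (m x).symm) *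
          (RatFunc.X : RatFunc ℚ) ^ numCycles ((m' x).trans (e x).symm)) := fun e => by
    rw [numCycles_full, Finset.prod_mul_distrib, Finset.prod_pow_eq_pow_sum]
  simp only [h]
  have h2 := Finset.prod_univ_sum (fun _ => Finset.univ)
    fun x (e : PosLetter w x ≃ NegLetter w x) => Wg (e.trans (m x).symm) *
      (RatFunc.X : RatFunc ℚ) ^ numCycles ((m' x).trans e.symm)
  rw [Fintype.piFinset_univ] at h2
  rw [← h2]
  simp only [sum_wg_trans_mul]
  by_cases hm : m = m'
  · subst hm
    simp
  · rw [if_neg hm]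
    obtain ⟨x, hx⟩ := Function.ne_iff.mp hm
    exact Finset.prod_eq_zero (Finset.mem_univ x) (if_neg hx)

/-- Both sides are left inverses of the same square matrix and hence agree. The quotient does not
depend on which certificate the search finds. -/
theorem tablePoly_div_scalarPoly {t : Certificate} (ht : IsCertificate (wordsInput w) t)
    (m e : Matching w) : algebraMap ℚ[X] (RatFunc ℚ) (tablePoly t (code m) (code e)) /
      algebraMap ℚ[X] (RatFunc ℚ) (scalarPoly t) = ∏ x, Wg ((e x).trans (m x).symm) := by
  obtain ⟨h0, h⟩ := (isCertificate_iff t).mp ht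
  have hd : algebraMap ℚ[X] (RatFunc ℚ) (scalarPoly t) ≠ 0 := by
    rwa [Ne, FaithfulSMul.algebraMap_eq_zero_iff]
  let A : Matrix (Matching w) (Matching w) (RatFunc ℚ) := Matrix.of fun m e =>
    algebraMap ℚ[X] (RatFunc ℚ) (tablePoly t (code m) (code e)) /
      algebraMap ℚ[X] (RatFunc ℚ) (scalarPoly t)
  let Z : Matrix (Matching w) (Matching w) (RatFunc ℚ) := Matrix.of fun m e =>
    ∏ x, Wg ((e x).trans (m x).symm)
  let G : Matrix (Matching w) (Matching w) (RatFunc ℚ) := gram Matching.full RatFunc.X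
  have hA : A * G = 1 := by
    ext m m'
    have h1 := congrArg (algebraMap ℚ[X] (RatFunc ℚ)) (h m m')
    simp only [map_sum, map_mul, map_pow, RatFunc.algebraMap_X] at h1
    simp only [Matrix.mul_apply, A, G, gram, Matrix.of_apply, div_mul_eq_mul_div,
      ← Finset.sum_div, h1, Matrix.one_apply]
    split_ifs
    · exact div_self hd
    · rw [map_zero, zero_div]
  have hZ : Z * G = 1 := by
    ext m m'
    simp only [Matrix.mul_apply, Z, G, gram, Matrix.of_apply, Matrix.one_apply]
    exact sum_prod_wg_mul m m'
  have hAZ : A = Z := left_inv_eq_right_inv hA (mul_eq_one_comm.mp hZ)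
  exact congrFun (congrFun hAZ m) e

theorem ratOfLists_outputOf {t : Certificate} (ht : IsCertificate (wordsInput w) t) :
    ratOfLists (outputOf (wordsInput w) t) = RatFunc.X ^ numTrivial w *
      ∑ σ : MatchPairs w, (∏ x, Wg ((σ x 1).trans (σ x 0).symm)) * RatFunc.X ^ numODiscs σ := by
  rw [ratOfLists, polyOfList_outputOf_fst, polyOfList_outputOf_snd,
    ← Equiv.sum_comp matchPairEquiv, Fintype.sum_prod_type]
  simp only [map_mul, map_sum, map_pow, RatFunc.algebraMap_X]
  rw [mul_div_assoc]
  simp only [Finset.sum_div]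
  congr 1
  refine Finset.sum_congr rfl fun m _ => Finset.sum_congr rfl fun e _ => ?_
  rw [mul_div_right_comm, tablePoly_div_scalarPoly ht]
  rfl

theorem hasValueAt_ratOfLists {t : Certificate} (ht : IsCertificate (wordsInput w) t) {n : ℕ}
    (hn : ∀ x, L w x ≤ n) : HasValueAt (ratOfLists (outputOf (wordsInput w) t)) n
      ((n : ℚ) ^ numTrivial w * ∑ σ : MatchPairs w,
        (∏ x, wgAt n ((σ x 1).trans (σ x 0).symm)) * (n : ℚ) ^ numODiscs σ) := by
  rw [ratOfLists_outputOf ht]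
  exact ((hasValueAt_X n).pow _).mul (HasValueAt.sum _ fun σ _ =>
    (HasValueAt.prod _ fun x _ => hasValueAt_wg (hn x) _).mul ((hasValueAt_X n).pow _))

theorem exists_computable_rational_function (r : ℕ) :
    ∃ alg : List (List (Fin r × Bool)) → List ℤ × List ℤ, Computable alg ∧
      ∀ (ℓ : ℕ) (w : Words r ℓ), polyOfList (alg (wordsInput w)).2 ≠ 0 ∧
        ∀ n : ℕ, (∀ x, L w x ≤ n) → HasNoPoleAt (ratOfLists (alg (wordsInput w))) n ∧
          Tr w n = ((evalAt (ratOfLists (alg (wordsInput w))) n : ℚ) : ℂ) := by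
  obtain ⟨alg, halg, h⟩ := exists_computable_search (primrec_searchStep (r := r))
    exists_searchStep_eq_some
  refine ⟨alg, halg, fun ℓ w => ?_⟩
  obtain ⟨k, hk⟩ := h (wordsInput w)
  obtain ⟨t, ht, hs⟩ := exists_certificate_of_searchStep hk
  rw [← hs]
  refine ⟨?_, fun n hn => ?_⟩
  · rw [polyOfList_outputOf_snd]
    exact ((isCertificate_iff t).mp ht).1
  · have hv := hasValueAt_ratOfLists ht hn
    exact ⟨hv.1, by rw [hv.2, tr_eq w hn]⟩

end Correctness

end UnitaryWords

theorem theorem2p5 (r : ℕ) :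
    -- for balanced non-trivial words: the finite sum, and the order of its summands
    (∀ (ℓ : ℕ) (w : UnitaryWords.Words r ℓ), (∀ i, w i ≠ 1) → UnitaryWords.Balanced w →
      (∀ n : ℕ, (∀ x, UnitaryWords.L w x ≤ n) →
        (∀ x (π : Equiv.Perm (UnitaryWords.PosLetter w x)),
          UnitaryWords.HasNoPoleAt (UnitaryWords.Wg π) n) ∧
        UnitaryWords.Tr w n =
          ((∑ σ : UnitaryWords.MatchPairs w, UnitaryWords.summand σ n : ℚ) : ℂ)) ∧
      (∀ σ : UnitaryWords.MatchPairs w,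
        (fun n : ℕ => (UnitaryWords.summand σ n : ℝ) -
            (UnitaryWords.moeb
              ((UnitaryWords.fullMatch σ 1).trans (UnitaryWords.fullMatch σ 0).symm) : ℝ) *
            (n : ℝ) ^ UnitaryWords.eulerChar σ)
          =O[Filter.atTop] (fun n : ℕ => (n : ℝ) ^ (UnitaryWords.eulerChar σ - 2)))) ∧
    -- for arbitrary words: an algorithm computes a rational function of `n` which is `Tr`
    (∃ alg : List (List (Fin r × Bool)) → List ℤ × List ℤ, Computable alg ∧
      ∀ (ℓ : ℕ) (w : UnitaryWords.Words r ℓ),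
        UnitaryWords.polyOfList (alg (UnitaryWords.wordsInput w)).2 ≠ 0 ∧
        ∀ n : ℕ, (∀ x, UnitaryWords.L w x ≤ n) →
          UnitaryWords.HasNoPoleAt
            (UnitaryWords.ratOfLists (alg (UnitaryWords.wordsInput w))) n ∧
          UnitaryWords.Tr w n =
            ((UnitaryWords.evalAt
              (UnitaryWords.ratOfLists (alg (UnitaryWords.wordsInput w))) n : ℚ) : ℂ)) := by
  refine ⟨fun ℓ w hw _ => ⟨fun n hn => ⟨fun x π => ?_, ?_⟩, fun σ => ?_⟩, ?_⟩
  · exact (UnitaryWords.hasValueAt_wg (hn x) π).1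
  · exact UnitaryWords.tr_eq_sum_summand hw hn
  · exact UnitaryWords.summand_sub_isBigO σ
  · exact UnitaryWords.exists_computable_rational_function r
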